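/- Let $1\le M\le N$ be integers and let $\alpha\ge 0$, $\eta,\theta>0$ be real. For integers $-M+1\le t\le N-1$ put $L_t=M-|t|$ if $t\le 0$ and $L_t=\min(N-t,M)$ if $t>0$. For vectors $\mathbf x,\mathbf y$ write $\mathbf y\prec\mathbf x$ if $x_1<y_1<x_2<y_2<\cdots$ (until the shorter vector is exhausted). The continuous Muttalib--Borodin process $(\mathbf x^{(t)})_{-M+1\le t\le N-1}$ consists of random increasing vectors $\mathbf x^{(t)}\in(0,1)^{L_t}$ with $$\mathbf x^{(-M+1)}\prec\cdots\prec\mathbf x^{(-1)}\prec\mathbf x^{(0)}\succ\mathbf x^{(1)}\succ\cdots\succ\mathbf x^{(N-1)},$$ whose joint law has on this set a density, with respect to Lebesgue measure, proportional to $$\prod_{t<0}\prod_{i}\big(x^{(t)}_i\big)^{\eta-1}\cdot\prod_{i}\big(x^{(0)}_i\big)^{\alpha+\frac{\eta+\theta}{2}-1}\cdot\prod_{t>0}\prod_{i}\big(x^{(t)}_i\big)^{\theta-1}.$$ Theorem. This law is a well-defined probability measure and the process is determinantal: for all $n$ and all times $t_1,\dots,t_n\in\{-M+1,\dots,N-1\}$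 (repetitions allowed) the $n$-point correlation function at these times, with respect to Lebesgue measure on $(0,1)^n$, is $$\rho(t_1,x_1;\dots;t_n,x_n)=\det_{1\le k,\ell\le n}K_c(t_k,x_k;t_\ell,x_\ell);$$ that is, for every Borel set $B\subseteq(0,1)^n$ the expected number of $n$-tuples of distinct particles, the $k$-th one from slice $\mathbf x^{(t_k)}$, with vector of positions in $B$ is the integral over $B$ of this (integrable) determinant. Moreover, for $t_1<\dots<t_n$ and pairwise distinct $x_1,\dots,x_n\in(0,1)$, $$\lim_{h\to0+}h^{-n}\,\mathbb P\Big[\bigcap_{k=1}^n\big\{\text{slice }\mathbf x^{(t_k)}\text{ has a particle in }(x_k,x_k+h)\big\}\Big]=\det_{1\le k,\ell\le n}K_c(t_k,x_k;t_\ell,x_\ell).$$ The extended kernel is $$K_c(s,x;t,y)=\frac1{\sqrt{xy}}\int\limits_{\delta+i\mathbb R}\frac{d\zeta}{2\pi i}\int\limits_{-\delta+i\mathbb R}\frac{d\omega}{2\pi i}\,\frac{F_c(s,\zeta)}{F_c(t,\omega)}\frac{x^\zeta}{y^\omega}\frac1{\zeta-\omega}-\frac{\mathbf 1_{[s>t]}}{\sqrt{xy}}\int\limits_{\delta+i\mathbb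 R}\frac{d\zeta}{2\pi i}\,\frac{F_c(s,\zeta)}{F_c(t,\zeta)}\Big(\frac xy\Big)^{\zeta},$$ $$F_c(s,\zeta)=\frac{\theta^{N-s^+}}{\eta^{M-s^-}}\cdot\frac{\big(\frac{\alpha}{2\theta}+\frac{\zeta}{\theta}+s^++\frac12\big)_{N-s^+}}{\big(\frac{\alpha}{2\eta}-\frac{\zeta}{\eta}+s^-+\frac12\big)_{M-s^-}},\qquad (z)_n=\prod_{0\le i<n}(z+i),\quad s^\pm=\max(\pm s,0),$$ where $0<\delta<\min\big(\frac{\alpha+\eta}2,\frac{\alpha+\theta}2\big)$ is arbitrary. The vertical lines are oriented bottom-to-top; since the integrals over them need not converge absolutely, they are understood as closed up at infinity. That is, in the double integral $\delta+i\mathbb R$ is replaced by the clockwise circle with centre $\delta+R$ and radius $R$, and $-\delta+i\mathbb R$ by the counterclockwise circle with centre $-\delta-R$ and radius $R$; in the single integral the line is replaced by the first circle if $x\le y$ and by the second one if $x>y$. Here $R$ is any number with $\delta+2R>\frac\alpha2+\eta(M-\frac12)$ and $\delta+2R>\frac\alpha2+\theta(N-\frac12)$, so that all relevant poles are enclosed.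 Equivalently, for all $x,y\in(0,1)$ (with $x\ne y$ if $s=t+1$), $K_c(s,x;t,y)$ is the limit as $\varepsilon\to0+$ of the displayed formula with the plain vertical lines and with the integrands multiplied by $e^{\varepsilon(\zeta^2+\omega^2)}$ and $e^{\varepsilon\zeta^2}$, respectively. -/

import Mathlib

noncomputable section

namespace MBP

open MeasureTheory Set

/-! ### The continuous Muttalib--Borodin process -/

/-- The discrete times `-M+1 ≤ t ≤ N-1`. -/
abbrev Time (M N : ℕ) : Type := ↥(Finset.Icc (-(M : ℤ) + 1) ((N : ℤ) - 1))

/-- The number `L_t` of particles at time `t`: it is `M - |t|` if `-M ≤ t ≤ 0`, and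
`min (N - t) M` if `0 < t ≤ N`. -/
def numPts (M N : ℕ) (t : ℤ) : ℕ :=
  if t ≤ 0 then M - t.natAbs else min (N - t.natAbs) M

/-- Configurations: a vector of `L_t` real numbers for each time `t`. The coordinate with index
`i : Fin L_t` is the particle usually written `x_{i+1}^{(t)}`. -/
abbrev Config (M N : ℕ) : Type := (t : Time M N) → Fin (numPts M N t) → ℝ

/-- Interlacing `y ≺ x`: `x₁ < y₁ < x₂ < y₂ < ⋯` (until the shorter vector is exhausted;
vectors may be thought of as continued by `1, 1, 1, …`). -/
def Interlaces {m n : ℕ} (y : Fin m → ℝ) (x : Fin n → ℝ) : Prop :=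
  (∀ (i : Fin n) (j : Fin m), (i : ℕ) = j → x i < y j) ∧
  (∀ (i : Fin n) (j : Fin m), (i : ℕ) = j + 1 → y j < x i)

/-- Admissible configurations: increasing vectors with entries in `(0,1)` such that
`x^(-M+1) ≺ ⋯ ≺ x^(-1) ≺ x^(0) ≻ x^(1) ≻ ⋯ ≻ x^(N-1)`. -/
def admissible (M N : ℕ) : Set (Config M N) :=
  {X | (∀ t, StrictMono (X t)) ∧ (∀ t i, X t i ∈ Ioo (0 : ℝ) 1) ∧
    ∀ s t : Time M N, (t : ℤ) = s + 1 →
      if (t : ℤ) ≤ 0 then Interlaces (X s) (X t) else Interlaces (X t) (X s)}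

/-- The exponent of the particles of slice `t` in the density. -/
def slotExponent (α η θ : ℝ) (t : ℤ) : ℝ :=
  if t < 0 then η - 1 else if t = 0 then α + (η + θ) / 2 - 1 else θ - 1

/-- The unnormalized law: on admissible configurations it has Lebesgue density
`∏_{t<0} ∏_i (x_i^(t))^(η-1) · ∏_i (x_i^(0))^(α+(η+θ)/2-1) · ∏_{t>0} ∏_i (x_i^(t))^(θ-1)`. -/
def weightMeasure (M N : ℕ) (α η θ : ℝ) : Measure (Config M N) :=
  ((volume : Measure (Config M N)).restrict (admissible M N)).withDensity
    fun X => ENNReal.ofReal (∏ t, ∏ i, X t i ^ slotExponent α η θ t)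

/-- The law of the continuous Muttalib--Borodin process. -/
def law (M N : ℕ) (α η θ : ℝ) : Measure (Config M N) :=
  (weightMeasure M N α η θ univ)⁻¹ • weightMeasure M N α η θ

open Classical in
/-- The `n`-point correlation (factorial moment) measure at times `t₁, …, t_n` (repetitions are
allowed): the measure of `B` is the expected number of `n`-tuples of distinct particles, the `k`-th
one taken from slice `t_k`, whose vector of positions lies in `B`. -/
def corrMeasure (M N : ℕ) (α η θ : ℝ) {n : ℕ} (t : Fin n → Time M N) : Measure (Fin n → ℝ) :=
  ∑ σ : (k : Fin n) → Fin (numPts M N (t k)),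
    if Function.Injective
        (fun k => (⟨t k, σ k⟩ : (u : Time M N) × Fin (numPts M N u))) then
      (law M N α η θ).map (fun X k => X (t k) (σ k))
    else 0

/-! ### The kernel -/

/-- The function `F_c(s, ζ)`, with `s⁺ = s.toNat` and `s⁻ = (-s).toNat`. -/
def Fc (M N : ℕ) (α η θ : ℝ) (s : ℤ) (ζ : ℂ) : ℂ :=
  (θ : ℂ) ^ (N - s.toNat) / (η : ℂ) ^ (M - (-s).toNat) *
    ((ascPochhammer ℂ (N - s.toNat)).eval (α / (2 * θ) + ζ / θ + (s.toNat : ℂ) + 1 / 2) /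
      (ascPochhammer ℂ (M - (-s).toNat)).eval
        (α / (2 * η) - ζ / η + ((-s).toNat : ℂ) + 1 / 2))

/-- The integrand `F_c(s,ζ)/F_c(t,ω) · x^ζ/y^ω · 1/(ζ-ω)`. -/
def doubleIntegrand (M N : ℕ) (α η θ : ℝ) (s : ℤ) (x : ℝ) (t : ℤ) (y : ℝ) (ζ ω : ℂ) : ℂ :=
  Fc M N α η θ s ζ / Fc M N α η θ t ω * ((x : ℂ) ^ ζ / (y : ℂ) ^ ω) * (1 / (ζ - ω))

/-- The integrand `F_c(s,ζ)/F_c(t,ζ) · (x/y)^ζ`. -/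
def singleIntegrand (M N : ℕ) (α η θ : ℝ) (s : ℤ) (x : ℝ) (t : ℤ) (y : ℝ) (ζ : ℂ) : ℂ :=
  Fc M N α η θ s ζ / Fc M N α η θ t ζ * ((x / y : ℝ) : ℂ) ^ ζ

/-- `∫ f(z) dz/(2πi)` over the vertical line `c + iℝ`, oriented bottom-to-top. -/
def vertInt (c : ℝ) (f : ℂ → ℂ) : ℂ :=
  (2 * Real.pi * Complex.I)⁻¹ * ∫ τ : ℝ, f (c + τ * Complex.I) * Complex.I

/-- `∮ f(z) dz/(2πi)` over the circle of radius `R` which touches the line `δ + iℝ` at `δ` from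
the right, oriented clockwise (hence upwards at `δ`): the line `δ + iℝ` closed up on the right. -/
def rightInt (δ R : ℝ) (f : ℂ → ℂ) : ℂ :=
  -((2 * Real.pi * Complex.I)⁻¹ * ∮ z in C(((δ + R : ℝ) : ℂ), R), f z)

/-- `∮ f(z) dz/(2πi)` over the circle of radius `R` which touches the line `-δ + iℝ` at `-δ` from
the left, oriented counterclockwise (hence upwards at `-δ`): the line `-δ + iℝ` closed up on the
left. -/
def leftInt (δ R : ℝ) (f : ℂ → ℂ) : ℂ :=
  (2 * Real.pi * Complex.I)⁻¹ * ∮ z in C((-(δ + R) : ℝ), R), f z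

/-- The extended kernel `K_c(s,x;t,y)` with closed contours. In the double integral the `ζ`-contour
is closed on the right and the `ω`-contour on the left; the contour of the single integral is closed
on the left if `x > y` and on the right if `x ≤ y`. -/
def Kc (M N : ℕ) (α η θ δ R : ℝ) (s : ℤ) (x : ℝ) (t : ℤ) (y : ℝ) : ℂ :=
  1 / (Real.sqrt (x * y) : ℂ) *
      rightInt δ R (fun ζ => leftInt δ R (fun ω => doubleIntegrand M N α η θ s x t y ζ ω)) -
    if t < s then
      1 / (Real.sqrt (x * y) : ℂ) *
        (if y < x then leftInt δ R (singleIntegrand M N α η θ s x t y)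
          else rightInt δ R (singleIntegrand M N α η θ s x t y))
    else 0

/-- The same kernel with the vertical lines `ζ ∈ δ + iℝ`, `ω ∈ -δ + iℝ`, the integrands being
multiplied by the Gaussian factors `exp (ε (ζ² + ω²))` and `exp (ε ζ²)`. For `ε = 0` it is the
formula with plain vertical lines; in general those integrals do not converge absolutely, and are
to be understood through the limit `ε → 0+`. -/
def KcVert (M N : ℕ) (α η θ δ ε : ℝ) (s : ℤ) (x : ℝ) (t : ℤ) (y : ℝ) : ℂ :=
  1 / (Real.sqrt (x * y) : ℂ) *
      vertInt δ (fun ζ => vertInt (-δ) (fun ω =>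
        Complex.exp (ε * (ζ ^ 2 + ω ^ 2)) * doubleIntegrand M N α η θ s x t y ζ ω)) -
    if t < s then
      1 / (Real.sqrt (x * y) : ℂ) *
        vertInt δ (fun ζ => Complex.exp (ε * ζ ^ 2) * singleIntegrand M N α η θ s x t y ζ)
    else 0

/-- The determinant `det_{k,l} K_c(t_k, x_k; t_l, x_l)`. -/
def corrDet (M N : ℕ) (α η θ δ R : ℝ) {n : ℕ} (t : Fin n → Time M N) (x : Fin n → ℝ) : ℂ :=
  (Matrix.of fun k l : Fin n => Kc M N α η θ δ R (t k) (x k) (t l) (x l)).det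

/-- The open cube `(0,1)^n`. -/
def cube (n : ℕ) : Set (Fin n → ℝ) := univ.pi fun _ => Ioo (0 : ℝ) 1

end MBP

end

/-!
The process is a family of nonintersecting paths in disguise. Its correlation functions are given by
an Eynard–Mehta kernel, which can be made explicit.

*Transfer functions.* Let `lam k` be the zeros and poles of the functions `F_c`, listed so that they
decrease: those with `k < 0` lie to the right of `δ`, those with `k ≥ 0` to the left of `-δ`. Then
`F_c(s, ζ) / F_c(t, ζ)` is the product over `t ≤ j < s` of the one-step factors `ε_j / (ζ - lam j)`
(`Fc_div_Fc`). Its partial fractions give transition kernels `trans` from time `t` to time `s`, which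
form a semigroup (`trans_conv`). A one-step kernel is the indicator of an inequality times powers of
the positions (`trans_step`), hence the determinant of one step detects interlacing (`det_step`). Let
the number of particles change by sources and sinks, all at position `1`: one source at each of the
times `-M, …, -1`, and one sink at each of the times `N - M + 1, …, N`. Then the determinant of the
transition kernels between all particles, sources and sinks is block triangular in time, and its
value is the density of the process (`det_segMat`).

*Correlations.* If `B` inverts the transposed matrix `linkMat` of transition kernels from sources to
sinks, a Schur complement turns this determinant, up to a constant, into the determinant over all
particles of the kernel `corrKer = pathKer - trans` (`exists_fullDet_eq`). By the semigroup property
`corrKer` has the trace and convolution identities `corrKer_trace` and `corrKer_conv`, so that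
particles can be integrated out one at a time (`setIntegral_kerDet_cons`). This yields the
normalization and all correlation functions at once (`weight_correlations`), after symmetrization
over the labels within each slice. The integrals converge because the kernel is bounded by powers of
the positions whose time-dependent parts cancel in every term of the determinant
(`exists_abs_corrKer_le`, `integrableOn_kerDet`). If more points than particles are placed in a
slice, the determinant vanishes by a rank argument (`det_corrKer_eq_zero`).

*The kernel.* The inverse `B` is explicit, by Lagrange interpolation at the poles on the right; the
source and sink polynomials combine with it into a Bezoutian with denominator `lam k - lam m`
(`exists_inverse`). This is the factor `1 / (ζ - ω)` of the double contour integral, and summing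
residues identifies `corrKer` with `K_c` (`Kc_eq`).

*Infinitesimal form.* The kernel determinant is continuous at distinct positions, and a Bonferroni
inequality compares the probability of the event with the `n`-point correlation
(`tendsto_prob_div_pow`).

*Vertical lines.* The function `exp (ε z² + L z)` has its saddle point at `-L / (2 ε)`. Moving a
vertical line there picks up the residues on the side where `exp (L z)` decays and leaves an error of
order `exp (-L² / (4 ε))` up to powers of `1 / ε` (`exists_norm_vertInt_sub_le`). This applies with
`L = log (x / y)` to the single integral, and with `L = -log y > 0` and `L = log x < 0` to the inner
and outer parts of the double integral (`tendsto_vertInt_double`). For `x = y` and `s ≥ t + 2` the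
single integrand decays quadratically, and dominated convergence takes over
(`tendsto_vertInt_single_one`).
-/

noncomputable section

namespace MBP

open MeasureTheory Set

variable {lam : ℤ → ℝ} {δ R : ℝ} {M N : ℕ}

/-! ### Linear algebra -/

/-- Expansion of a bordered determinant along its border. -/
theorem det_bordered {n : ℕ} (A : Matrix (Fin (n + 1)) (Fin (n + 1)) ℝ) :
    A.det = A 0 0 * (A.submatrix Fin.succ Fin.succ).det -
      ∑ l, ∑ k, A 0 (Fin.succ l) * (A.submatrix Fin.succ Fin.succ).adjugate l k *
        A (Fin.succ k) 0 := by
  rw [Matrix.det_succ_row_zero, Fin.sum_univ_succ]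
  simp only [Fin.val_zero, pow_zero, one_mul, Fin.succAbove_zero, Fin.val_succ]
  rw [sub_eq_add_neg, ← Finset.sum_neg_distrib]
  congr 1
  refine Finset.sum_congr rfl fun l _ => ?_
  rcases n with _ | n
  · exact l.elim0
  rw [Matrix.det_succ_column_zero, Finset.mul_sum, ← Finset.sum_neg_distrib]
  refine Finset.sum_congr rfl fun k _ => ?_
  rw [Matrix.adjugate_fin_succ_eq_det_submatrix]
  have h : ((A.submatrix Fin.succ (Fin.succ l).succAbove).submatrix k.succAbove Fin.succ) =
      (A.submatrix Fin.succ Fin.succ).submatrix k.succAbove l.succAbove := by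
    ext i j
    simp [Matrix.submatrix_apply]
  rw [h]
  simp only [Matrix.submatrix_apply, Fin.succ_succAbove_zero]
  ring

/-- A matrix is singular if the submatrix with rows `p` and columns `q` factors through dimension
`d` and `d` plus the number of remaining rows is smaller than the number of these columns. -/
theorem det_eq_zero_of_factor {ι : Type*} [Fintype ι] [DecidableEq ι] {d : ℕ}
    (A : Matrix ι ι ℝ) (p q : ι → Prop) [DecidablePred p] [DecidablePred q]
    (U : ι → Fin d → ℝ) (V : Fin d → ι → ℝ)
    (h : ∀ i j, p i → q j → A i j = ∑ l, U i l * V l j)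
    (hc : d + Fintype.card {i // ¬ p i} < Fintype.card {j // q j}) : A.det = 0 := by
  classical
  let f : ({j // q j} → ℝ) →ₗ[ℝ] ((Fin d → ℝ) × ({i // ¬ p i} → ℝ)) :=
    { toFun := fun v => (fun l => ∑ j, V l j.1 * v j, fun i => ∑ j, A i.1 j.1 * v j)
      map_add' := by
        intro v w
        ext l <;> simp [mul_add, Finset.sum_add_distrib]
      map_smul' := by
        intro c v
        ext l <;> simp [Finset.mul_sum, mul_left_comm] }
  have hk : LinearMap.ker f ≠ ⊥ := by
    apply LinearMap.ker_ne_bot_of_finrank_lt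
    simpa using hc
  obtain ⟨v, hv, hv0⟩ := (Submodule.ne_bot_iff _).1 hk
  rw [LinearMap.mem_ker] at hv
  have h1 : ∀ l, ∑ j, V l j.1 * v j = 0 := fun l => congrFun (congrArg Prod.fst hv) l
  have h2 : ∀ i : {i // ¬ p i}, ∑ j, A i.1 j.1 * v j = 0 :=
    fun i => congrFun (congrArg Prod.snd hv) i
  refine Matrix.exists_mulVec_eq_zero_iff.1
    ⟨fun j => if hj : q j then v ⟨j, hj⟩ else 0, ?_, ?_⟩
  · intro h0
    apply hv0
    ext j
    have := congrFun h0 j.1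
    simpa [j.2] using this
  · have key : ∀ i, (∑ j, A i j * (if hj : q j then v ⟨j, hj⟩ else 0)) =
        ∑ j : {j // q j}, A i j.1 * v j := by
      intro i
      have h3 : ∀ j, A i j * (if hj : q j then v ⟨j, hj⟩ else 0) =
          if q j then A i j * (if hj : q j then v ⟨j, hj⟩ else 0) else 0 := by
        intro j
        by_cases hj : q j <;> simp [hj]
      rw [Finset.sum_congr rfl fun j _ => h3 j, ← Finset.sum_filter,
        Finset.sum_subtype (p := q) _ (by simp)]
      exact Finset.sum_congr rfl fun j _ => by simp [j.2]
    ext i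
    simp only [Matrix.mulVec, dotProduct, Pi.zero_apply]
    rw [key]
    by_cases hp : p i
    · have : ∀ j : {j // q j}, A i j.1 * v j = ∑ l, U i l * (V l j.1 * v j) := by
        intro j
        rw [h i j.1 hp j.2, Finset.sum_mul]
        exact Finset.sum_congr rfl fun l _ => by ring
      simp_rw [this]
      rw [Finset.sum_comm]
      simp_rw [← Finset.mul_sum, h1]
      simp
    · exact h2 ⟨i, hp⟩

/-! ### Partial fractions -/

/-- The residue at `lam k` of `∏_{j ∈ S} eps j / (z - lam j)`, for `k ∈ S`. -/
def pfCoef {ι F : Type*} [DecidableEq ι] [Field F] (lam eps : ι → F) (S : Finset ι) (k : ι) : F :=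
  eps k * ∏ j ∈ S.erase k, eps j / (lam k - lam j)

/-- Partial fraction decomposition of a product of simple fractions with distinct poles. -/
theorem prod_eq_sum_pfCoef {ι F : Type*} [DecidableEq ι] [Field F] {lam : ι → F} (eps : ι → F)
    (hl : Function.Injective lam) {S : Finset ι} (hS : S.Nonempty) :
    ∀ z : F, (∀ k ∈ S, z ≠ lam k) →
      ∏ j ∈ S, eps j / (z - lam j) = ∑ k ∈ S, pfCoef lam eps S k / (z - lam k) := by
  induction hS using Finset.Nonempty.cons_induction with
  | singleton a => intro z _; simp [pfCoef]
  | cons m S hm hS ih =>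
    intro z hz
    rw [Finset.prod_cons, Finset.sum_cons, ih z fun k hk => hz k (Finset.mem_cons_of_mem hk)]
    have hzm : z - lam m ≠ 0 := sub_ne_zero.2 (hz m (Finset.mem_cons_self m S))
    have e1 : pfCoef lam eps (Finset.cons m S hm) m =
        eps m * ∑ k ∈ S, pfCoef lam eps S k / (lam m - lam k) := by
      rw [pfCoef, ← ih (lam m) fun k hk h => hm (hl h ▸ hk)]
      simp [Finset.cons_eq_insert, hm]
    have e2 : ∀ k ∈ S, pfCoef lam eps (Finset.cons m S hm) k =
        pfCoef lam eps S k * (eps m / (lam k - lam m)) := by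
      intro k hk
      have hkm : k ≠ m := fun h => hm (h ▸ hk)
      rw [pfCoef, pfCoef, Finset.cons_eq_insert, Finset.erase_insert_of_ne (Ne.symm hkm),
        Finset.prod_insert (fun h => hm (Finset.mem_of_mem_erase h))]
      ring
    rw [e1, Finset.mul_sum, Finset.mul_sum, Finset.sum_div, ← Finset.sum_add_distrib]
    refine Finset.sum_congr rfl fun k hk => ?_
    rw [e2 k hk]
    have hzk : z - lam k ≠ 0 := sub_ne_zero.2 (hz k (Finset.mem_cons_of_mem hk))
    have hkm : lam k - lam m ≠ 0 := sub_ne_zero.2 fun h => hm (hl h ▸ hk)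
    have hmk : lam m - lam k ≠ 0 := sub_ne_zero.2 fun h => hm (hl h ▸ hk)
    have : lam m - lam k = -(lam k - lam m) := by ring
    rw [this]
    field_simp
    ring

theorem pfCoef_union {ι F : Type*} [DecidableEq ι] [Field F] (lam eps : ι → F) {S U : Finset ι}
    (h : Disjoint S U) {k : ι} (hk : k ∈ S) :
    pfCoef lam eps (S ∪ U) k = pfCoef lam eps S k * ∏ j ∈ U, eps j / (lam k - lam j) := by
  have hU : k ∉ U := Finset.disjoint_left.1 h hk
  rw [pfCoef, pfCoef, Finset.erase_union_distrib, Finset.erase_eq_of_notMem hU,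
    Finset.prod_union (h.mono_left (Finset.erase_subset _ _)), mul_assoc]

/-- Polynomials `p 0, p 1, …` with `p i` of degree `i` span all polynomials. -/
theorem exists_eq_sum_of_natDegree {F : Type*} [Field F] (p : ℕ → Polynomial F)
    (hp : ∀ i, (p i).natDegree = i) (hp0 : ∀ i, p i ≠ 0) (n : ℕ) :
    ∀ f : Polynomial F, f.degree < n → ∃ c : ℕ → F,
      f = ∑ i ∈ Finset.range n, Polynomial.C (c i) * p i := by
  induction n with
  | zero =>
    intro f hf
    refine ⟨0, ?_⟩
    simpa [Polynomial.degree_lt_iff_coeff_zero, Polynomial.ext_iff] using hf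
  | succ n ih =>
    intro f hf
    have hl : (p n).coeff n ≠ 0 := by
      have := Polynomial.leadingCoeff_ne_zero.2 (hp0 n)
      rwa [Polynomial.leadingCoeff, hp n] at this
    obtain ⟨c, hc⟩ := ih (f - Polynomial.C (f.coeff n / (p n).coeff n) * p n) (by
      rw [Polynomial.degree_lt_iff_coeff_zero] at hf ⊢
      intro m hm
      rcases Nat.eq_or_lt_of_le hm with rfl | hm
      · simp [div_mul_cancel₀ _ hl]
      · rw [Polynomial.coeff_sub, hf m hm, Polynomial.coeff_C_mul,
          Polynomial.coeff_eq_zero_of_natDegree_lt (p := p n) (n := m) (by rw [hp n]; exact hm)]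
        simp)
    refine ⟨Function.update c n (f.coeff n / (p n).coeff n), ?_⟩
    rw [Finset.sum_range_succ, Function.update_self]
    have : ∑ i ∈ Finset.range n,
        Polynomial.C (Function.update c n (f.coeff n / (p n).coeff n) i) * p i =
        ∑ i ∈ Finset.range n, Polynomial.C (c i) * p i := by
      refine Finset.sum_congr rfl fun i hi => ?_
      rw [Function.update_of_ne (Finset.mem_range.1 hi).ne]
    rw [this, ← hc]
    ring

/-! ### Transition kernels between slices -/

/-- The assumptions on the poles `lam k` of the one-step factors: they decrease strictly, and lie
to the right of `δ` for `k < 0` and to the left of `-δ` for `k ≥ 0`. -/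
structure IsPoles (lam : ℤ → ℝ) (δ : ℝ) : Prop where
  anti : StrictAnti lam
  pos : 0 < δ
  lt_neg_one : δ < lam (-1)
  zero_lt : lam 0 < -δ

theorem IsPoles.lt_of_neg (h : IsPoles lam δ) {k : ℤ} (hk : k < 0) : δ < lam k :=
  h.lt_neg_one.trans_le (h.anti.antitone (by omega))

theorem IsPoles.lt_of_nonneg (h : IsPoles lam δ) {k : ℤ} (hk : 0 ≤ k) : lam k < -δ :=
  (h.anti.antitone hk).trans_lt h.zero_lt

/-- The sign `ε_k` of the one-step factor `ε_k / (ζ - lam k)`: it makes this factor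
`1 / (lam k - ζ)` for `k < 0` and `1 / (ζ - lam k)` for `k ≥ 0`. -/
def stepSign (k : ℤ) : ℝ := if k < 0 then -1 else 1

/-- The residue at `lam k` of the transfer function `∏_{t ≤ j < s} ε_j / (ζ - lam j)`. -/
def coef (lam : ℤ → ℝ) (t s k : ℤ) : ℝ := pfCoef lam stepSign (Finset.Ico t s) k

/-- The function of `r` whose Mellin-type transform is `1 / (ζ - lam k)`, that is, the vertical-line
integral of `r ^ ζ / (ζ - lam k)`; the value at `r = 1` is the limit from the left. -/
def mode (lam : ℤ → ℝ) (k : ℤ) (r : ℝ) : ℝ :=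
  if k < 0 then (if r ≤ 1 then -r ^ lam k else 0) else (if 1 < r then r ^ lam k else 0)

/-- The transition kernel from position `y` at time `t` to position `x` at time `s`; it vanishes
unless `t < s`. -/
def trans (lam : ℤ → ℝ) (t : ℤ) (y : ℝ) (s : ℤ) (x : ℝ) : ℝ :=
  (√(x * y))⁻¹ * ∑ k ∈ Finset.Ico t s, coef lam t s k * mode lam k (x / y)

theorem trans_eq_zero {t s : ℤ} (h : s ≤ t) (y x : ℝ) : trans lam t y s x = 0 := by
  simp [trans, Finset.Ico_eq_empty (not_lt.2 h)]

theorem mode_measurable (k : ℤ) : Measurable (mode lam k) := by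
  unfold mode
  split_ifs
  · exact Measurable.ite (measurableSet_le measurable_id measurable_const) (by fun_prop)
      measurable_const
  · exact Measurable.ite (measurableSet_lt measurable_const measurable_id) (by fun_prop)
      measurable_const

/-- The integral of `z ^ (p - 1)` over an interval at distance from zero or with `p > 0`. -/
theorem integrableOn_rpow_Ioc {p a b : ℝ} (ha : 0 < a ∨ 0 < p ∧ a = 0) (hab : a ≤ b) :
    IntegrableOn (fun z : ℝ => z ^ (p - 1)) (Ioc a b) := by
  rw [← intervalIntegrable_iff_integrableOn_Ioc_of_le hab]
  rcases ha with ha | ⟨hp, rfl⟩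
  · apply intervalIntegral.intervalIntegrable_rpow
    right
    rw [uIcc_of_le hab]
    exact fun h => absurd h.1 (not_le.2 ha)
  · exact intervalIntegral.intervalIntegrable_rpow' (by linarith)

theorem integral_rpow_Ioc {p a b : ℝ} (hp : p ≠ 0) (ha : 0 < a ∨ 0 < p ∧ a = 0) (hab : a ≤ b) :
    ∫ z in Ioc a b, z ^ (p - 1) = (b ^ p - a ^ p) / p := by
  rw [← intervalIntegral.integral_of_le hab]
  rw [integral_rpow]
  · simp
  · rcases ha with ha | ⟨hp, rfl⟩
    · right
      refine ⟨fun h => hp (by linarith), ?_⟩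
      rw [uIcc_of_le hab]
      exact fun h => absurd h.1 (not_le.2 ha)
    · left; linarith

/-- The multiplicative convolution of two modes, the real-space form of
`1 / ((ζ - lam k) (ζ - lam m)) = (1 / (ζ - lam k) - 1 / (ζ - lam m)) / (lam k - lam m)`. On the
whole half-line the same formula holds; the integrand vanishes beyond `1` since `x, y ≤ 1`. -/
theorem mode_conv (h : IsPoles lam δ) {k m : ℤ} (hkm : k < m) {x y : ℝ} (hx : x ∈ Ioc (0 : ℝ) 1)
    (hy : y ∈ Ioc (0 : ℝ) 1) :
    IntegrableOn (fun z => mode lam k (z / y) * mode lam m (x / z) * z⁻¹) (Ioo 0 1) ∧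
    ∫ z in Ioo (0 : ℝ) 1, mode lam k (z / y) * mode lam m (x / z) * z⁻¹ =
      (mode lam k (x / y) - mode lam m (x / y)) / (lam k - lam m) := by
  obtain ⟨hx0, hx1⟩ := hx
  obtain ⟨hy0, hy1⟩ := hy
  have hp : 0 < lam k - lam m := sub_pos.2 (h.anti hkm)
  rw [← integral_Ioc_eq_integral_Ioo, ← integrableOn_Ioc_iff_integrableOn_Ioo]
  -- the integrand is a multiple of a power on a subinterval
  have key : ∀ (a b c : ℝ), (0 < a ∨ 0 < lam k - lam m ∧ a = 0) → a ≤ b → b ≤ 1 →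
      (∀ᵐ z, z ∈ Ioc (0 : ℝ) 1 → mode lam k (z / y) * mode lam m (x / z) * z⁻¹ =
        (Ioc a b).indicator (fun z => c * z ^ (lam k - lam m - 1)) z) →
      IntegrableOn (fun z => mode lam k (z / y) * mode lam m (x / z) * z⁻¹) (Ioc 0 1) ∧
      ∫ z in Ioc (0 : ℝ) 1, mode lam k (z / y) * mode lam m (x / z) * z⁻¹ =
        c * ((b ^ (lam k - lam m) - a ^ (lam k - lam m)) / (lam k - lam m)) := by
    intro a b c ha hab hb hae
    have ha0 : 0 ≤ a := by rcases ha with ha | ⟨_, rfl⟩ <;> linarith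
    have hsub : Ioc a b ⊆ Ioc (0 : ℝ) 1 := Ioc_subset_Ioc ha0 hb
    have hae' : (fun z => mode lam k (z / y) * mode lam m (x / z) * z⁻¹) =ᵐ[volume.restrict (Ioc 0 1)]
        (Ioc a b).indicator (fun z => c * z ^ (lam k - lam m - 1)) :=
      (ae_restrict_iff' measurableSet_Ioc).2 hae
    have hi : IntegrableOn (fun z : ℝ => c * z ^ (lam k - lam m - 1)) (Ioc a b) :=
      (integrableOn_rpow_Ioc ha hab).const_mul c
    constructor
    · refine Integrable.congr ?_ hae'.symm
      rw [integrable_indicator_iff measurableSet_Ioc, IntegrableOn,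
        Measure.restrict_restrict measurableSet_Ioc, inter_eq_left.2 hsub]
      exact hi
    · rw [integral_congr_ae hae', integral_indicator measurableSet_Ioc,
        Measure.restrict_restrict measurableSet_Ioc, inter_eq_left.2 hsub, integral_const_mul,
        integral_rpow_Ioc hp.ne' ha hab]
  have hpow : ∀ z : ℝ, 0 < z → (z / y) ^ lam k * (x / z) ^ lam m * z⁻¹ =
      (x ^ lam m / y ^ lam k) * z ^ (lam k - lam m - 1) := by
    intro z hz
    rw [Real.div_rpow hz.le hy0.le, Real.div_rpow hx0.le hz.le, Real.rpow_sub hz,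
      Real.rpow_sub hz, Real.rpow_one]
    have := (Real.rpow_pos_of_pos hz (lam k)).ne'
    have := (Real.rpow_pos_of_pos hz (lam m)).ne'
    have := (Real.rpow_pos_of_pos hy0 (lam k)).ne'
    field_simp
  have hr : (x / y) ^ lam k = x ^ lam k / y ^ lam k := Real.div_rpow hx0.le hy0.le _
  have hr' : (x / y) ^ lam m = x ^ lam m / y ^ lam m := Real.div_rpow hx0.le hy0.le _
  have e1 : x ^ (lam k - lam m) = x ^ lam k / x ^ lam m := Real.rpow_sub hx0 _ _
  have e2 : y ^ (lam k - lam m) = y ^ lam k / y ^ lam m := Real.rpow_sub hy0 _ _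
  have px := (Real.rpow_pos_of_pos hx0 (lam m)).ne'
  have py := (Real.rpow_pos_of_pos hy0 (lam k)).ne'
  have py' := (Real.rpow_pos_of_pos hy0 (lam m)).ne'
  have z0 : (0 : ℝ) ^ (lam k - lam m) = 0 := Real.zero_rpow hp.ne'
  have ne : ∀ a : ℝ, ∀ᵐ z : ℝ, z ≠ a := fun a => by simp [ae_iff, measure_singleton]
  rcases lt_or_ge m 0 with hm | hm
  · have hk : k < 0 := hkm.trans hm
    rcases le_or_gt x y with hxy | hxy
    · have := key x y (x ^ lam m / y ^ lam k) (Or.inl hx0) hxy hy1 (by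
        filter_upwards [ne x] with z hzx hz
        have hz0 : 0 < z := hz.1
        simp only [mode, hk, hm, if_true, div_le_one hy0, div_le_one hz0]
        by_cases h1 : z ≤ y <;> by_cases h2 : x ≤ z <;>
          simp [indicator, h1, h2, lt_iff_le_and_ne, hzx.symm, ← hpow z hz0])
      refine ⟨this.1, this.2.trans ?_⟩
      simp only [mode, hk, hm, if_true, (div_le_one hy0).2 hxy]
      rw [hr, hr', e1, e2]
      field_simp
      ring
    · have := key y y 0 (Or.inl hy0) le_rfl hy1 (by
        filter_upwards with z hz
        have hz0 : 0 < z := hz.1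
        simp only [mode, hk, hm, if_true, div_le_one hy0, div_le_one hz0]
        by_cases h1 : z ≤ y
        · simp [not_le.2 (h1.trans_lt hxy)]
        · simp [h1])
      refine ⟨this.1, this.2.trans ?_⟩
      simp [mode, hk, hm, not_le.2 ((one_lt_div hy0).2 hxy)]
  · rcases lt_or_ge k 0 with hk | hk
    · have := key 0 (min x y) (-(x ^ lam m / y ^ lam k)) (Or.inr ⟨hp, rfl⟩)
        (le_min hx0.le hy0.le) ((min_le_left _ _).trans hx1) (by
        filter_upwards [ne x] with z hzx hz
        have hz0 : 0 < z := hz.1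
        simp only [mode, hk, not_lt.2 hm, if_true, if_false, div_le_one hy0, one_lt_div hz0]
        by_cases h1 : z ≤ y <;> by_cases h2 : z < x <;>
          simp [indicator, h1, h2, hz0, le_iff_lt_or_eq (a := z) (b := x), hzx, ← hpow z hz0])
      refine ⟨this.1, this.2.trans ?_⟩
      simp only [mode, hk, not_lt.2 hm, if_true, if_false, z0]
      rcases le_or_gt x y with hxy | hxy
      · rw [min_eq_left hxy, if_pos ((div_le_one hy0).2 hxy),
          if_neg (not_lt.2 ((div_le_one hy0).2 hxy)), hr, e1]
        field_simp
        ring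
      · rw [min_eq_right hxy.le, if_neg (not_le.2 ((one_lt_div hy0).2 hxy)),
          if_pos ((one_lt_div hy0).2 hxy), hr', e2]
        field_simp
        ring
    · rcases le_or_gt y x with hxy | hxy
      · have := key y x (x ^ lam m / y ^ lam k) (Or.inl hy0) hxy hx1 (by
          filter_upwards [ne x] with z hzx hz
          have hz0 : 0 < z := hz.1
          simp only [mode, not_lt.2 hk, not_lt.2 hm, if_false, one_lt_div hy0, one_lt_div hz0]
          by_cases h1 : y < z <;> by_cases h2 : z < x <;>
            simp [indicator, h1, h2, le_iff_lt_or_eq (a := z) (b := x), hzx, ← hpow z hz0])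
        refine ⟨this.1, this.2.trans ?_⟩
        simp only [mode, not_lt.2 hk, not_lt.2 hm, if_false]
        rcases hxy.eq_or_lt with rfl | hxy
        · simp [div_self hy0.ne']
        · rw [if_pos ((one_lt_div hy0).2 hxy), hr, if_pos ((one_lt_div hy0).2 hxy), hr', e1, e2]
          field_simp
      · have := key y y 0 (Or.inl hy0) le_rfl hy1 (by
          filter_upwards with z hz
          have hz0 : 0 < z := hz.1
          simp only [mode, not_lt.2 hk, not_lt.2 hm, if_false, one_lt_div hy0, one_lt_div hz0]
          by_cases h1 : y < z
          · simp [not_lt.2 (hxy.trans h1).le]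
          · simp [h1])
        refine ⟨this.1, this.2.trans ?_⟩
        simp [mode, not_lt.2 hk, not_lt.2 hm, not_lt.2 ((div_le_one hy0).2 hxy.le)]

/-- Extending the time interval to the right multiplies the residue by the values of the new
factors. -/
theorem coef_left {t s u k : ℤ} (hut : u ≤ t) (hts : t ≤ s) (hk : k ∈ Finset.Ico u t) :
    coef lam u s k = coef lam u t k * ∏ j ∈ Finset.Ico t s, stepSign j / (lam k - lam j) := by
  rw [coef, coef, ← Finset.Ico_union_Ico_eq_Ico hut hts]
  exact pfCoef_union lam _ (Finset.Ico_disjoint_Ico_consecutive u t s) hk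

/-- Extending the time interval to the left multiplies the residue by the values of the new factors.
-/
theorem coef_right {t s u k : ℤ} (hut : u ≤ t) (hts : t ≤ s) (hk : k ∈ Finset.Ico t s) :
    coef lam u s k = coef lam t s k * ∏ j ∈ Finset.Ico u t, stepSign j / (lam k - lam j) := by
  rw [coef, coef, ← Finset.Ico_union_Ico_eq_Ico hut hts, Finset.union_comm]
  exact pfCoef_union lam _ (Finset.Ico_disjoint_Ico_consecutive u t s).symm hk

/-- The transition kernels form a semigroup. -/
theorem trans_conv (h : IsPoles lam δ) {u t s : ℤ} {x y : ℝ}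
    (hx : x ∈ Ioc (0 : ℝ) 1) (hy : y ∈ Ioc (0 : ℝ) 1) :
    IntegrableOn (fun z => trans lam u y t z * trans lam t z s x) (Ioo 0 1) ∧
    ∫ z in Ioo (0 : ℝ) 1, trans lam u y t z * trans lam t z s x =
      if u < t ∧ t < s then trans lam u y s x else 0 := by
  by_cases hut : u < t
  swap
  · simp [hut, trans_eq_zero (not_lt.1 hut)]
  by_cases hts : t < s
  swap
  · simp [hts, trans_eq_zero (not_lt.1 hts)]
  rw [if_pos ⟨hut, hts⟩]
  have e : ∀ z ∈ Ioo (0 : ℝ) 1, trans lam u y t z * trans lam t z s x =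
      ∑ k ∈ Finset.Ico u t, ∑ m ∈ Finset.Ico t s, (√(x * y))⁻¹ * coef lam u t k * coef lam t s m *
        (mode lam k (z / y) * mode lam m (x / z) * z⁻¹) := by
    intro z hz
    have : (√(z * y))⁻¹ * (√(x * z))⁻¹ = (√(x * y))⁻¹ * z⁻¹ := by
      rw [← mul_inv, ← mul_inv, ← Real.sqrt_mul (mul_nonneg hz.1.le hy.1.le),
        show z * y * (x * z) = x * y * z ^ 2 by ring,
        Real.sqrt_mul (mul_nonneg hx.1.le hy.1.le), Real.sqrt_sq hz.1.le]
    rw [trans, trans, mul_mul_mul_comm, this, Finset.sum_mul_sum, Finset.mul_sum]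
    refine Finset.sum_congr rfl fun k _ => ?_
    rw [Finset.mul_sum]
    exact Finset.sum_congr rfl fun m _ => by ring
  have hlt : ∀ k ∈ Finset.Ico u t, ∀ m ∈ Finset.Ico t s, k < m := fun k hk m hm =>
    (Finset.mem_Ico.1 hk).2.trans_le (Finset.mem_Ico.1 hm).1
  have hi : ∀ k ∈ Finset.Ico u t, ∀ m ∈ Finset.Ico t s,
      IntegrableOn (fun z => (√(x * y))⁻¹ * coef lam u t k * coef lam t s m *
        (mode lam k (z / y) * mode lam m (x / z) * z⁻¹)) (Ioo 0 1) := fun k hk m hm =>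
    (mode_conv h (hlt k hk m hm) hx hy).1.const_mul _
  constructor
  · rw [integrableOn_congr_fun e measurableSet_Ioo]
    exact integrable_finsetSum _ fun k hk => integrable_finsetSum _ fun m hm => hi k hk m hm
  · rw [setIntegral_congr_fun measurableSet_Ioo e, integral_finsetSum _ fun k hk =>
      integrable_finsetSum _ fun m hm => hi k hk m hm]
    have e2 : ∀ k ∈ Finset.Ico u t, ∫ z in Ioo (0 : ℝ) 1, ∑ m ∈ Finset.Ico t s,
        (√(x * y))⁻¹ * coef lam u t k * coef lam t s m *
          (mode lam k (z / y) * mode lam m (x / z) * z⁻¹) =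
        ∑ m ∈ Finset.Ico t s, ((√(x * y))⁻¹ * (coef lam u t k * mode lam k (x / y)) *
            (coef lam t s m / (lam k - lam m)) +
          (√(x * y))⁻¹ * (coef lam t s m * mode lam m (x / y)) *
            (coef lam u t k / (lam m - lam k))) := by
      intro k hk
      rw [integral_finsetSum _ fun m hm => hi k hk m hm]
      refine Finset.sum_congr rfl fun m hm => ?_
      rw [integral_const_mul, (mode_conv h (hlt k hk m hm) hx hy).2,
        ← neg_sub (lam k) (lam m), div_neg]
      ring
    rw [Finset.sum_congr rfl e2]
    simp_rw [Finset.sum_add_distrib]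
    rw [Finset.sum_comm (f := fun k m => (√(x * y))⁻¹ * (coef lam t s m * mode lam m (x / y)) *
            (coef lam u t k / (lam m - lam k)))]
    simp_rw [← Finset.mul_sum]
    rw [trans, ← Finset.Ico_union_Ico_eq_Ico hut.le hts.le,
      Finset.sum_union (Finset.Ico_disjoint_Ico_consecutive u t s), mul_add, Finset.mul_sum,
      Finset.mul_sum]
    congr 1
    · refine Finset.sum_congr rfl fun k hk => ?_
      rw [coef_left hut.le hts.le hk, prod_eq_sum_pfCoef stepSign h.anti.injective (by simpa)]
      · simp only [coef]; ring
      · exact fun m hm hh => (hlt k hk m hm).ne (h.anti.injective hh)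
    · refine Finset.sum_congr rfl fun m hm => ?_
      rw [coef_right hut.le hts.le hm, prod_eq_sum_pfCoef stepSign h.anti.injective (by simpa)]
      · simp only [coef]; ring
      · exact fun k hk hh => (hlt k hk m hm).ne' (h.anti.injective hh)

/-! ### Sources, sinks and the correlation kernel -/

/-- The polynomial `∏_{0 ≤ j < N} (z - lam j)`, the numerator of `F_c(0, ·)`. -/
def numer (lam : ℤ → ℝ) (N : ℕ) (z : ℝ) : ℝ := ∏ j ∈ Finset.Ico (0 : ℤ) N, (z - lam j)

/-- The polynomial `∏_{-M ≤ j < 0} (lam j - z)`, the denominator of `F_c(0, ·)`. -/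
def denom (lam : ℤ → ℝ) (M : ℕ) (z : ℝ) : ℝ := ∏ j ∈ Finset.Ico (-(M : ℤ)) 0, (lam j - z)

/-- The factor by which the transfer function of the source entering at time `-M + i` differs from
that of the first source. -/
def srcPoly (lam : ℤ → ℝ) (M i : ℕ) (z : ℝ) : ℝ :=
  ∏ j ∈ Finset.Ico (-(M : ℤ)) (-M + i), (lam j - z)

/-- The factor by which the transfer function of the sink at time `N - i` differs from that of the
last sink. -/
def snkPoly (lam : ℤ → ℝ) (N i : ℕ) (z : ℝ) : ℝ :=
  ∏ j ∈ Finset.Ico ((N : ℤ) - i) N, (z - lam j)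

/-- The transition kernels between the sources, which sit at position `1` at the times `-M + i`,
and the sinks, which sit at position `1` at the times `N - j`. -/
def linkMat (lam : ℤ → ℝ) (M N : ℕ) : Matrix (Fin M) (Fin M) ℝ :=
  Matrix.of fun i j => trans lam (-M + i) 1 (N - j) 1

theorem sum_Ico_neg (M : ℕ) (f : ℤ → ℝ) :
    ∑ k ∈ Finset.Ico (-(M : ℤ)) 0, f k = ∑ i : Fin M, f (-M + i) := by
  rw [← Finset.sum_range (fun i => f (-(M : ℤ) + i))]
  refine (Finset.sum_nbij' (fun i : ℕ => -(M : ℤ) + i) (fun k => (k + M).toNat) ?_ ?_ ?_ ?_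
    fun _ _ => rfl).symm
  all_goals intro a ha; simp only [Finset.mem_range, Finset.mem_Ico] at *; omega

theorem prod_div_stepSign_neg (h : IsPoles lam δ) {S : Finset ℤ} (hS : ∀ j ∈ S, j < 0) (k : ℤ)
    (hk : k ∉ S) : (∏ j ∈ S, stepSign j / (lam k - lam j)) * ∏ j ∈ S, (lam j - lam k) = 1 := by
  rw [← Finset.prod_mul_distrib]
  refine Finset.prod_eq_one fun j hj => ?_
  have : lam k - lam j ≠ 0 := sub_ne_zero.2 fun e => hk (h.anti.injective e ▸ hj)
  rw [stepSign, if_pos (hS j hj)]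
  field_simp
  ring

theorem prod_div_stepSign_nonneg (h : IsPoles lam δ) {S : Finset ℤ} (hS : ∀ j ∈ S, 0 ≤ j) (k : ℤ)
    (hk : k ∉ S) : (∏ j ∈ S, stepSign j / (lam k - lam j)) * ∏ j ∈ S, (lam k - lam j) = 1 := by
  rw [← Finset.prod_mul_distrib]
  refine Finset.prod_eq_one fun j hj => ?_
  have : lam k - lam j ≠ 0 := sub_ne_zero.2 fun e => hk (h.anti.injective e ▸ hj)
  rw [stepSign, if_neg (not_lt.2 (hS j hj))]
  field_simp

/-- The residues of the transfer function from the source entering at time `-M + i` are those from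
the first source times `srcPoly`, which vanishes at the poles that are lost. -/
theorem coef_src (h : IsPoles lam δ) {M i : ℕ} (hi : i ≤ M) {s k : ℤ}
    (hk : k ∈ Finset.Ico (-(M : ℤ)) s) :
    coef lam (-M) s k * srcPoly lam M i (lam k) = if -(M : ℤ) + i ≤ k then coef lam (-M + i) s k
      else 0 := by
  rw [Finset.mem_Ico] at hk
  split_ifs with hik
  · rw [coef_right (t := -(M : ℤ) + i) (by omega) (by omega) (Finset.mem_Ico.2 ⟨hik, hk.2⟩), srcPoly,
      mul_assoc, prod_div_stepSign_neg h, mul_one]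
    · intro j hj; rw [Finset.mem_Ico] at hj; omega
    · rw [Finset.mem_Ico]; omega
  · have : srcPoly lam M i (lam k) = 0 :=
      Finset.prod_eq_zero (i := k) (by rw [Finset.mem_Ico]; omega) (sub_self _)
    rw [this, mul_zero]

/-- The residues of the transfer function to the sink at time `N - i` are those to the last sink
times `snkPoly`, which vanishes at the poles that are lost. -/
theorem coef_snk (h : IsPoles lam δ) {N i : ℕ} (hi : i ≤ N) {u k : ℤ}
    (hk : k ∈ Finset.Ico u N) :
    coef lam u N k * snkPoly lam N i (lam k) = if k < (N : ℤ) - i then coef lam u (N - i) k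
      else 0 := by
  rw [Finset.mem_Ico] at hk
  split_ifs with hik
  · rw [coef_left (t := (N : ℤ) - i) (by omega) (by omega) (Finset.mem_Ico.2 ⟨hk.1, hik⟩), snkPoly,
      mul_assoc, prod_div_stepSign_nonneg h, mul_one]
    · intro j hj; rw [Finset.mem_Ico] at hj; omega
    · rw [Finset.mem_Ico]; omega
  · have : snkPoly lam N i (lam k) = 0 :=
      Finset.prod_eq_zero (i := k) (by rw [Finset.mem_Ico]; omega) (sub_self _)
    rw [this, mul_zero]

theorem trans_src (h : IsPoles lam δ) {M i : ℕ} (hi : i ≤ M) (s : ℤ) (x : ℝ) :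
    trans lam (-M + i) 1 s x = (√x)⁻¹ * ∑ k ∈ Finset.Ico (-(M : ℤ)) s,
      coef lam (-M) s k * srcPoly lam M i (lam k) * mode lam k x := by
  rw [trans, mul_one]
  congr 1
  rw [div_one]
  have : Finset.Ico (-(M : ℤ) + i) s ⊆ Finset.Ico (-(M : ℤ)) s :=
    Finset.Ico_subset_Ico_left (by omega)
  rw [← Finset.sum_subset this]
  · refine Finset.sum_congr rfl fun k hk => ?_
    rw [coef_src h hi (this hk), if_pos (Finset.mem_Ico.1 hk).1]
  · intro k hk hk'
    rw [coef_src h hi hk, if_neg, zero_mul]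
    rw [Finset.mem_Ico] at *; omega

theorem trans_snk (h : IsPoles lam δ) {N i : ℕ} (hi : i ≤ N) (u : ℤ) (y : ℝ) :
    trans lam u y (N - i) 1 = (√y)⁻¹ * ∑ m ∈ Finset.Ico u N,
      coef lam u N m * snkPoly lam N i (lam m) * mode lam m (1 / y) := by
  rw [trans, one_mul]
  congr 1
  have : Finset.Ico u ((N : ℤ) - i) ⊆ Finset.Ico u N :=
    Finset.Ico_subset_Ico_right (by omega)
  rw [← Finset.sum_subset this]
  · refine Finset.sum_congr rfl fun k hk => ?_
    rw [coef_snk h hi (this hk), if_pos (Finset.mem_Ico.1 hk).2]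
  · intro k hk hk'
    rw [coef_snk h hi hk, if_neg, zero_mul]
    rw [Finset.mem_Ico] at *; omega

theorem mode_of_nonneg {k : ℤ} (hk : 0 ≤ k) {r : ℝ} (hr : r ≤ 1) : mode lam k r = 0 := by
  simp [mode, not_lt.2 hk, not_lt.2 hr]

theorem mode_of_neg {k : ℤ} (hk : k < 0) {r : ℝ} (hr : 1 < r) : mode lam k r = 0 := by
  simp [mode, hk, not_le.2 hr]

/-- A sum of modes at a point of `(0,1]` involves the poles on the right only. -/
theorem sum_mode_eq (M : ℕ) (s : ℤ) (f : ℤ → ℝ) {r : ℝ} (hr : r ≤ 1) :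
    ∑ k ∈ Finset.Ico (-(M : ℤ)) s, f k * mode lam k r =
      ∑ k ∈ Finset.Ico (-(M : ℤ)) (min s 0), f k * mode lam k r := by
  symm
  refine Finset.sum_subset (Finset.Ico_subset_Ico_right (min_le_left _ _)) fun k hk hk' => ?_
  rw [mode_of_nonneg _ hr, mul_zero]
  rw [Finset.mem_Ico] at *; omega

/-- At ratio `1` only the modes with `k < 0` contribute, so that `linkMat` is a product of an `M ×
M` matrix in the source polynomials, a diagonal one and one in the sink polynomials. -/
theorem linkMat_apply (h : IsPoles lam δ) {M N : ℕ} (hMN : M ≤ N) (i j : Fin M) :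
    linkMat lam M N i j = -∑ k : Fin M, srcPoly lam M i (lam (-M + k)) * coef lam (-M) N (-M + k) *
      snkPoly lam N j (lam (-M + k)) := by
  have hi := i.2
  have hj := j.2
  rw [linkMat, Matrix.of_apply, trans_src h (by omega), Real.sqrt_one, inv_one, one_mul,
    sum_mode_eq M _ _ le_rfl, min_eq_right (by omega), sum_Ico_neg, ← Finset.sum_neg_distrib]
  refine Finset.sum_congr rfl fun k _ => ?_
  have hk := k.2
  have := coef_snk h (i := j) (u := -M) (N := N) (k := -M + k) (by omega) (by rw [Finset.mem_Ico]; omega)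
  rw [if_pos (by omega)] at this
  rw [← this, mode, if_pos (by omega), if_pos le_rfl, Real.one_rpow]
  ring

/-- The inverse of the transposed matrix of transition kernels from sources to sinks, together with
the Bezoutian-type formula that identifies it with the double contour integral. -/
theorem exists_inverse (h : IsPoles lam δ) {M N : ℕ} (hMN : M ≤ N) :
    ∃ B : Matrix (Fin M) (Fin M) ℝ, B * (linkMat lam M N).transpose = 1 ∧
      ∀ k ∈ Finset.Ico (-(M : ℤ)) 0, ∀ m : ℤ, 0 ≤ m →
        ∑ i : Fin M, ∑ j : Fin M, srcPoly lam M i (lam k) * B i j * snkPoly lam N j (lam m) =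
          numer lam N (lam k) * denom lam M (lam m) / (lam k - lam m) := by
  classical
  have hinj : Function.Injective fun k : Fin M => lam (-M + k) := by
    intro k m e
    have := h.anti.injective e
    ext; omega
  -- The transpose of `linkMat` factors as `-(G * diagonal w * Eᵀ)`, where `G` and `E` hold the values
  -- of the sink and source polynomials at the nodes `lam k`, `k < 0`. A left inverse `H` of `G` up to
  -- a diagonal matrix comes from Lagrange interpolation, and the diagonal matrices combine to `-1`.
  -- the matrix of the source polynomials at the nodes is triangular
  let E : Matrix (Fin M) (Fin M) ℝ := Matrix.of fun i k => srcPoly lam M i (lam (-M + k))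
  have hE : IsUnit E.det := by
    rw [Matrix.det_of_isUpperTriangular]
    · rw [isUnit_iff_ne_zero, Finset.prod_ne_zero_iff]
      intro i _
      simp only [E, Matrix.of_apply, srcPoly]
      rw [Finset.prod_ne_zero_iff]
      intro j hj e
      have := h.anti.injective (sub_eq_zero.1 e)
      rw [Finset.mem_Ico] at hj; omega
    · intro i k hik
      simp only [E, Matrix.of_apply, srcPoly]
      refine Finset.prod_eq_zero (i := (-M + k : ℤ)) ?_ (sub_self _)
      have : (k : ℕ) < i := hik
      rw [Finset.mem_Ico]; omega
  -- expansion of the Lagrange-type polynomials in the sink polynomials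
  have hH : ∀ k : Fin M, ∃ c : ℕ → ℝ, ∀ z : ℝ,
      ∏ m ∈ Finset.univ.erase k, (lam (-M + (m : ℕ)) - z) =
        ∑ j : Fin M, c j * snkPoly lam N j z := by
    intro k
    have hM := k.2
    obtain ⟨c, hc⟩ := exists_eq_sum_of_natDegree
      (fun i : ℕ => ∏ j ∈ Finset.range i, (Polynomial.X - Polynomial.C (lam ((N : ℤ) - 1 - j))))
      (fun i => by
        rw [Polynomial.natDegree_prod_of_monic (Finset.range i)
        (fun j : ℕ => (Polynomial.X - Polynomial.C (lam ((N : ℤ) - 1 - j))))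
        (fun j _ => Polynomial.monic_X_sub_C _)]
        simp)
      (fun i => (Polynomial.monic_prod_of_monic _ _ fun j _ => Polynomial.monic_X_sub_C _).ne_zero)
      M (∏ m ∈ Finset.univ.erase k, (Polynomial.C (lam (-M + (m : ℕ))) - Polynomial.X)) (by
        refine (Polynomial.degree_prod_le _ _).trans_lt ?_
        have : ∀ m ∈ Finset.univ.erase k,
            (Polynomial.C (lam (-M + (m : ℕ))) - Polynomial.X).degree ≤ 1 := by
          intro m _
          rw [← Polynomial.degree_neg, neg_sub, Polynomial.degree_X_sub_C]
        refine (Finset.sum_le_sum this).trans_lt ?_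
        rw [Finset.sum_const, Finset.card_erase_of_mem (Finset.mem_univ _), Finset.card_univ,
          Fintype.card_fin, nsmul_eq_mul, mul_one]
        exact_mod_cast (by omega : M - 1 < M))
    refine ⟨c, fun z => ?_⟩
    have hz := congrArg (Polynomial.eval z) hc
    rw [Polynomial.eval_prod, Polynomial.eval_finsetSum] at hz
    simp only [Polynomial.eval_sub, Polynomial.eval_C, Polynomial.eval_X, Polynomial.eval_mul,
      Polynomial.eval_prod] at hz
    rw [hz, Finset.sum_range]
    refine Finset.sum_congr rfl fun j _ => ?_
    congr 1
    rw [snkPoly]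
    refine Finset.prod_nbij' (fun i : ℕ => (N : ℤ) - 1 - i) (fun k => (N - 1 - k).toNat)
      ?_ ?_ ?_ ?_ ?_
    on_goal 5 => exact fun _ _ => rfl
    all_goals intro a ha; simp only [Finset.mem_range, Finset.mem_Ico] at *; omega
  choose c hc using hH
  let H : Matrix (Fin M) (Fin M) ℝ := Matrix.of fun k j => c k j
  let G : Matrix (Fin M) (Fin M) ℝ := Matrix.of fun j k => snkPoly lam N j (lam (-M + k))
  let w : Fin M → ℝ := fun k => coef lam (-M) N (-M + k)
  let p : Fin M → ℝ := fun k => numer lam N (lam (-M + k))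
  let q : Fin M → ℝ := fun k => ∏ m ∈ Finset.univ.erase k, (lam (-M + (m : ℕ)) - lam (-M + k))
  have hHG : H * G = Matrix.diagonal q := by
    ext k k'
    rw [Matrix.mul_apply]
    simp only [H, G, Matrix.of_apply]
    rw [← hc k, Matrix.diagonal_apply]
    split_ifs with hk
    · rw [← hk]
    · exact Finset.prod_eq_zero (i := k') (by simp [Ne.symm hk]) (sub_self _)
  have hA : (linkMat lam M N).transpose = -(G * Matrix.diagonal w * E.transpose) := by
    ext j i
    rw [Matrix.transpose_apply, linkMat_apply h hMN, Matrix.neg_apply, Matrix.mul_apply]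
    simp only [Matrix.mul_diagonal, G, E, w, Matrix.of_apply, Matrix.transpose_apply]
    congr 1
    exact Finset.sum_congr rfl fun k _ => by ring
  have hpq : ∀ k, p k * q k * w k = -1 := by
    intro k
    have hk := k.2
    have e1 : ∏ m ∈ Finset.univ.erase k, (lam (-M + (m : ℕ)) - lam (-M + k)) =
        ∏ j ∈ (Finset.Ico (-(M : ℤ)) 0).erase (-M + k), (lam j - lam (-M + k)) := by
      refine Finset.prod_bij (fun m _ => (-M + (m : ℕ) : ℤ)) ?_ ?_ ?_ ?_
      · intro m hm
        have := m.2
        have h2 : m ≠ k := Finset.ne_of_mem_erase hm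
        rw [Finset.mem_erase, Finset.mem_Ico]
        exact ⟨fun e => h2 (by ext; omega), by omega, by omega⟩
      · intro a _ b _ e; ext; omega
      · intro j hj
        rw [Finset.mem_erase, Finset.mem_Ico] at hj
        refine ⟨⟨(j + M).toNat, by omega⟩, ?_, ?_⟩
        · simp only [Finset.mem_erase, Finset.mem_univ, and_true]
          intro e
          have := congrArg Fin.val e
          simp only at this
          omega
        · simp only; omega
      · intros; rfl
    have e2 : (Finset.Ico (-(M : ℤ)) N).erase (-M + k) =
        (Finset.Ico (-(M : ℤ)) 0).erase (-M + k) ∪ Finset.Ico 0 (N : ℤ) := by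
      ext j
      simp only [Finset.mem_erase, Finset.mem_Ico, Finset.mem_union]
      omega
    have e3 : Disjoint ((Finset.Ico (-(M : ℤ)) 0).erase (-M + k)) (Finset.Ico 0 (N : ℤ)) := by
      rw [Finset.disjoint_left]
      intro j
      simp only [Finset.mem_erase, Finset.mem_Ico]
      omega
    simp only [p, q, w]
    rw [e1, coef, pfCoef, e2, Finset.prod_union e3, numer]
    have h1 := prod_div_stepSign_neg h (S := (Finset.Ico (-(M : ℤ)) 0).erase (-M + k))
      (fun j hj => (Finset.mem_Ico.1 (Finset.mem_of_mem_erase hj)).2) (-M + k) (by simp)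
    have h2 := prod_div_stepSign_nonneg h (S := Finset.Ico 0 (N : ℤ))
      (fun j hj => (Finset.mem_Ico.1 hj).1) (-M + k) (by rw [Finset.mem_Ico]; omega)
    rw [stepSign, if_pos (by omega)]
    linear_combination -(∏ j ∈ (Finset.Ico (-(M : ℤ)) 0).erase (-M + k),
      stepSign j / (lam (-M + k) - lam j)) * (∏ j ∈ (Finset.Ico (-(M : ℤ)) 0).erase (-M + k),
        (lam j - lam (-M + k))) * h2 - h1
  have hEE : E * E⁻¹ = 1 := Matrix.mul_nonsing_inv E hE
  refine ⟨(E⁻¹).transpose * Matrix.diagonal p * H, ?_, ?_⟩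
  · rw [hA, Matrix.mul_neg]
    calc -((E⁻¹).transpose * Matrix.diagonal p * H * (G * Matrix.diagonal w * E.transpose))
        = -((E⁻¹).transpose * Matrix.diagonal p * (H * G) * Matrix.diagonal w * E.transpose) := by
          simp only [Matrix.mul_assoc]
      _ = (E⁻¹).transpose * E.transpose := by
          rw [hHG, Matrix.mul_assoc _ (Matrix.diagonal p), Matrix.diagonal_mul_diagonal,
            Matrix.mul_assoc _ (Matrix.diagonal _) (Matrix.diagonal w),
            Matrix.diagonal_mul_diagonal]
          simp only [hpq]
          have : (Matrix.diagonal fun _ : Fin M => (-1 : ℝ)) = -1 := by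
            rw [← Matrix.diagonal_one, ← Matrix.diagonal_neg]
          rw [this]
          simp
      _ = 1 := by rw [← Matrix.transpose_mul, hEE, Matrix.transpose_one]
  · intro k hk m hm
    rw [Finset.mem_Ico] at hk
    obtain ⟨κ, rfl⟩ : ∃ κ : Fin M, (-M + (κ : ℕ) : ℤ) = k :=
      ⟨⟨(k + M).toNat, by omega⟩, by simp only; omega⟩
    have e1 : ∀ j : Fin M, ∑ i : Fin M, srcPoly lam M i (lam (-M + κ)) *
        ((E⁻¹).transpose * Matrix.diagonal p * H) i j = p κ * c κ j := by
      intro j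
      have : (E.transpose * ((E⁻¹).transpose * Matrix.diagonal p * H)) κ j = p κ * c κ j := by
        rw [← Matrix.mul_assoc, ← Matrix.mul_assoc, ← Matrix.transpose_mul,
          Matrix.nonsing_inv_mul E hE, Matrix.transpose_one, Matrix.one_mul, Matrix.diagonal_mul]
        rfl
      rw [← this, Matrix.mul_apply]
      rfl
    rw [Finset.sum_comm]
    simp_rw [← Finset.sum_mul, e1, mul_assoc, ← Finset.mul_sum]
    rw [← hc κ, mul_div_assoc]
    congr 1
    have hne : lam (-M + κ) - lam m ≠ 0 :=
      sub_ne_zero.2 fun e => by have := h.anti.injective e; omega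
    rw [eq_div_iff hne, denom, ← Finset.mul_prod_erase _ _ (Finset.mem_Ico.2 hk), mul_comm]
    congr 1
    refine Finset.prod_bij (fun m _ => (-M + (m : ℕ) : ℤ)) ?_ ?_ ?_ ?_
    · intro m hm
      have := m.2
      have h2 : m ≠ κ := Finset.ne_of_mem_erase hm
      rw [Finset.mem_erase, Finset.mem_Ico]
      exact ⟨fun e => h2 (by ext; omega), by omega, by omega⟩
    · intro a _ b _ e; ext; omega
    · intro j hj
      rw [Finset.mem_erase, Finset.mem_Ico] at hj
      refine ⟨⟨(j + M).toNat, by omega⟩, ?_, ?_⟩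
      · simp only [Finset.mem_erase, Finset.mem_univ, and_true]
        intro e
        have := congrArg Fin.val e
        simp only at this
        omega
      · simp only; omega
    · intros; rfl

/-- The part of the correlation kernel carried by paths from the sources to the sinks, for a matrix
`B` that is to be the inverse of the transpose of `linkMat`. -/
def pathKer (lam : ℤ → ℝ) {M : ℕ} (N : ℕ) (B : Matrix (Fin M) (Fin M) ℝ) (s : ℤ) (x : ℝ) (t : ℤ)
    (y : ℝ) : ℝ :=
  ∑ i : Fin M, ∑ j : Fin M, trans lam (-M + i) 1 s x * B i j * trans lam t y (N - j) 1

/-- The correlation kernel of Eynard–Mehta type: paths through the sources and sinks minus the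
transition kernel. -/
def corrKer (lam : ℤ → ℝ) {M : ℕ} (N : ℕ) (B : Matrix (Fin M) (Fin M) ℝ) (s : ℤ) (x : ℝ) (t : ℤ)
    (y : ℝ) : ℝ :=
  pathKer lam N B s x t y - trans lam t y s x

theorem pathKer_integral (h : IsPoles lam δ) {t : ℤ} {B : Matrix (Fin M) (Fin M) ℝ} :
    IntegrableOn (fun z => pathKer lam N B t z t z) (Ioo 0 1) ∧
    ∫ z in Ioo (0 : ℝ) 1, pathKer lam N B t z t z =
      ∑ i : Fin M, ∑ j : Fin M, B i j *
        (if -(M : ℤ) + i < t ∧ t < (N : ℤ) - j then linkMat lam M N i j else 0) := by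
  have e : ∀ z, pathKer lam N B t z t z = ∑ i : Fin M, ∑ j : Fin M, B i j *
      (trans lam (-M + i) 1 t z * trans lam t z (N - j) 1) := fun z =>
    Finset.sum_congr rfl fun i _ => Finset.sum_congr rfl fun j _ => by ring
  have hI : ∀ i j : Fin M, IntegrableOn (fun z => B i j *
      (trans lam (-M + i) 1 t z * trans lam t z (N - j) 1)) (Ioo 0 1) := fun i j =>
    (trans_conv h (by simp) (by simp)).1.const_mul _
  simp_rw [e]
  refine ⟨integrable_finsetSum _ fun i _ => integrable_finsetSum _ fun j _ => hI i j, ?_⟩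
  rw [integral_finsetSum _ fun i _ => integrable_finsetSum _ fun j _ => hI i j]
  refine Finset.sum_congr rfl fun i _ => ?_
  rw [integral_finsetSum _ fun j _ => hI i j]
  refine Finset.sum_congr rfl fun j _ => ?_
  rw [integral_const_mul, (trans_conv h (by simp) (by simp)).2]
  rfl

/-- Integrating the kernel over the diagonal of a slice gives its number of particles. -/
theorem corrKer_trace (h : IsPoles lam δ) (hMN : M ≤ N) {t : ℤ} (ht : -(M : ℤ) < t) (ht' : t < N)
    {B : Matrix (Fin M) (Fin M) ℝ} (hB : B * (linkMat lam M N).transpose = 1) :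
    IntegrableOn (fun z => corrKer lam N B t z t z) (Ioo 0 1) ∧
    ∫ z in Ioo (0 : ℝ) 1, corrKer lam N B t z t z = numPts M N t := by
  have e : ∀ z, corrKer lam N B t z t z = pathKer lam N B t z t z := fun z => by
    rw [corrKer, trans_eq_zero le_rfl, sub_zero]
  simp_rw [e]
  refine ⟨(pathKer_integral h).1, (pathKer_integral h).2.trans ?_⟩
  have hB' : (linkMat lam M N).transpose * B = 1 := mul_eq_one_comm.1 hB
  have hB1 : ∀ i, ∑ j, B i j * linkMat lam M N i j = 1 := fun i => by
    have := congrFun (congrFun hB i) i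
    rwa [Matrix.mul_apply, Matrix.one_apply_eq] at this
  have hB2 : ∀ j, ∑ i, B i j * linkMat lam M N i j = 1 := fun j => by
    have := congrFun (congrFun hB' j) j
    rw [Matrix.mul_apply, Matrix.one_apply_eq] at this
    rw [← this]
    exact Finset.sum_congr rfl fun i _ => mul_comm _ _
  rcases le_or_gt t ((N : ℤ) - M) with htN | htN
  · have : ∀ i j : Fin M, B i j *
        (if -(M : ℤ) + i < t ∧ t < (N : ℤ) - j then linkMat lam M N i j else 0) =
        if -(M : ℤ) + i < t then B i j * linkMat lam M N i j else 0 := by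
      intro i j
      have := j.2
      by_cases hi : -(M : ℤ) + i < t
      · rw [if_pos ⟨hi, by omega⟩, if_pos hi]
      · rw [if_neg (fun h => hi h.1), if_neg hi, mul_zero]
    simp_rw [this, Finset.sum_ite_irrel, hB1, Finset.sum_const_zero]
    rw [Finset.sum_boole, Nat.cast_inj]
    have h2 : (Finset.univ.filter fun i : Fin M => -(M : ℤ) + i < t).card =
        min M (t + M).toNat := by
      have : (Finset.univ.filter fun i : Fin M => -(M : ℤ) + i < t) =
          Finset.univ.filter fun i : Fin M => i.1 < (t + M).toNat := by
        ext i; simp; omega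
      rw [this, Fin.card_filter_val_lt]
    rw [h2, numPts]
    split_ifs <;> omega
  · have : ∀ i j : Fin M, B i j *
        (if -(M : ℤ) + i < t ∧ t < (N : ℤ) - j then linkMat lam M N i j else 0) =
        if t < (N : ℤ) - j then B i j * linkMat lam M N i j else 0 := by
      intro i j
      have := i.2
      by_cases hi : t < (N : ℤ) - j
      · rw [if_pos ⟨by omega, hi⟩, if_pos hi]
      · rw [if_neg (fun h => hi h.2), if_neg hi, mul_zero]
    rw [Finset.sum_comm]
    simp_rw [this, Finset.sum_ite_irrel, hB2, Finset.sum_const_zero]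
    rw [Finset.sum_boole, Nat.cast_inj]
    have h2 : (Finset.univ.filter fun j : Fin M => t < (N : ℤ) - j).card =
        min M (N - t).toNat := by
      have : (Finset.univ.filter fun j : Fin M => t < (N : ℤ) - j) =
          Finset.univ.filter fun i : Fin M => i.1 < (N - t).toNat := by
        ext i; simp; omega
      rw [this, Fin.card_filter_val_lt]
    rw [h2, numPts]
    split_ifs <;> omega

/-- The kernel reproduces itself, or its negative, or annihilates itself, under convolution over
slice `t`, according to the position of `t` relative to the other two times. -/
theorem corrKer_conv (h : IsPoles lam δ) {s t u : ℤ} {x y : ℝ}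
    {B : Matrix (Fin M) (Fin M) ℝ} (hB : B * (linkMat lam M N).transpose = 1)
    (hx : x ∈ Ioo (0 : ℝ) 1) (hy : y ∈ Ioo (0 : ℝ) 1) (hMN : M ≤ N) :
    IntegrableOn (fun z => corrKer lam N B s x t z * corrKer lam N B t z u y) (Ioo 0 1) ∧
    ∫ z in Ioo (0 : ℝ) 1, corrKer lam N B s x t z * corrKer lam N B t z u y =
      ((if s ≤ t then 1 else 0) - (if u < t then 1 else 0)) * corrKer lam N B s x u y := by
  have hx' : x ∈ Ioc (0 : ℝ) 1 := ⟨hx.1, hx.2.le⟩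
  have hy' : y ∈ Ioc (0 : ℝ) 1 := ⟨hy.1, hy.2.le⟩
  have h1 : (1 : ℝ) ∈ Ioc (0 : ℝ) 1 := by simp
  set a : Fin M → ℝ := fun i => trans lam (-M + i) 1 s x with ha
  set b : Fin M → ℝ := fun j => trans lam u y (N - j) 1 with hb
  let p : Fin M → ℝ → ℝ := fun i z => trans lam (-M + i) 1 t z
  let q : Fin M → ℝ → ℝ := fun j z => trans lam t z (N - j) 1
  have e : ∀ z, corrKer lam N B s x t z * corrKer lam N B t z u y =
      (∑ i, ∑ j, ∑ i', ∑ j', a i * B i j * B i' j' * b j' * (p i' z * q j z)) -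
      (∑ i', ∑ j', B i' j' * b j' * (p i' z * trans lam t z s x)) -
      (∑ i, ∑ j, a i * B i j * (trans lam u y t z * q j z)) +
      trans lam u y t z * trans lam t z s x := by
    intro z
    have e1 : (∑ i, ∑ j, ∑ i', ∑ j', a i * B i j * B i' j' * b j' * (p i' z * q j z)) =
        (∑ i, ∑ j, a i * B i j * q j z) * (∑ i', ∑ j', p i' z * B i' j' * b j') := by
      simp_rw [Finset.sum_mul, Finset.mul_sum]
      refine Finset.sum_congr rfl fun i _ => Finset.sum_congr rfl fun j _ =>
        Finset.sum_congr rfl fun i' _ => Finset.sum_congr rfl fun j' _ => by ring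
    have e2 : (∑ i', ∑ j', B i' j' * b j' * (p i' z * trans lam t z s x)) =
        trans lam t z s x * ∑ i', ∑ j', p i' z * B i' j' * b j' := by
      simp_rw [Finset.mul_sum]
      exact Finset.sum_congr rfl fun i _ => Finset.sum_congr rfl fun j _ => by ring
    have e3 : (∑ i, ∑ j, a i * B i j * (trans lam u y t z * q j z)) =
        (∑ i, ∑ j, a i * B i j * q j z) * trans lam u y t z := by
      simp_rw [Finset.sum_mul]
      exact Finset.sum_congr rfl fun i _ => Finset.sum_congr rfl fun j _ => by ring
    rw [e1, e2, e3]
    simp only [corrKer, pathKer, a, b, p, q]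
    ring
  have I1 : ∀ i j i' j', IntegrableOn
      (fun z => a i * B i j * B i' j' * b j' * (p i' z * q j z)) (Ioo 0 1) := fun i j i' j' =>
    (trans_conv h h1 h1).1.const_mul _
  have I2 : ∀ i' j', IntegrableOn
      (fun z => B i' j' * b j' * (p i' z * trans lam t z s x)) (Ioo 0 1) := fun i' j' =>
    (trans_conv h hx' h1).1.const_mul _
  have I3 : ∀ i j, IntegrableOn
      (fun z => a i * B i j * (trans lam u y t z * q j z)) (Ioo 0 1) := fun i j =>
    (trans_conv h h1 hy').1.const_mul _
  have J1 : IntegrableOn (fun z => ∑ i, ∑ j, ∑ i', ∑ j',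
      a i * B i j * B i' j' * b j' * (p i' z * q j z)) (Ioo 0 1) :=
    integrable_finsetSum _ fun i _ => integrable_finsetSum _ fun j _ =>
    integrable_finsetSum _ fun i' _ => integrable_finsetSum _ fun j' _ => I1 i j i' j'
  have J2 : IntegrableOn (fun z => ∑ i', ∑ j', B i' j' * b j' * (p i' z * trans lam t z s x))
      (Ioo 0 1) :=
    integrable_finsetSum _ fun i _ => integrable_finsetSum _ fun j _ => I2 i j
  have J3 : IntegrableOn (fun z => ∑ i, ∑ j, a i * B i j * (trans lam u y t z * q j z))
      (Ioo 0 1) :=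
    integrable_finsetSum _ fun i _ => integrable_finsetSum _ fun j _ => I3 i j
  have J4 : IntegrableOn (fun z => trans lam u y t z * trans lam t z s x) (Ioo 0 1) :=
    (trans_conv h hx' hy').1
  simp_rw [e]
  refine ⟨((J1.sub J2).sub J3).add J4, ?_⟩
  rw [integral_add ?_ J4, integral_sub ?_ J3, integral_sub J1 J2]
  rotate_left
  · exact J1.sub J2
  · exact (J1.sub J2).sub J3
  have V1 : ∫ z in Ioo (0 : ℝ) 1, ∑ i, ∑ j, ∑ i', ∑ j',
      a i * B i j * B i' j' * b j' * (p i' z * q j z) = ∑ i, ∑ j, ∑ i', ∑ j',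
      a i * B i j * B i' j' * b j' *
        (if -(M : ℤ) + i' < t ∧ t < (N : ℤ) - j then linkMat lam M N i' j else 0) := by
    rw [integral_finsetSum _ fun i _ => integrable_finsetSum _ fun j _ =>
      integrable_finsetSum _ fun i' _ => integrable_finsetSum _ fun j' _ => I1 i j i' j']
    refine Finset.sum_congr rfl fun i _ => ?_
    rw [integral_finsetSum _ fun j _ =>
      integrable_finsetSum _ fun i' _ => integrable_finsetSum _ fun j' _ => I1 i j i' j']
    refine Finset.sum_congr rfl fun j _ => ?_
    rw [integral_finsetSum _ fun i' _ => integrable_finsetSum _ fun j' _ => I1 i j i' j']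
    refine Finset.sum_congr rfl fun i' _ => ?_
    rw [integral_finsetSum _ fun j' _ => I1 i j i' j']
    refine Finset.sum_congr rfl fun j' _ => ?_
    rw [integral_const_mul, (trans_conv h h1 h1).2]
    rfl
  have V2 : ∫ z in Ioo (0 : ℝ) 1, ∑ i', ∑ j', B i' j' * b j' * (p i' z * trans lam t z s x) =
      ∑ i', ∑ j', B i' j' * b j' * (if -(M : ℤ) + i' < t ∧ t < s then a i' else 0) := by
    rw [integral_finsetSum _ fun i' _ => integrable_finsetSum _ fun j' _ => I2 i' j']
    refine Finset.sum_congr rfl fun i' _ => ?_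
    rw [integral_finsetSum _ fun j' _ => I2 i' j']
    refine Finset.sum_congr rfl fun j' _ => ?_
    rw [integral_const_mul, (trans_conv h hx' h1).2]
  have V3 : ∫ z in Ioo (0 : ℝ) 1, ∑ i, ∑ j, a i * B i j * (trans lam u y t z * q j z) =
      ∑ i, ∑ j, a i * B i j * (if u < t ∧ t < (N : ℤ) - j then b j else 0) := by
    rw [integral_finsetSum _ fun i _ => integrable_finsetSum _ fun j _ => I3 i j]
    refine Finset.sum_congr rfl fun i _ => ?_
    rw [integral_finsetSum _ fun j _ => I3 i j]
    refine Finset.sum_congr rfl fun j _ => ?_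
    rw [integral_const_mul, (trans_conv h h1 hy').2]
  rw [V1, V2, V3, (trans_conv h hx' hy').2]
  have hs : ∀ i : Fin M, ¬ -(M : ℤ) + i < s → a i = 0 := fun i hi =>
    trans_eq_zero (not_lt.1 hi) _ _
  have hu : ∀ j : Fin M, ¬ u < (N : ℤ) - j → b j = 0 := fun j hj =>
    trans_eq_zero (not_lt.1 hj) _ _
  have hker : corrKer lam N B s x u y = (∑ i, ∑ j, a i * B i j * b j) - trans lam u y s x := rfl
  have hτ : ¬ u < s → trans lam u y s x = 0 := fun hh => trans_eq_zero (not_lt.1 hh) _ _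
  have hB' : (linkMat lam M N).transpose * B = 1 := mul_eq_one_comm.1 hB
  have hB1 : ∀ i i', ∑ j, B i j * linkMat lam M N i' j = if i = i' then 1 else 0 := fun i i' => by
    have := congrFun (congrFun hB i) i'
    rwa [Matrix.mul_apply, Matrix.one_apply] at this
  have hB2 : ∀ j j', ∑ i, B i j' * linkMat lam M N i j = if j = j' then 1 else 0 := fun j j' => by
    have := congrFun (congrFun hB' j) j'
    rw [Matrix.mul_apply, Matrix.one_apply] at this
    rw [← this]
    exact Finset.sum_congr rfl fun i _ => mul_comm _ _
  rw [hker]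
  -- Up to time `N - M` all sinks lie ahead, and beyond it all sources have been passed since `M ≤ N`.
  -- Either way one of the two conditions on `linkMat` is void, and `B` cancels it.
  rcases le_or_gt t ((N : ℤ) - M) with htN | htN
  · have hj : ∀ j : Fin M, t < (N : ℤ) - j := fun j => by have := j.2; omega
    have W1 : (∑ i, ∑ j, ∑ i', ∑ j', a i * B i j * B i' j' * b j' *
        (if -(M : ℤ) + i' < t ∧ t < (N : ℤ) - j then linkMat lam M N i' j else 0)) =
        ∑ i : Fin M, ∑ j', (if -(M : ℤ) + i < t then a i else 0) * B i j' * b j' := by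
      refine Finset.sum_congr rfl fun i _ => ?_
      calc _ = ∑ i', ∑ j', (∑ j, B i j * linkMat lam M N i' j) * (a i * B i' j' * b j' *
            (if -(M : ℤ) + i' < t then 1 else 0)) := by
            rw [Finset.sum_comm]
            refine Finset.sum_congr rfl fun i' _ => ?_
            rw [Finset.sum_comm]
            refine Finset.sum_congr rfl fun j' _ => ?_
            rw [Finset.sum_mul]
            refine Finset.sum_congr rfl fun j _ => ?_
            simp only [hj j, and_true]
            split_ifs <;> ring
        _ = _ := by
            simp_rw [hB1]
            rw [Finset.sum_eq_single i (fun i' _ hi' => by simp [Ne.symm hi']) (by simp)]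
            refine Finset.sum_congr rfl fun j' _ => ?_
            rw [if_pos rfl]
            split_ifs <;> ring
    rw [W1]
    have e2 : ∑ i' : Fin M, ∑ j', B i' j' * b j' * (if -(M : ℤ) + i' < t ∧ t < s then a i' else 0) =
        (if t < s then 1 else 0) *
          ∑ i : Fin M, ∑ j', (if -(M : ℤ) + i < t then a i else 0) * B i j' * b j' := by
      simp_rw [Finset.mul_sum]
      refine Finset.sum_congr rfl fun i _ => Finset.sum_congr rfl fun j _ => ?_
      rw [ite_and]
      split_ifs <;> ring1
    have e3 : ∑ i, ∑ j : Fin M, a i * B i j * (if u < t ∧ t < (N : ℤ) - j then b j else 0) =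
        (if u < t then 1 else 0) * ∑ i, ∑ j, a i * B i j * b j := by
      simp_rw [Finset.mul_sum]
      refine Finset.sum_congr rfl fun i _ => Finset.sum_congr rfl fun j _ => ?_
      simp only [hj j, and_true]
      split_ifs <;> ring
    rw [e2, e3]
    by_cases hst : s ≤ t
    · have e4 : ∑ i : Fin M, ∑ j', (if -(M : ℤ) + i < t then a i else 0) * B i j' * b j' =
          ∑ i, ∑ j, a i * B i j * b j := by
        refine Finset.sum_congr rfl fun i _ => Finset.sum_congr rfl fun j _ => ?_
        split_ifs with hi
        · rfl
        · rw [hs i (by omega)]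
      rw [e4]
      have : ¬ t < s := not_lt.2 hst
      by_cases hut : u < t <;> by_cases hus : u < s <;> simp [hst, this, hut, hτ, hus]
      omega
    · have : t < s := not_le.1 hst
      by_cases hut : u < t <;> by_cases hus : u < s <;> simp [hst, this, hut, hτ, hus]
      first | omega | ring1
  · have hj : ∀ i : Fin M, -(M : ℤ) + i < t := fun j => by have := j.2; omega
    have W1 : (∑ i, ∑ j, ∑ i', ∑ j', a i * B i j * B i' j' * b j' *
        (if -(M : ℤ) + i' < t ∧ t < (N : ℤ) - j then linkMat lam M N i' j else 0)) =
        ∑ i : Fin M, ∑ j : Fin M, a i * B i j * (if t < (N : ℤ) - j then b j else 0) := by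
      refine Finset.sum_congr rfl fun i _ => Finset.sum_congr rfl fun j _ => ?_
      calc _ = ∑ j', (∑ i', B i' j' * linkMat lam M N i' j) * (a i * B i j * b j' *
            (if t < (N : ℤ) - j then 1 else 0)) := by
            rw [Finset.sum_comm]
            refine Finset.sum_congr rfl fun j' _ => ?_
            rw [Finset.sum_mul]
            refine Finset.sum_congr rfl fun i' _ => ?_
            simp only [hj i', true_and]
            split_ifs <;> ring
        _ = _ := by
            simp_rw [hB2, ite_mul, one_mul, zero_mul, Finset.sum_ite_eq, Finset.mem_univ, if_true]
            split_ifs <;> ring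
    rw [W1]
    have e2 : ∑ i' : Fin M, ∑ j', B i' j' * b j' * (if -(M : ℤ) + i' < t ∧ t < s then a i' else 0) =
        (if t < s then 1 else 0) * ∑ i, ∑ j, a i * B i j * b j := by
      simp_rw [Finset.mul_sum]
      refine Finset.sum_congr rfl fun i _ => Finset.sum_congr rfl fun j _ => ?_
      simp only [hj i, true_and]
      split_ifs <;> ring
    have e3 : ∑ i, ∑ j : Fin M, a i * B i j * (if u < t ∧ t < (N : ℤ) - j then b j else 0) =
        (if u < t then 1 else 0) *
          ∑ i : Fin M, ∑ j : Fin M, a i * B i j * (if t < (N : ℤ) - j then b j else 0) := by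
      simp_rw [Finset.mul_sum]
      refine Finset.sum_congr rfl fun i _ => Finset.sum_congr rfl fun j _ => ?_
      rw [ite_and]
      split_ifs <;> ring1
    rw [e2, e3]
    by_cases hut : u < t
    · by_cases hst : s ≤ t
      · have : ¬ t < s := not_lt.2 hst
        by_cases hus : u < s <;> simp [hst, this, hut, hτ, hus]
      · have : t < s := not_le.1 hst
        by_cases hus : u < s <;> simp [hst, this, hut, hτ, hus]
        first | omega | ring1
    · have e4 : ∑ i : Fin M, ∑ j : Fin M, a i * B i j * (if t < (N : ℤ) - j then b j else 0) =
          ∑ i, ∑ j, a i * B i j * b j := by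
        refine Finset.sum_congr rfl fun i _ => Finset.sum_congr rfl fun j _ => ?_
        split_ifs with hi
        · rfl
        · rw [hu j (by omega)]
      rw [e4]
      by_cases hst : s ≤ t
      · have : ¬ t < s := not_lt.2 hst
        by_cases hus : u < s <;> simp [hst, this, hut, hτ, hus]
        omega
      · have : t < s := not_le.1 hst
        by_cases hus : u < s <;> simp [hst, this, hut, hτ, hus]

/-- The determinant of the kernel vanishes if more points are placed in a slice than it has
particles. -/
theorem det_corrKer_eq_zero {n : ℕ} (B : Matrix (Fin M) (Fin M) ℝ) (t : Fin n → ℤ) (x : Fin n → ℝ)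
    (u : ℤ) (hMN : M ≤ N) (hu : numPts M N u < (Finset.univ.filter fun k => t k = u).card) :
    (Matrix.of fun k l => corrKer lam N B (t k) (x k) (t l) (x l)).det = 0 := by
  classical
  -- the rows at times `≤ u` and the columns at times `≥ u`
  have hcard : Fintype.card {i // ¬ t i ≤ u} + (Finset.univ.filter fun k => t k = u).card ≤
      Fintype.card {j // u ≤ t j} := by
    rw [Fintype.card_subtype, Fintype.card_subtype, ← Finset.card_union_of_disjoint]
    · apply Finset.card_le_card
      intro i
      simp only [Finset.mem_union, Finset.mem_filter, Finset.mem_univ, true_and]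
      omega
    · rw [Finset.disjoint_left]
      intro i
      simp only [Finset.mem_filter, Finset.mem_univ, true_and]
      omega
  have hpath : ∀ i j, t i ≤ u → u ≤ t j →
      corrKer lam N B (t i) (x i) (t j) (x j) = pathKer lam N B (t i) (x i) (t j) (x j) :=
    fun i j hi hj => by rw [corrKer, trans_eq_zero (hi.trans hj), sub_zero]
  rcases le_or_gt u ((N : ℤ) - M) with huN | huN
  · have hd : min M (u + M).toNat ≤ numPts M N u := by
      rw [numPts]; split_ifs <;> omega
    refine det_eq_zero_of_factor (d := min M (u + M).toNat) _ (fun i => t i ≤ u) (fun j => u ≤ t j)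
      (fun i l => trans lam (-M + l) 1 (t i) (x i))
      (fun l j => ∑ j' : Fin M, B ⟨l, lt_of_lt_of_le l.2 (min_le_left _ _)⟩ j' *
        trans lam (t j) (x j) (N - j') 1) ?_ (by omega)
    intro i j hi hj
    rw [Matrix.of_apply, hpath i j hi hj, pathKer]
    have : ∀ i' : Fin M, ∑ j' : Fin M, trans lam (-M + i') 1 (t i) (x i) * B i' j' *
        trans lam (t j) (x j) (N - j') 1 = trans lam (-M + i') 1 (t i) (x i) *
        ∑ j' : Fin M, B i' j' * trans lam (t j) (x j) (N - j') 1 := fun i' => by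
      rw [Finset.mul_sum]; simp only [mul_assoc]
    simp_rw [this]
    symm
    refine Finset.sum_of_injOn (Fin.castLE (min_le_left M (u + M).toNat)) ?_ ?_ ?_ ?_
    · exact (Fin.castLE_injective _).injOn
    · intro _ _; simp
    · intro i' _ hi'
      rw [trans_eq_zero, zero_mul]
      by_contra hc
      refine hi' ⟨⟨i', by have := i'.2; omega⟩, by simp, rfl⟩
    · intro l _; rfl
  · have hd : min M (N - u).toNat ≤ numPts M N u := by
      rw [numPts]; split_ifs <;> omega
    refine det_eq_zero_of_factor (d := min M (N - u).toNat) _ (fun i => t i ≤ u) (fun j => u ≤ t j)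
      (fun i l => ∑ i' : Fin M, trans lam (-M + i') 1 (t i) (x i) *
        B i' ⟨l, lt_of_lt_of_le l.2 (min_le_left _ _)⟩)
      (fun l j => trans lam (t j) (x j) (N - l) 1) ?_ (by omega)
    intro i j hi hj
    rw [Matrix.of_apply, hpath i j hi hj, pathKer, Finset.sum_comm]
    simp_rw [← Finset.sum_mul]
    symm
    refine Finset.sum_of_injOn (Fin.castLE (min_le_left M (N - u).toNat)) ?_ ?_ ?_ ?_
    · exact (Fin.castLE_injective _).injOn
    · intro _ _; simp
    · intro i' _ hi'
      rw [trans_eq_zero, mul_zero]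
      by_contra hc
      refine hi' ⟨⟨i', by have := i'.2; omega⟩, by simp, rfl⟩
    · intro l _; rfl

/-! ### Bounds, integrability and the integration of one variable -/

/-- The determinants of the correlation kernel at given times and positions. -/
def kerDet (lam : ℤ → ℝ) {M : ℕ} (N : ℕ) (B : Matrix (Fin M) (Fin M) ℝ) {ι : Type*} [Fintype ι]
    [DecidableEq ι] (t : ι → ℤ) (x : ι → ℝ) : ℝ :=
  (Matrix.of fun k l => corrKer lam N B (t k) (x k) (t l) (x l)).det

theorem kerDet_comp {B : Matrix (Fin M) (Fin M) ℝ} {ι κ : Type*} [Fintype ι] [DecidableEq ι]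
    [Fintype κ] [DecidableEq κ] (e : κ ≃ ι) (t : ι → ℤ) (x : ι → ℝ) :
    kerDet lam N B (t ∘ e) (x ∘ e) = kerDet lam N B t x :=
  Matrix.det_submatrix_equiv_self e
    (Matrix.of fun k l => corrKer lam N B (t k) (x k) (t l) (x l))

theorem abs_mode_le (h : IsPoles lam δ) (k : ℤ) {r E : ℝ} (hr : 0 < r) (hE : |E| ≤ δ) :
    |mode lam k r| ≤ r ^ E := by
  obtain ⟨h1, h2⟩ := abs_le.1 hE
  unfold mode
  split_ifs with hk hr1 hr1
  · rw [abs_neg, abs_of_pos (Real.rpow_pos_of_pos hr _)]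
    exact Real.rpow_le_rpow_of_exponent_ge hr hr1 (h2.trans (h.lt_of_neg hk).le)
  · rw [abs_zero]; exact (Real.rpow_pos_of_pos hr _).le
  · rw [abs_of_pos (Real.rpow_pos_of_pos hr _)]
    exact Real.rpow_le_rpow_of_exponent_le hr1.le ((h.lt_of_nonneg (not_lt.1 hk)).le.trans h1)
  · rw [abs_zero]; exact (Real.rpow_pos_of_pos hr _).le

/-- A bound on the transition kernel by powers. The freedom in the exponents comes from `|mode lam k
r| ≤ r ^ E` for `|E| ≤ δ`; raising `E` to `E'` in the power of `y ≤ 1` only weakens the bound. -/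
theorem exists_abs_trans_le (h : IsPoles lam δ) (t s : ℤ) :
    ∃ D, 0 ≤ D ∧ ∀ E E' x y : ℝ, |E| ≤ δ → E ≤ E' → x ∈ Ioc (0 : ℝ) 1 → y ∈ Ioc (0 : ℝ) 1 →
      |trans lam t y s x| ≤ D * x ^ (-1 / 2 + E) * y ^ (-1 / 2 - E') := by
  refine ⟨∑ k ∈ Finset.Ico t s, |coef lam t s k|, Finset.sum_nonneg fun _ _ => abs_nonneg _, ?_⟩
  intro E E' x y hE hEE hx hy
  have hsq : (√(x * y))⁻¹ = x ^ (-1 / 2 : ℝ) * y ^ (-1 / 2 : ℝ) := by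
    rw [Real.sqrt_eq_rpow, ← Real.rpow_neg (mul_nonneg hx.1.le hy.1.le),
      Real.mul_rpow hx.1.le hy.1.le]
    norm_num
  have hm : ∀ k, |mode lam k (x / y)| ≤ x ^ E * y ^ (-E') := by
    intro k
    refine (abs_mode_le h k (div_pos hx.1 hy.1) hE).trans ?_
    rw [Real.div_rpow hx.1.le hy.1.le, div_eq_mul_inv, ← Real.rpow_neg hy.1.le]
    exact mul_le_mul_of_nonneg_left
      (Real.rpow_le_rpow_of_exponent_ge hy.1 hy.2 (neg_le_neg hEE)) (Real.rpow_nonneg hx.1.le _)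
  rw [trans, hsq, abs_mul, abs_of_nonneg (mul_nonneg (Real.rpow_nonneg hx.1.le _)
    (Real.rpow_nonneg hy.1.le _)), Real.rpow_add hx.1, sub_eq_add_neg, Real.rpow_add hy.1]
  calc _ ≤ x ^ (-1 / 2 : ℝ) * y ^ (-1 / 2 : ℝ) *
        ((∑ k ∈ Finset.Ico t s, |coef lam t s k|) * (x ^ E * y ^ (-E'))) := by
        refine mul_le_mul_of_nonneg_left ?_ (mul_nonneg (Real.rpow_nonneg hx.1.le _)
          (Real.rpow_nonneg hy.1.le _))
        refine (Finset.abs_sum_le_sum_abs _ _).trans ?_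
        rw [Finset.sum_mul]
        refine Finset.sum_le_sum fun k _ => ?_
        rw [abs_mul]
        exact mul_le_mul_of_nonneg_left (hm k) (abs_nonneg _)
    _ = _ := by ring

/-- A bound on the kernel by powers of the positions. The exponents depend on the times in such a
way that in a product along a cycle of points every position ends up with exponent
`-1 + δ / (M + N + 1)`. -/
theorem exists_abs_corrKer_le (h : IsPoles lam δ) (B : Matrix (Fin M) (Fin M) ℝ) {s t : ℤ}
    (hs : s ∈ Finset.Icc (-(M : ℤ) + 1) (N - 1)) (ht : t ∈ Finset.Icc (-(M : ℤ) + 1) (N - 1)) :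
    ∃ D, 0 ≤ D ∧ ∀ x ∈ Ioo (0 : ℝ) 1, ∀ y ∈ Ioo (0 : ℝ) 1,
      |corrKer lam N B s x t y| ≤
        D * x ^ (-1 / 2 + (δ / (M + N + 1) - δ / (M + N + 1) * s)) *
          y ^ (-1 / 2 - -(δ / (M + N + 1) * t)) := by
  set ε := δ / (M + N + 1) with hε
  have hMN : (0 : ℝ) < M + N + 1 := by positivity
  have hε0 : 0 < ε := div_pos h.pos hMN
  have hδ : ε * (M + N + 1) = δ := div_mul_cancel₀ _ hMN.ne'
  rw [Finset.mem_Icc] at hs ht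
  have hs1 : (-(M : ℝ) + 1) ≤ s := by exact_mod_cast hs.1
  have hs2 : (s : ℝ) ≤ N - 1 := by exact_mod_cast hs.2
  have ht1 : (-(M : ℝ) + 1) ≤ t := by exact_mod_cast ht.1
  have ht2 : (t : ℝ) ≤ N - 1 := by exact_mod_cast ht.2
  have hM0 : (0 : ℝ) ≤ M := by positivity
  have hN0 : (0 : ℝ) ≤ N := by positivity
  have hEs : |ε - ε * s| ≤ δ := by
    rw [← hδ, abs_le]
    constructor <;> nlinarith
  have hEt : |(-(ε * t))| ≤ δ := by
    rw [← hδ, abs_le]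
    constructor <;> nlinarith
  choose D1 hD1 b1 using fun i : Fin M => exists_abs_trans_le h (-M + i) s
  choose D2 hD2 b2 using fun j : Fin M => exists_abs_trans_le h t (N - j)
  obtain ⟨D3, hD3, b3⟩ := exists_abs_trans_le h t s
  refine ⟨(∑ i, ∑ j, D1 i * |B i j| * D2 j) + D3, add_nonneg (Finset.sum_nonneg fun i _ =>
    Finset.sum_nonneg fun j _ => mul_nonneg (mul_nonneg (hD1 i) (abs_nonneg _)) (hD2 j)) hD3, ?_⟩
  intro x hx y hy
  have hx' : x ∈ Ioc (0 : ℝ) 1 := ⟨hx.1, hx.2.le⟩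
  have hy' : y ∈ Ioc (0 : ℝ) 1 := ⟨hy.1, hy.2.le⟩
  have h1 : (1 : ℝ) ∈ Ioc (0 : ℝ) 1 := by simp
  have px := Real.rpow_nonneg hx.1.le (-1 / 2 + (ε - ε * s))
  have py := Real.rpow_nonneg hy.1.le (-1 / 2 - -(ε * t))
  rw [corrKer, add_mul, add_mul]
  refine (abs_sub _ _).trans (add_le_add ?_ ?_)
  · rw [pathKer, Finset.sum_mul, Finset.sum_mul]
    refine (Finset.abs_sum_le_sum_abs _ _).trans (Finset.sum_le_sum fun i _ => ?_)
    rw [Finset.sum_mul, Finset.sum_mul]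
    refine (Finset.abs_sum_le_sum_abs _ _).trans (Finset.sum_le_sum fun j _ => ?_)
    have e1 := b1 i (ε - ε * s) (ε - ε * s) x 1 hEs le_rfl hx' h1
    have e2 := b2 j (-(ε * t)) (-(ε * t)) 1 y hEt le_rfl h1 hy'
    rw [Real.one_rpow, mul_one] at e1 e2
    rw [abs_mul, abs_mul]
    calc _ ≤ (D1 i * x ^ (-1 / 2 + (ε - ε * s))) * |B i j| * (D2 j * y ^ (-1 / 2 - -(ε * t))) := by
          gcongr
          exact mul_nonneg (mul_nonneg (hD1 i) px) (abs_nonneg _)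
      _ = _ := by ring
  · by_cases hst : t < s
    · refine b3 _ _ x y hEs ?_ hx' hy'
      have : (t : ℝ) + 1 ≤ s := by exact_mod_cast hst
      nlinarith
    · rw [trans_eq_zero (not_lt.1 hst), abs_zero]
      positivity

theorem measurable_trans (t s : ℤ) : Measurable fun p : ℝ × ℝ => trans lam t p.1 s p.2 := by
  unfold trans
  refine Measurable.mul (by fun_prop) (Finset.measurable_fun_sum _ fun k _ => ?_)
  exact ((mode_measurable k).comp (measurable_snd.div measurable_fst)).const_mul _

theorem measurable_corrKer (B : Matrix (Fin M) (Fin M) ℝ) (s t : ℤ) :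
    Measurable fun p : ℝ × ℝ => corrKer lam N B s p.1 t p.2 := by
  have h1 : ∀ i : Fin M, Measurable fun p : ℝ × ℝ => trans lam (-(M : ℤ) + i) 1 s p.1 := fun i =>
    (measurable_trans (lam := lam) (-(M : ℤ) + i) s).comp
      (g := fun p : ℝ × ℝ => trans lam (-(M : ℤ) + i) p.1 s p.2) (f := fun p : ℝ × ℝ => (1, p.1))
      (measurable_const.prodMk measurable_fst)
  have h2 : ∀ j : Fin M, Measurable fun p : ℝ × ℝ => trans lam t p.2 ((N : ℤ) - j) 1 := fun j =>
    (measurable_trans (lam := lam) t ((N : ℤ) - j)).comp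
      (g := fun p : ℝ × ℝ => trans lam t p.1 ((N : ℤ) - j) p.2) (f := fun p : ℝ × ℝ => (p.2, 1))
      (measurable_snd.prodMk measurable_const)
  have h3 : Measurable fun p : ℝ × ℝ => trans lam t p.2 s p.1 :=
    (measurable_trans (lam := lam) t s).comp
      (g := fun p : ℝ × ℝ => trans lam t p.1 s p.2) (f := fun p : ℝ × ℝ => (p.2, p.1))
      (measurable_snd.prodMk measurable_fst)
  exact (Finset.measurable_fun_sum _ fun i _ => Finset.measurable_fun_sum _ fun j _ =>
    ((h1 i).mul measurable_const).mul (h2 j)).sub h3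

theorem measurable_det_kernel {f : ℤ → ℝ → ℤ → ℝ → ℝ}
    (hf : ∀ s t, Measurable fun p : ℝ × ℝ => f s p.1 t p.2) {ι : Type*} [Fintype ι]
    [DecidableEq ι] (t : ι → ℤ) :
    Measurable fun x : ι → ℝ => (Matrix.of fun k l => f (t k) (x k) (t l) (x l)).det := by
  simp_rw [Matrix.det_apply', Matrix.of_apply]
  refine Finset.measurable_fun_sum _ fun π _ =>
    Measurable.const_mul (Finset.measurable_fun_prod _ fun i _ => ?_) _
  have h2 : Measurable fun x : ι → ℝ => (x (π i), x i) :=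
    (measurable_pi_apply (π i)).prodMk (measurable_pi_apply i)
  exact (hf (t (π i)) (t i)).comp h2

theorem measurable_kerDet (B : Matrix (Fin M) (Fin M) ℝ) {ι : Type*} [Fintype ι] [DecidableEq ι]
    (t : ι → ℤ) : Measurable fun x : ι → ℝ => kerDet lam N B t x :=
  measurable_det_kernel (fun s t => measurable_corrKer B s t) t

/-- The open unit cube with an arbitrary finite set of coordinates. -/
def unitCube (ι : Type*) : Set (ι → ℝ) := univ.pi fun _ => Ioo (0 : ℝ) 1

theorem measurableSet_unitCube (ι : Type*) [Countable ι] : MeasurableSet (unitCube ι) :=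
  MeasurableSet.univ_pi fun _ => measurableSet_Ioo

/-- In each term of the Leibniz expansion, the time-dependent parts of the exponents in
`exists_abs_corrKer_le` cancel, since every variable occurs once as a row and once as a column. What
remains is the integrable power `x i ^ (ε - 1)` of each variable. -/
theorem integrableOn_kerDet (h : IsPoles lam δ) (B : Matrix (Fin M) (Fin M) ℝ) {ι : Type*}
    [Fintype ι] [DecidableEq ι] {t : ι → ℤ}
    (ht : ∀ i, t i ∈ Finset.Icc (-(M : ℤ) + 1) (N - 1)) :
    IntegrableOn (kerDet lam N B t) (unitCube ι) := by
  have hm := measurable_kerDet (lam := lam) (N := N) B t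
  have hMN : (0 : ℝ) < M + N + 1 := by positivity
  choose D hD b using fun i j => exists_abs_corrKer_le h B (ht i) (ht j)
  set ε := δ / (M + N + 1) with hε
  have hε0 : 0 < ε := div_pos h.pos hMN
  have hint : IntegrableOn (fun x : ι → ℝ => ∑ π : Equiv.Perm ι, (∏ i, D (π i) i) *
      ∏ i, x i ^ (ε - 1)) (unitCube ι) := by
    refine integrable_finsetSum _ fun π _ => Integrable.const_mul ?_ _
    rw [unitCube, volume_pi, Measure.restrict_pi_pi]
    refine Integrable.fintype_prod (f := fun _ z => z ^ (ε - 1)) fun i => ?_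
    exact (integrableOn_Ioc_iff_integrableOn_Ioo).1
      (integrableOn_rpow_Ioc (Or.inr ⟨hε0, rfl⟩) zero_le_one)
  refine Integrable.mono' hint hm.aestronglyMeasurable ?_
  refine (ae_restrict_iff' (measurableSet_unitCube ι)).2 (ae_of_all _ fun x hx => ?_)
  have hx : ∀ i, x i ∈ Ioo (0 : ℝ) 1 := fun i => hx i (mem_univ i)
  rw [kerDet, Matrix.det_apply, Real.norm_eq_abs]
  refine (Finset.abs_sum_le_sum_abs _ _).trans (Finset.sum_le_sum fun π _ => ?_)
  rw [show |Equiv.Perm.sign π • ∏ i, (Matrix.of fun k l =>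
    corrKer lam N B (t k) (x k) (t l) (x l)) (π i) i| = |∏ i, (Matrix.of fun k l =>
    corrKer lam N B (t k) (x k) (t l) (x l)) (π i) i| by
      rcases Int.units_eq_one_or (Equiv.Perm.sign π) with e | e <;> rw [e] <;> simp,
    Finset.abs_prod]
  calc _ ≤ ∏ i, (D (π i) i * x (π i) ^ (-1 / 2 + (ε - ε * t (π i))) *
        x i ^ (-1 / 2 - -(ε * t i))) :=
        Finset.prod_le_prod (fun _ _ => abs_nonneg _) fun i _ => b (π i) i _ (hx _) _ (hx _)
    _ = _ := by
        rw [Finset.prod_mul_distrib, Finset.prod_mul_distrib, mul_assoc]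
        congr 1
        rw [Equiv.prod_comp π (fun j => x j ^ (-1 / 2 + (ε - ε * t j))),
          ← Finset.prod_mul_distrib]
        refine Finset.prod_congr rfl fun i _ => ?_
        rw [← Real.rpow_add (hx i).1]
        congr 1
        ring

/-- Integration of one variable over its slice `u` lowers the order of the determinant by one. -/
theorem integral_kerDet_cons (h : IsPoles lam δ) (hMN : M ≤ N) {B : Matrix (Fin M) (Fin M) ℝ}
    (hB : B * (linkMat lam M N).transpose = 1) {n : ℕ} (t : Fin n → ℤ) {u : ℤ}
    (hu : u ∈ Finset.Icc (-(M : ℤ) + 1) (N - 1)) {x : Fin n → ℝ} (hx : x ∈ unitCube (Fin n)) :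
    ∫ z in Ioo (0 : ℝ) 1, kerDet lam N B (Fin.cons u t : Fin (n + 1) → ℤ)
        (Fin.cons z x : Fin (n + 1) → ℝ) =
      (numPts M N u - (Finset.univ.filter fun k => t k = u).card) * kerDet lam N B t x := by
  have hx : ∀ i, x i ∈ Ioo (0 : ℝ) 1 := fun i => hx i (mem_univ i)
  rw [Finset.mem_Icc] at hu
  set K : Matrix (Fin n) (Fin n) ℝ :=
    Matrix.of fun k l => corrKer lam N B (t k) (x k) (t l) (x l) with hK
  have e : ∀ z, kerDet lam N B (Fin.cons u t : Fin (n + 1) → ℤ) (Fin.cons z x : Fin (n + 1) → ℝ) =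
      corrKer lam N B u z u z * K.det - ∑ l, ∑ k, K.adjugate l k *
        (corrKer lam N B (t k) (x k) u z * corrKer lam N B u z (t l) (x l)) := by
    intro z
    rw [kerDet, det_bordered]
    congr 1
    exact Finset.sum_congr rfl fun l _ => Finset.sum_congr rfl fun k _ => by
      simp only [Matrix.of_apply, Fin.cons_zero, Fin.cons_succ]
      rw [show (Matrix.of fun k l : Fin (n + 1) => corrKer lam N B
        ((Fin.cons u t : Fin (n + 1) → ℤ) k) ((Fin.cons z x : Fin (n + 1) → ℝ) k)
        ((Fin.cons u t : Fin (n + 1) → ℤ) l) ((Fin.cons z x : Fin (n + 1) → ℝ) l)).submatrix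
          Fin.succ Fin.succ = K from rfl]
      ring
  have tr := corrKer_trace h hMN (t := u) (by omega) (by omega) hB
  have cv := fun k l => corrKer_conv (t := u) (s := t k) (u := t l) h hB (hx k) (hx l) hMN
  have I2 : ∀ l k, IntegrableOn (fun z => K.adjugate l k *
        (corrKer lam N B (t k) (x k) u z * corrKer lam N B u z (t l) (x l))) (Ioo 0 1) :=
    fun l k => (cv k l).1.const_mul _
  simp_rw [e]
  rw [integral_sub (tr.1.mul_const _) (integrable_finsetSum _ fun l _ =>
    integrable_finsetSum _ fun k _ => I2 l k), integral_mul_const, tr.2, sub_mul]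
  congr 1
  rw [integral_finsetSum _ fun l _ => integrable_finsetSum _ fun k _ => I2 l k]
  have e2 : ∀ l, ∫ z in Ioo (0 : ℝ) 1, ∑ k, K.adjugate l k *
        (corrKer lam N B (t k) (x k) u z * corrKer lam N B u z (t l) (x l)) =
      ∑ k, ((if t k ≤ u then 1 else 0) * (K k l * K.adjugate l k) -
        (if t l < u then 1 else 0) * (K.adjugate l k * K k l)) := by
    intro l
    rw [integral_finsetSum _ fun k _ => I2 l k]
    refine Finset.sum_congr rfl fun k _ => ?_
    rw [integral_const_mul, (cv k l).2, hK, Matrix.of_apply]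
    ring
  simp_rw [e2, Finset.sum_sub_distrib]
  rw [Finset.sum_comm]
  simp_rw [← Finset.mul_sum, ← Matrix.mul_apply, Matrix.mul_adjugate, Matrix.adjugate_mul,
    Matrix.smul_apply, Matrix.one_apply_eq, smul_eq_mul, mul_one, ← Finset.sum_mul]
  rw [← sub_mul, kerDet, ← Finset.sum_sub_distrib, ← Finset.sum_boole]
  congr 1
  refine Finset.sum_congr rfl fun k _ => ?_
  rcases lt_trichotomy (t k) u with hk | hk | hk
  · simp [hk, hk.le, hk.ne]
  · simp [hk]
  · simp [hk.not_ge, hk.le, hk.ne']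

/-- `integral_kerDet_cons` integrated over the remaining variables: a particle of slice `u` is
integrated out, and the factor is the number of particles of that slice not yet listed in `t`. -/
theorem setIntegral_kerDet_cons (h : IsPoles lam δ) (hMN : M ≤ N) {B : Matrix (Fin M) (Fin M) ℝ}
    (hB : B * (linkMat lam M N).transpose = 1) {n : ℕ} {t : Fin n → ℤ} {u : ℤ}
    (hu : u ∈ Finset.Icc (-(M : ℤ) + 1) (N - 1))
    (ht : ∀ i, t i ∈ Finset.Icc (-(M : ℤ) + 1) (N - 1)) {S : Set (Fin n → ℝ)}
    (hS : MeasurableSet S) :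
    ∫ x in {x : Fin (n + 1) → ℝ | Fin.tail x ∈ S} ∩ unitCube (Fin (n + 1)),
        kerDet lam N B (Fin.cons u t : Fin (n + 1) → ℤ) x =
      (numPts M N u - (Finset.univ.filter fun k => t k = u).card) *
        ∫ x in S ∩ unitCube (Fin n), kerDet lam N B t x := by
  have hmp := (volume_preserving_piFinSuccAbove (fun _ : Fin (n + 1) => ℝ) 0).symm
  have hset : (MeasurableEquiv.piFinSuccAbove (fun _ : Fin (n + 1) => ℝ) 0).symm ⁻¹'
      ({x : Fin (n + 1) → ℝ | Fin.tail x ∈ S} ∩ unitCube (Fin (n + 1))) =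
      Ioo (0 : ℝ) 1 ×ˢ (S ∩ unitCube (Fin n)) := by
    ext ⟨z, x⟩
    simp only [mem_preimage, mem_inter_iff, mem_ofPred_eq, unitCube, mem_pi, mem_univ, true_imp_iff,
      mem_prod, MeasurableEquiv.piFinSuccAbove_symm_apply, Fin.insertNthEquiv_apply,
      Fin.forall_fin_succ]
    simp [Fin.insertNth_zero']
    tauto
  have hi : IntegrableOn (kerDet lam N B (Fin.cons u t : Fin (n + 1) → ℤ))
      ({x : Fin (n + 1) → ℝ | Fin.tail x ∈ S} ∩ unitCube (Fin (n + 1))) := by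
    refine (integrableOn_kerDet h B ?_).mono_set inter_subset_right
    intro i
    refine Fin.cases ?_ (fun i => ?_) i
    · simpa using hu
    · simpa using ht i
  have hcons : ∀ p : ℝ × (Fin n → ℝ),
      (MeasurableEquiv.piFinSuccAbove (fun _ : Fin (n + 1) => ℝ) 0).symm p = Fin.cons p.1 p.2 := by
    intro p
    rw [MeasurableEquiv.piFinSuccAbove_symm_apply, Fin.insertNthEquiv_zero]
    rfl
  rw [← hmp.setIntegral_preimage_emb (MeasurableEquiv.measurableEmbedding _), hset]
  rw [← hmp.integrableOn_comp_preimage (MeasurableEquiv.measurableEmbedding _), hset] at hi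
  simp only [Function.comp_def, hcons] at hi ⊢
  rw [IntegrableOn, Measure.volume_eq_prod, ← Measure.prod_restrict] at hi
  rw [Measure.volume_eq_prod, ← Measure.prod_restrict, integral_prod_symm _ hi,
    ← integral_const_mul]
  refine setIntegral_congr_fun (hS.inter (measurableSet_unitCube _)) fun x hx => ?_
  exact integral_kerDet_cons h hMN hB t hu hx.2

/-! ### Interlacing and determinants of indicators -/

theorem det_indicator_eq_one {m : ℕ} {x y : Fin m → ℝ} (hx : StrictMono x)
    (h1 : ∀ i, x i ≤ y i) (h2 : ∀ i j : Fin m, (i : ℕ) = j + 1 → y j < x i) :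
    (Matrix.of fun i j => if x i ≤ y j then (1 : ℝ) else 0).det = 1 := by
  rw [Matrix.det_of_isUpperTriangular]
  · exact Finset.prod_eq_one fun i _ => by simp [h1 i]
  · intro i j hij
    have hij : j < i := hij
    have hlt : (j : ℕ) + 1 < m := lt_of_le_of_lt hij i.2
    have : y j < x i := (h2 ⟨j + 1, hlt⟩ j rfl).trans_le (hx.monotone (by
      rw [Fin.le_def]; exact hij))
    simp [this]

/-- If the indicator determinant does not vanish, every interval between consecutive `x`'s contains
exactly one of the `y`'s. -/
theorem interlacing_of_det_indicator_ne_zero {m : ℕ} {x y : Fin m → ℝ} (hx : StrictMono x)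
    (hy : StrictMono y)
    (hdet : (Matrix.of fun i j => if x i ≤ y j then (1 : ℝ) else 0).det ≠ 0) :
    (∀ i, x i ≤ y i) ∧ ∀ i j : Fin m, (i : ℕ) = j + 1 → y j < x i := by
  have key : ∀ i : Fin m, ∃ j, x i ≤ y j ∧ ∀ i' : Fin m, (i' : ℕ) = i + 1 → y j < x i' := by
    intro i
    by_contra hc
    push Not at hc
    apply hdet
    by_cases hi : (i : ℕ) + 1 < m
    · -- two consecutive rows agree
      refine Matrix.det_zero_of_row_eq (i := i) (j := ⟨i + 1, hi⟩) ?_ ?_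
      · intro e
        have := congrArg Fin.val e
        simp at this
      · ext j
        simp only [Matrix.of_apply]
        have hlt : x i < x ⟨i + 1, hi⟩ := hx (by rw [Fin.lt_def]; simp)
        by_cases hj : x i ≤ y j
        · obtain ⟨i', hi', hle⟩ := hc j hj
          have : i' = ⟨i + 1, hi⟩ := Fin.ext hi'
          rw [if_pos hj, if_pos (this ▸ hle)]
        · rw [if_neg hj, if_neg (fun h => hj (hlt.le.trans h))]
    · -- the last row vanishes
      refine Matrix.det_eq_zero_of_row_eq_zero i fun j => ?_
      rw [Matrix.of_apply, if_neg]
      intro hj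
      obtain ⟨i', hi', _⟩ := hc j hj
      have := i'.2
      omega
  choose f hf1 hf2 using key
  have hmono : StrictMono f := by
    intro i i' hii
    have hlt : (i : ℕ) + 1 < m := lt_of_le_of_lt hii i'.2
    have h1 : y (f i) < x ⟨i + 1, hlt⟩ := hf2 i _ rfl
    have h2 : x ⟨i + 1, hlt⟩ ≤ x i' := hx.monotone (by rw [Fin.le_def]; exact hii)
    exact hy.lt_iff_lt.1 ((h1.trans_le h2).trans_le (hf1 i'))
  have hid : f = id := by
    have := hmono.range_inj (g := id) strictMono_id
    refine this.1 ?_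
    rw [range_id, (Finite.injective_iff_surjective.1 hmono.injective).range_eq]
  subst hid
  exact ⟨hf1, fun i j h => hf2 j i h⟩

/-- The one-step kernel is an indicator times a power of each position, so that determinants of
one-step kernels detect interlacing. -/
theorem trans_step (t : ℤ) {x y : ℝ} (hx : 0 < x) (hy : 0 < y) :
    trans lam t y (t + 1) x =
      x ^ (lam t - 1 / 2) * (y ^ (-lam t - 1 / 2) *
        (if t < 0 then (if x ≤ y then 1 else 0) else (if y < x then 1 else 0))) := by
  have hsq : (√(x * y))⁻¹ = x ^ (-1 / 2 : ℝ) * y ^ (-1 / 2 : ℝ) := by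
    rw [Real.sqrt_eq_rpow, ← Real.rpow_neg (mul_nonneg hx.le hy.le), Real.mul_rpow hx.le hy.le]
    norm_num
  have hIco : Finset.Ico t (t + 1) = {t} := by ext; simp; omega
  have hr : (x / y) ^ lam t = x ^ lam t * y ^ (-lam t) := by
    rw [Real.div_rpow hx.le hy.le, Real.rpow_neg hy.le, div_eq_mul_inv]
  have e1 : x ^ (lam t - 1 / 2) = x ^ lam t * x ^ (-1 / 2 : ℝ) := by
    rw [← Real.rpow_add hx]; ring_nf
  have e2 : y ^ (-lam t - 1 / 2) = y ^ (-lam t) * y ^ (-1 / 2 : ℝ) := by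
    rw [← Real.rpow_add hy]; ring_nf
  rw [trans, hsq, hIco, Finset.sum_singleton, coef, hIco, pfCoef, Finset.erase_singleton,
    Finset.prod_empty, mul_one, stepSign, mode, hr, e1, e2]
  simp only [div_le_one hy, one_lt_div hy]
  split_ifs <;> ring

/-! ### The joint density of all particles -/

/-- The number of paths that cross the step from time `s - 1` to time `s`. -/
def numPaths (M N : ℕ) (s : ℤ) : ℕ :=
  if s ≤ 0 then (M + s).toNat else min M (N + 1 - s).toNat

/-- The particles of slice `s`, continued by `1, 1, 1, …`. -/
def hatPos (X : Config M N) (s : ℤ) (i : ℕ) : ℝ :=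
  if h : ∃ _ : s ∈ Finset.Icc (-(M : ℤ) + 1) (N - 1), i < numPts M N s then X ⟨s, h.1⟩ ⟨i, h.2⟩
  else 1

/-- The labels of all particles: a time and an index in its slice. -/
abbrev Slot (M N : ℕ) : Type := (t : Time M N) × Fin (numPts M N t)

/-- The labels of all path segments from one time to the next, by the endpoint of the step and an
index; there are `M + N` steps, the first one out of the first source and the last one into the last
sink. -/
abbrev Seg (M N : ℕ) : Type :=
  (s : ↥(Finset.Icc (-(M : ℤ) + 1) (N : ℤ))) × Fin (numPaths M N s)

theorem hatPos_coe (X : Config M N) (t : Time M N) (i : Fin (numPts M N t)) :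
    hatPos X t i = X t i := by
  rw [hatPos, dif_pos ⟨t.2, i.2⟩]

theorem hatPos_eq_one (X : Config M N) {s : ℤ} {i : ℕ} (h : numPts M N s ≤ i) :
    hatPos X s i = 1 := by
  rw [hatPos, dif_neg]
  rintro ⟨_, h'⟩
  omega

theorem numPts_le_numPaths {t : ℤ} (h : -(M : ℤ) ≤ t) : numPts M N t ≤ numPaths M N t := by
  unfold numPts numPaths
  split_ifs <;> omega

theorem numPts_le_numPaths_succ (hMN : M ≤ N) {t : ℤ} (h : -(M : ℤ) ≤ t) :
    numPts M N t ≤ numPaths M N (t + 1) := by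
  unfold numPts numPaths
  split_ifs <;> omega

theorem numPts_lt_numPaths (hMN : M ≤ N) {j : ℕ} (hj : j < M) :
    numPts M N ((N : ℤ) - j) < numPaths M N ((N : ℤ) - j) := by
  unfold numPts numPaths
  split_ifs <;> omega

theorem numPts_lt_numPaths_succ {i : ℕ} (hi : i < M) :
    numPts M N (-(M : ℤ) + i) < numPaths M N (-(M : ℤ) + i + 1) := by
  unfold numPts numPaths
  split_ifs <;> omega

/-- A path segment that does not end in a particle ends in the one sink at time `s`, which has the
last index. -/
theorem eq_numPts_of_lt_numPaths (hMN : M ≤ N) {s : ℤ} {i : ℕ} (h1 : -(M : ℤ) + 1 ≤ s)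
    (h2 : s ≤ N) (hi : i < numPaths M N s) (h : ¬i < numPts M N s) :
    (N - s).toNat < M ∧ i = numPts M N s := by
  unfold numPts at h ⊢
  unfold numPaths at hi
  split_ifs at * <;> omega

/-- A path segment that does not start in a particle starts in the one source at time `s - 1`, which
has the last index. -/
theorem eq_numPts_of_lt_numPaths' (hMN : M ≤ N) {s : ℤ} {i : ℕ} (h1 : -(M : ℤ) + 1 ≤ s)
    (h2 : s ≤ N) (hi : i < numPaths M N s) (h : ¬i < numPts M N (s - 1)) :
    (s - 1 + M).toNat < M ∧ i = numPts M N (s - 1) := by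
  unfold numPts at h ⊢
  unfold numPaths at hi
  split_ifs at * <;> omega

theorem lt_of_lt_numPts (hMN : M ≤ N) {s : ℤ} {i : ℕ} (h1 : -(M : ℤ) ≤ s) (h2 : s ≤ N)
    (h : i < numPts M N s) : s ∈ Finset.Icc (-(M : ℤ) + 1) (N - 1) := by
  rw [Finset.mem_Icc]
  unfold numPts at h
  split_ifs at h <;> omega

/-- The endpoint of a path segment, as a particle or a sink. -/
def rowMap (hMN : M ≤ N) : Slot M N ⊕ Fin M → Seg M N
  | Sum.inl p => ⟨⟨p.1, by have := Finset.mem_Icc.1 p.1.2; rw [Finset.mem_Icc]; omega⟩, p.2, by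
      have h1 := Finset.mem_Icc.1 p.1.2
      exact p.2.2.trans_le (numPts_le_numPaths (by omega))⟩
  | Sum.inr j => ⟨⟨(N : ℤ) - j, by have := j.2; rw [Finset.mem_Icc]; omega⟩, numPts M N (N - j),
      numPts_lt_numPaths hMN j.2⟩

/-- The starting point of a path segment, as a particle or a source. -/
def colMap (hMN : M ≤ N) : Slot M N ⊕ Fin M → Seg M N
  | Sum.inl p => ⟨⟨p.1 + 1, by have := Finset.mem_Icc.1 p.1.2; rw [Finset.mem_Icc]; omega⟩, p.2, by
      have h1 := Finset.mem_Icc.1 p.1.2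
      exact p.2.2.trans_le (numPts_le_numPaths_succ hMN (by omega))⟩
  | Sum.inr i => ⟨⟨-(M : ℤ) + i + 1, by have := i.2; rw [Finset.mem_Icc]; omega⟩,
      numPts M N (-M + i), numPts_lt_numPaths_succ i.2⟩

theorem Seg.ext_iff' {p q : Seg M N} : p = q ↔ (p.1 : ℤ) = q.1 ∧ (p.2 : ℕ) = q.2 := by
  refine ⟨fun h => h ▸ ⟨rfl, rfl⟩, ?_⟩
  obtain ⟨⟨s, hs⟩, i⟩ := p
  obtain ⟨⟨t, ht⟩, j⟩ := q
  rintro ⟨h1, h2⟩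
  simp only at h1 h2
  subst h1
  obtain rfl : i = j := Fin.ext h2
  rfl

theorem Slot.ext_iff' {p q : Slot M N} : p = q ↔ (p.1 : ℤ) = q.1 ∧ (p.2 : ℕ) = q.2 := by
  refine ⟨fun h => h ▸ ⟨rfl, rfl⟩, ?_⟩
  obtain ⟨⟨s, hs⟩, i⟩ := p
  obtain ⟨⟨t, ht⟩, j⟩ := q
  rintro ⟨h1, h2⟩
  simp only at h1 h2
  subst h1
  obtain rfl : i = j := Fin.ext h2
  rfl

/-- Every path segment ends in exactly one particle or sink. -/
theorem rowMap_bijective (hMN : M ≤ N) : Function.Bijective (rowMap hMN) := by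
  constructor
  · rintro (p | i) (q | j) e <;> rw [Seg.ext_iff'] at e <;> simp only [rowMap] at e
    · exact congrArg _ (Slot.ext_iff'.2 e)
    · exfalso
      have := p.2.2
      have e2 := congrArg (numPts M N) e.1
      omega
    · exfalso
      have := q.2.2
      have e2 := congrArg (numPts M N) e.1
      omega
    · exact congrArg _ (Fin.ext (by omega))
  · rintro ⟨⟨s, hs⟩, i⟩
    have hs' := Finset.mem_Icc.1 hs
    have hi : (i : ℕ) < numPaths M N s := i.2
    by_cases h : (i : ℕ) < numPts M N s
    · have hsN : s ∈ Finset.Icc (-(M : ℤ) + 1) (N - 1) :=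
        lt_of_lt_numPts hMN (by omega) (by omega) h
      exact ⟨Sum.inl ⟨⟨s, hsN⟩, ⟨i, h⟩⟩, Seg.ext_iff'.2 ⟨rfl, rfl⟩⟩
    · obtain ⟨hj, hi'⟩ := eq_numPts_of_lt_numPaths hMN hs'.1 hs'.2 hi h
      have e1 : (N : ℤ) - (N - s).toNat = s := by omega
      refine ⟨Sum.inr ⟨(N - s).toNat, hj⟩, Seg.ext_iff'.2 ⟨e1, ?_⟩⟩
      simp only [rowMap, e1, hi']

/-- Every path segment starts in exactly one particle or source. -/
theorem colMap_bijective (hMN : M ≤ N) : Function.Bijective (colMap hMN) := by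
  constructor
  · rintro (p | i) (q | j) e <;> rw [Seg.ext_iff'] at e <;> simp only [colMap] at e
    · exact congrArg _ (Slot.ext_iff'.2 ⟨by omega, e.2⟩)
    · exfalso
      have := p.2.2
      have e2 := congrArg (numPts M N) (show (p.1 : ℤ) = -M + j by omega)
      omega
    · exfalso
      have := q.2.2
      have e2 := congrArg (numPts M N) (show (q.1 : ℤ) = -M + i by omega)
      omega
    · exact congrArg _ (Fin.ext (by omega))
  · rintro ⟨⟨s, hs⟩, i⟩
    have hs' := Finset.mem_Icc.1 hs
    have hi : (i : ℕ) < numPaths M N s := i.2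
    by_cases h : (i : ℕ) < numPts M N (s - 1)
    · have hsN : s - 1 ∈ Finset.Icc (-(M : ℤ) + 1) (N - 1) :=
        lt_of_lt_numPts hMN (by omega) (by omega) h
      exact ⟨Sum.inl ⟨⟨s - 1, hsN⟩, ⟨i, h⟩⟩, Seg.ext_iff'.2 ⟨by simp [colMap], rfl⟩⟩
    · obtain ⟨hj, hi'⟩ := eq_numPts_of_lt_numPaths' hMN hs'.1 hs'.2 hi h
      have e1 : -(M : ℤ) + (s - 1 + M).toNat = s - 1 := by omega
      refine ⟨Sum.inr ⟨(s - 1 + M).toNat, hj⟩, Seg.ext_iff'.2 ⟨by simp only [colMap]; omega, ?_⟩⟩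
      simp only [colMap, e1, hi']

/-- The transition kernels between all starting points and endpoints of path segments. -/
def segMat (lam : ℤ → ℝ) (X : Config M N) : Matrix (Seg M N) (Seg M N) ℝ :=
  Matrix.of fun p q => trans lam ((q.1 : ℤ) - 1) (hatPos X (q.1 - 1) q.2) p.1 (hatPos X p.1 p.2)

/-- The kernel determinant over all particles. -/
def fullDet (lam : ℤ → ℝ) (B : Matrix (Fin M) (Fin M) ℝ) (X : Config M N) : ℝ :=
  kerDet lam N B (fun p : Slot M N => (p.1 : ℤ)) fun p => X p.1 p.2

/-- By a Schur complement, the kernel determinant over all particles is, up to a constant, the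
determinant of transition kernels between all particles, sources and sinks. -/
theorem exists_fullDet_eq (hMN : M ≤ N) {B : Matrix (Fin M) (Fin M) ℝ}
    (hB : B * (linkMat lam M N).transpose = 1) :
    ∃ c : ℝ, ∀ X : Config M N, fullDet lam B X = c * (segMat lam X).det := by
  let er := Equiv.ofBijective _ (rowMap_bijective hMN)
  let ec := Equiv.ofBijective _ (colMap_bijective hMN)
  refine ⟨(-1) ^ Fintype.card (Slot M N) * B.det * ((Equiv.Perm.sign (er.symm.trans ec) : ℤ) : ℝ), fun X => ?_⟩
  have hA : (linkMat lam M N).transpose * B = 1 := mul_eq_one_comm.1 hB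
  let _ : Invertible (linkMat lam M N).transpose := ⟨B, hB, hA⟩
  have hinv : ⅟(linkMat lam M N).transpose = B := rfl
  have hdet : B.det * (linkMat lam M N).transpose.det = 1 := by
    rw [← Matrix.det_mul, hB, Matrix.det_one]
  have hsub : (segMat lam X).submatrix er ec = Matrix.fromBlocks
      (Matrix.of fun p q : Slot M N => trans lam q.1 (X q.1 q.2) p.1 (X p.1 p.2))
      (Matrix.of fun (p : Slot M N) (i : Fin M) => trans lam (-M + i) 1 p.1 (X p.1 p.2))
      (Matrix.of fun (j : Fin M) (q : Slot M N) => trans lam q.1 (X q.1 q.2) (N - j) 1)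
      (linkMat lam M N).transpose := by
    ext p q
    have hr : ∀ p : Slot M N, hatPos X (er (Sum.inl p)).1 (er (Sum.inl p)).2 = X p.1 p.2 :=
      fun p => hatPos_coe X p.1 p.2
    have hr' : ∀ j : Fin M, hatPos X (er (Sum.inr j)).1 (er (Sum.inr j)).2 = 1 :=
      fun j => hatPos_eq_one X le_rfl
    have hc : ∀ p : Slot M N, hatPos X ((ec (Sum.inl p)).1 - 1) (ec (Sum.inl p)).2 = X p.1 p.2 := by
      intro p
      rw [← hatPos_coe X p.1 p.2]
      congr 1
      exact add_sub_cancel_right _ _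
    have hc' : ∀ j : Fin M, hatPos X ((ec (Sum.inr j)).1 - 1) (ec (Sum.inr j)).2 = 1 := by
      intro j
      refine hatPos_eq_one X (le_of_eq ?_)
      congr 1
      exact add_sub_cancel_right _ _
    have tc : ∀ p : Slot M N, ((ec (Sum.inl p)).1 : ℤ) - 1 = p.1 := fun p => add_sub_cancel_right _ _
    have tc' : ∀ i : Fin M, ((ec (Sum.inr i)).1 : ℤ) - 1 = -M + i :=
      fun i => add_sub_cancel_right _ _
    rcases p with p | j <;> rcases q with q | i <;>
      simp only [Matrix.submatrix_apply, segMat, Matrix.of_apply, Matrix.fromBlocks_apply₁₁,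
        Matrix.fromBlocks_apply₁₂, Matrix.fromBlocks_apply₂₁, Matrix.fromBlocks_apply₂₂,
        Matrix.transpose_apply]
    · rw [hr, hc, tc]; rfl
    · rw [hr, hc', tc']; rfl
    · rw [hr', hc, tc]; rfl
    · rw [hr', hc', tc']; rfl
  have hperm : ((segMat lam X).submatrix er ec).det =
      ((Equiv.Perm.sign (er.symm.trans ec) : ℤ) : ℝ) * (segMat lam X).det := by
    rw [← Matrix.det_permute', ← Matrix.det_submatrix_equiv_self er]
    congr 1
    ext p q
    simp
  have hschur : ((segMat lam X).submatrix er ec).det =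
      (linkMat lam M N).transpose.det * ((-1) ^ Fintype.card (Slot M N) * fullDet lam B X) := by
    rw [hsub, Matrix.det_fromBlocks₂₂, hinv, fullDet, kerDet, ← Matrix.det_neg]
    congr 2
    ext p q
    simp only [Matrix.sub_apply, Matrix.neg_apply, Matrix.of_apply, corrKer, pathKer,
      Matrix.mul_apply, neg_sub, Finset.sum_mul]
    rw [Finset.sum_comm]
  have hsq : ((-1 : ℝ) ^ Fintype.card (Slot M N)) * (-1) ^ Fintype.card (Slot M N) = 1 := by
    rw [← mul_pow]; simp
  have hcomb := hschur.symm.trans hperm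
  linear_combination (-1) ^ Fintype.card (Slot M N) * B.det * hcomb -
    (fullDet lam B X) * (B.det * (linkMat lam M N).transpose.det) * hsq -
    (fullDet lam B X) * hdet

/-- Increasing slices with entries in `(0,1)`, all particles being at different positions. -/
structure IsGeneric (X : Config M N) : Prop where
  mono : ∀ t, StrictMono (X t)
  mem : ∀ t i, X t i ∈ Ioo (0 : ℝ) 1
  ne : ∀ p q : Slot M N, p ≠ q → X p.1 p.2 ≠ X q.1 q.2

theorem hatPos_of_lt (X : Config M N) {s : ℤ} (hs : s ∈ Finset.Icc (-(M : ℤ) + 1) (N - 1)) {i : ℕ}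
    (hi : i < numPts M N s) : hatPos X s i = X ⟨s, hs⟩ ⟨i, hi⟩ := by
  rw [hatPos, dif_pos ⟨hs, hi⟩]

namespace IsGeneric
variable {X : Config M N}

theorem hatPos_pos (hX : IsGeneric X) (s : ℤ) (i : ℕ) : 0 < hatPos X s i := by
  rw [hatPos]
  split_ifs with h
  · exact (hX.mem _ _).1
  · exact one_pos

theorem hatPos_le_one (hX : IsGeneric X) (s : ℤ) (i : ℕ) : hatPos X s i ≤ 1 := by
  rw [hatPos]
  split_ifs with h
  · exact (hX.mem _ _).2.le
  · exact le_rfl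

/-- The positions in a slice remain strictly increasing when one `1` is appended. -/
theorem hatPos_strictMono (hX : IsGeneric X) (hMN : M ≤ N) {s : ℤ} (h1 : -(M : ℤ) ≤ s)
    (h2 : s ≤ N) {m : ℕ} (hm : m ≤ numPts M N s + 1) :
    StrictMono fun i : Fin m => hatPos X s i := by
  intro i j hij
  have hij' : (i : ℕ) < j := hij
  have hj := j.2
  have hi : (i : ℕ) < numPts M N s := by omega
  have hs := lt_of_lt_numPts hMN h1 h2 hi
  simp only
  rw [hatPos_of_lt X hs hi]
  by_cases hj' : (j : ℕ) < numPts M N s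
  · rw [hatPos_of_lt X hs hj']
    exact hX.mono _ hij
  · rw [hatPos_eq_one X (not_lt.1 hj')]
    exact (hX.mem _ _).2

end IsGeneric

/-- Interlacing of slices `a` and `b`, where slice `b` is continued by `1`. -/
def HatInterlaces (X : Config M N) (a b : ℤ) : Prop :=
  (∀ i < numPts M N a, hatPos X a i ≤ hatPos X b i) ∧
    ∀ i, i + 1 < numPts M N a → hatPos X b i < hatPos X a (i + 1)

/-- For generic configurations the non-strict inequalities are strict, and comparison with the
appended `1` is no condition. -/
theorem hatInterlaces_iff {X : Config M N} (hX : IsGeneric X) {a b : Time M N} (hab : a ≠ b)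
    (h : numPts M N a ≤ numPts M N b + 1) :
    HatInterlaces X a b ↔ Interlaces (X b) (X a) := by
  constructor
  · rintro ⟨h1, h2⟩
    refine ⟨fun i j hij => ?_, fun i j hij => ?_⟩
    · have := h1 i i.2
      rw [hatPos_coe, hij, hatPos_coe] at this
      exact this.lt_of_ne (hX.ne ⟨a, i⟩ ⟨b, j⟩ fun e => hab (congrArg Sigma.fst e))
    · have := h2 j (hij ▸ i.2)
      rwa [← hij, hatPos_coe, hatPos_coe] at this
  · rintro ⟨h1, h2⟩
    refine ⟨fun i hi => ?_, fun i hi => ?_⟩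
    · by_cases hb : i < numPts M N b
      · rw [hatPos_of_lt X a.2 hi, hatPos_of_lt X b.2 hb]
        exact (h1 ⟨i, hi⟩ ⟨i, hb⟩ rfl).le
      · rw [hatPos_eq_one X (not_lt.1 hb)]
        exact hX.hatPos_le_one _ _
    · rw [hatPos_of_lt X a.2 hi, hatPos_of_lt X b.2 (show i < _ by omega)]
      exact h2 ⟨i + 1, hi⟩ ⟨i, by omega⟩ rfl

/-- The first and the last step impose no condition. -/
theorem hatInterlaces_of_le_one {X : Config M N} (hX : IsGeneric X) {a b : ℤ}
    (ha : numPts M N a ≤ 1) (hb : numPts M N b = 0) : HatInterlaces X a b := by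
  refine ⟨fun i _ => ?_, fun i hi => by omega⟩
  rw [hatPos_eq_one X (s := b) (by omega)]
  exact hX.hatPos_le_one _ _

open Classical in
/-- The determinant of one step is the indicator of interlacing. -/
theorem det_step {X : Config M N} (hX : IsGeneric X) (hMN : M ≤ N) {s : ℤ}
    (h1 : -(M : ℤ) + 1 ≤ s) (h2 : s ≤ N) :
    (Matrix.of fun i j : Fin (numPaths M N s) =>
      if s - 1 < 0 then (if hatPos X s i ≤ hatPos X (s - 1) j then (1 : ℝ) else 0)
        else (if hatPos X (s - 1) j < hatPos X s i then 1 else 0)).det =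
      if (if s ≤ 0 then HatInterlaces X s (s - 1) else HatInterlaces X (s - 1) s) then 1 else 0 := by
  by_cases hs : s ≤ 0
  · have hs' : s - 1 < 0 := by omega
    have e1 : numPaths M N s = numPts M N s := by
      unfold numPaths numPts; split_ifs; omega
    have e2 : numPaths M N s ≤ numPts M N (s - 1) + 1 := by
      unfold numPaths numPts; split_ifs <;> omega
    simp only [if_pos hs, if_pos hs']
    have m1 := hX.hatPos_strictMono hMN (by omega) h2 (e1.le.trans (Nat.le_succ _))
    have m2 := hX.hatPos_strictMono hMN (by omega) (by omega) e2
    split_ifs with hc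
    · exact det_indicator_eq_one m1 (fun i => hc.1 i (by omega)) fun i j hij => by
        have := hc.2 j (by omega)
        rwa [← hij] at this
    · by_contra hd
      obtain ⟨h3, h4⟩ := interlacing_of_det_indicator_ne_zero m1 m2 hd
      exact hc ⟨fun i hi => h3 ⟨i, by omega⟩, fun i hi => h4 ⟨i + 1, by omega⟩ ⟨i, by omega⟩ rfl⟩
  · have hs' : ¬s - 1 < 0 := by omega
    have e1 : numPaths M N s = numPts M N (s - 1) := by
      unfold numPaths numPts; split_ifs <;> omega
    have e2 : numPaths M N s ≤ numPts M N s + 1 := by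
      unfold numPaths numPts; split_ifs; omega
    simp only [if_neg hs, if_neg hs']
    have m1 := hX.hatPos_strictMono hMN (by omega) (by omega) (e1.le.trans (Nat.le_succ _))
    have m2 := hX.hatPos_strictMono hMN (by omega) (by omega) e2
    -- without ties `<` may be replaced by `≤`
    have htie : ∀ i j : Fin (numPaths M N s),
        hatPos X (s - 1) j < hatPos X s i ↔ hatPos X (s - 1) j ≤ hatPos X s i := by
      intro i j
      refine ⟨le_of_lt, fun h => lt_of_le_of_ne h ?_⟩
      have hj : (j : ℕ) < numPts M N (s - 1) := by have := j.2; omega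
      have hjs := lt_of_lt_numPts hMN (by omega) (by omega) hj
      rw [hatPos_of_lt X hjs hj, hatPos]
      split_ifs with h
      · refine hX.ne ⟨⟨s - 1, hjs⟩, ⟨j, hj⟩⟩ ⟨⟨s, h.1⟩, ⟨i, h.2⟩⟩ fun e => ?_
        have := congrArg (fun p : Slot M N => (p.1 : ℤ)) e
        simp at this
      · exact (hX.mem _ _).2.ne
    rw [← Matrix.det_transpose]
    simp only [htie]
    split_ifs with hc
    · exact det_indicator_eq_one m1 (fun i => hc.1 i (by omega)) fun i j hij => by
        have := hc.2 j (by omega)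
        rwa [← hij] at this
    · by_contra hd
      obtain ⟨h3, h4⟩ := interlacing_of_det_indicator_ne_zero m1 m2 hd
      exact hc ⟨fun i hi => h3 ⟨i, by omega⟩, fun i hi => h4 ⟨i + 1, by omega⟩ ⟨i, by omega⟩ rfl⟩

/-- Admissibility is interlacing in every step, including the void conditions for the steps out of
the first source and into the last sink. -/
theorem mem_admissible_iff {X : Config M N} (hX : IsGeneric X) (hM : 1 ≤ M) (hMN : M ≤ N) :
    X ∈ admissible M N ↔ ∀ s ∈ Finset.Icc (-(M : ℤ) + 1) N,
      if s ≤ 0 then HatInterlaces X s (s - 1) else HatInterlaces X (s - 1) s := by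
  have hne : ∀ s t : Time M N, (t : ℤ) = s + 1 → s ≠ t := by
    rintro s t h rfl
    omega
  constructor
  · rintro ⟨-, -, h⟩ s hs
    rw [Finset.mem_Icc] at hs
    split_ifs with h0
    · by_cases hl : s = -(M : ℤ) + 1
      · apply hatInterlaces_of_le_one hX <;> rw [numPts] <;> split_ifs <;> omega
      · have hs1 : s ∈ Finset.Icc (-(M : ℤ) + 1) (N - 1) := by rw [Finset.mem_Icc]; omega
        have hs2 : s - 1 ∈ Finset.Icc (-(M : ℤ) + 1) (N - 1) := by rw [Finset.mem_Icc]; omega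
        have := h ⟨s - 1, hs2⟩ ⟨s, hs1⟩ (by simp)
        rw [if_pos h0] at this
        refine (hatInterlaces_iff hX (a := ⟨s, hs1⟩) (b := ⟨s - 1, hs2⟩)
          (hne _ _ (by simp)).symm ?_).2 this
        simp only [numPts]
        split_ifs <;> omega
    · by_cases hl : s = N
      · apply hatInterlaces_of_le_one hX <;> rw [numPts] <;> split_ifs <;> omega
      · have hs1 : s ∈ Finset.Icc (-(M : ℤ) + 1) (N - 1) := by rw [Finset.mem_Icc]; omega
        have hs2 : s - 1 ∈ Finset.Icc (-(M : ℤ) + 1) (N - 1) := by rw [Finset.mem_Icc]; omega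
        have := h ⟨s - 1, hs2⟩ ⟨s, hs1⟩ (by simp)
        rw [if_neg h0] at this
        refine (hatInterlaces_iff hX (a := ⟨s - 1, hs2⟩) (b := ⟨s, hs1⟩)
          (hne _ _ (by simp)) ?_).2 this
        simp only [numPts]
        split_ifs <;> omega
  · intro h
    refine ⟨hX.mono, hX.mem, fun s t hst => ?_⟩
    have ht := Finset.mem_Icc.1 t.2
    have hs := Finset.mem_Icc.1 s.2
    have := h t (by rw [Finset.mem_Icc]; omega)
    rw [show (t : ℤ) - 1 = s by omega] at this
    split_ifs at this ⊢ with h0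
    · refine (hatInterlaces_iff hX (hne s t hst).symm ?_).1 this
      simp only [numPts]
      split_ifs <;> omega
    · refine (hatInterlaces_iff hX (hne s t hst) ?_).1 this
      simp only [numPts]
      split_ifs <;> omega

open Classical in
/-- The determinant of transition kernels between all particles, sources and sinks is block
triangular with respect to time. Its blocks are the determinants of single steps, so that its value
is the density of the configuration. -/
theorem det_segMat {X : Config M N} (hX : IsGeneric X) (hM : 1 ≤ M) (hMN : M ≤ N) :
    (segMat lam X).det =
      if X ∈ admissible M N then ∏ t, ∏ i, X t i ^ (lam ((t : ℤ) - 1) - lam t - 1) else 0 := by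
  set v : Seg M N → ℝ := fun p => hatPos X p.1 p.2 ^ (lam ((p.1 : ℤ) - 1) - 1 / 2) with hv
  set w : Seg M N → ℝ := fun q => hatPos X (q.1 - 1) q.2 ^ (-lam ((q.1 : ℤ) - 1) - 1 / 2) with hw
  have htri : (segMat lam X).transpose.BlockTriangular Sigma.fst := by
    intro p q hpq
    exact trans_eq_zero (by have : (q.1 : ℤ) < p.1 := hpq; omega) _ _
  have hblock : ∀ s : ↥(Finset.Icc (-(M : ℤ) + 1) (N : ℤ)),
      ((segMat lam X).transpose.toSquareBlock Sigma.fst s).det =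
        (∏ i, v ⟨s, i⟩) * (∏ j, w ⟨s, j⟩) *
        if (if (s : ℤ) ≤ 0 then HatInterlaces X s (s - 1) else HatInterlaces X (s - 1) s)
          then 1 else 0 := by
    intro s
    have hs := Finset.mem_Icc.1 s.2
    rw [← det_step hX hMN hs.1 hs.2, ← Matrix.det_submatrix_equiv_self
      (Equiv.sigmaSubtype (β := fun s : ↥(Finset.Icc (-(M : ℤ) + 1) (N : ℤ)) =>
        Fin (numPaths M N s)) s).symm, ← Matrix.det_transpose, mul_assoc,
      ← Matrix.det_mul_row, ← Matrix.det_mul_column]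
    congr 1
    ext i j
    simp only [Matrix.transpose_apply, Matrix.submatrix_apply, Matrix.toSquareBlock_def,
      Matrix.of_apply, segMat, hv, hw]
    have := trans_step (lam := lam) ((s : ℤ) - 1) (hX.hatPos_pos s i) (hX.hatPos_pos (s - 1) j)
    rw [sub_add_cancel] at this
    exact this
  rw [← Matrix.det_transpose, htri.det_fintype, Finset.prod_congr rfl fun s _ => hblock s,
    Finset.prod_mul_distrib, Finset.prod_mul_distrib, ← Fintype.prod_sigma v,
    ← Fintype.prod_sigma w]
  have hprod : (∏ p, v p) * ∏ q, w q = ∏ t, ∏ i, X t i ^ (lam ((t : ℤ) - 1) - lam t - 1) := by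
    rw [← (Equiv.ofBijective _ (rowMap_bijective hMN)).prod_comp v,
      ← (Equiv.ofBijective _ (colMap_bijective hMN)).prod_comp w, Fintype.prod_sum_type,
      Fintype.prod_sum_type]
    have a1 : ∀ p : Slot M N, v (Equiv.ofBijective _ (rowMap_bijective hMN) (Sum.inl p)) =
        X p.1 p.2 ^ (lam ((p.1 : ℤ) - 1) - 1 / 2) := fun p => by
      simp only [hv]
      have : hatPos X _ _ = _ := hatPos_coe X p.1 p.2
      exact congrArg (· ^ (lam ((p.1 : ℤ) - 1) - 1 / 2)) this
    have a2 : ∀ j : Fin M, v (Equiv.ofBijective _ (rowMap_bijective hMN) (Sum.inr j)) = 1 :=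
      fun j => by
        simp only [hv]
        have : hatPos X ((N : ℤ) - j) (numPts M N ((N : ℤ) - j)) = 1 := hatPos_eq_one X le_rfl
        exact (congrArg (· ^ (lam ((N : ℤ) - j - 1) - 1 / 2)) this).trans (Real.one_rpow _)
    have tc : ∀ p, (((Equiv.ofBijective _ (colMap_bijective hMN)) (Sum.inl p)).1 : ℤ) - 1 = p.1 :=
      fun p => add_sub_cancel_right _ _
    have tc' : ∀ i : Fin M,
        (((Equiv.ofBijective _ (colMap_bijective hMN)) (Sum.inr i)).1 : ℤ) - 1 = -M + i :=
      fun i => add_sub_cancel_right _ _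
    have a3 : ∀ p : Slot M N, w (Equiv.ofBijective _ (colMap_bijective hMN) (Sum.inl p)) =
        X p.1 p.2 ^ (-lam (p.1 : ℤ) - 1 / 2) := fun p => by
      simp only [hw]
      rw [tc]
      exact congrArg (· ^ (-lam (p.1 : ℤ) - 1 / 2)) (hatPos_coe X p.1 p.2)
    have a4 : ∀ j : Fin M, w (Equiv.ofBijective _ (colMap_bijective hMN) (Sum.inr j)) = 1 :=
      fun j => by
        simp only [hw]
        rw [tc']
        have : hatPos X (-(M : ℤ) + j) (numPts M N (-(M : ℤ) + j)) = 1 := hatPos_eq_one X le_rfl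
        exact (congrArg (· ^ (-lam (-(M : ℤ) + j) - 1 / 2)) this).trans (Real.one_rpow _)
    simp only [a1, a2, a3, a4, Finset.prod_const_one, mul_one]
    rw [← Finset.prod_mul_distrib, Fintype.prod_sigma]
    refine Finset.prod_congr rfl fun t _ => Finset.prod_congr rfl fun i _ => ?_
    rw [← Real.rpow_add (hX.mem t i).1]
    ring_nf
  rw [hprod]
  split_ifs with hadm
  · refine (congrArg (_ * ·) (Finset.prod_eq_one fun s _ => ?_)).trans (mul_one _)
    rw [if_pos ((mem_admissible_iff hX hM hMN).1 hadm s s.2)]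
  · have : ¬∀ s ∈ Finset.Icc (-(M : ℤ) + 1) N,
      if s ≤ 0 then HatInterlaces X s (s - 1) else HatInterlaces X (s - 1) s :=
      fun h => hadm ((mem_admissible_iff hX hM hMN).2 h)
    push Not at this
    obtain ⟨s, hs, hn⟩ := this
    refine (congrArg (_ * ·) (Finset.prod_eq_zero (Finset.mem_univ ⟨s, hs⟩) ?_)).trans
      (mul_zero _)
    exact if_neg hn

/-! ### Tuples of distinct particles -/

open Classical in
/-- The `n`-tuples of distinct particles, the `k`-th one from slice `t k`. -/
def particleTuples {n : ℕ} (t : Fin n → Time M N) : Finset ((k : Fin n) → Fin (numPts M N (t k))) :=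
  Finset.univ.filter fun σ => Function.Injective fun k => (⟨t k, σ k⟩ : Slot M N)

theorem mem_particleTuples {n : ℕ} {t : Fin n → Time M N}
    {σ : (k : Fin n) → Fin (numPts M N (t k))} :
    σ ∈ particleTuples t ↔ Function.Injective fun k => (⟨t k, σ k⟩ : Slot M N) := by
  simp [particleTuples]

open Classical in
/-- The particles of slice `u` that occur in a tuple are as many as the indices at time `u`. -/
theorem card_used {n : ℕ} {t : Fin n → Time M N} {σ : (k : Fin n) → Fin (numPts M N (t k))}
    (hσ : σ ∈ particleTuples t) (u : Time M N) :
    (Finset.univ.filter fun i : Fin (numPts M N u) =>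
      (⟨u, i⟩ : Slot M N) ∈ range fun k => (⟨t k, σ k⟩ : Slot M N)).card =
      (Finset.univ.filter fun k => t k = u).card := by
  rw [mem_particleTuples] at hσ
  rw [← Finset.card_image_of_injective _ hσ, ← Finset.card_image_of_injective
    (f := fun i => (⟨u, i⟩ : Slot M N)) _ (fun i j e => by simpa using e)]
  congr 1
  ext p
  simp only [Finset.mem_image, Finset.mem_filter, Finset.mem_univ, true_and, mem_range]
  constructor
  · rintro ⟨i, ⟨k, hk⟩, rfl⟩
    exact ⟨k, congrArg Sigma.fst hk, hk⟩
  · rintro ⟨k, rfl, rfl⟩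
    exact ⟨σ k, ⟨k, rfl⟩, rfl⟩

open Classical in
theorem card_le_of_mem_particleTuples {n : ℕ} {t : Fin n → Time M N}
    {σ : (k : Fin n) → Fin (numPts M N (t k))} (hσ : σ ∈ particleTuples t) (u : Time M N) :
    (Finset.univ.filter fun k => t k = u).card ≤ numPts M N u := by
  rw [← card_used hσ]
  exact (Finset.card_le_univ _).trans (by simp)

open Classical in
/-- Tuples of distinct particles are counted by choosing the first entry among the unused particles
of its slice. The natural subtraction is harmless: it truncates only if there is no tuple with times
`t`. -/
theorem card_particleTuples_cons {n : ℕ} (u : Time M N) (t : Fin n → Time M N) :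
    (particleTuples (Fin.cons u t : Fin (n + 1) → Time M N)).card =
      (numPts M N u - (Finset.univ.filter fun k => t k = u).card) * (particleTuples t).card := by
  have hinj : ∀ (i : Fin (numPts M N u)) (σ : (k : Fin n) → Fin (numPts M N (t k))),
      (Function.Injective fun k => (⟨(Fin.cons u t : Fin (n + 1) → Time M N) k,
        (Fin.consEquiv fun k => Fin (numPts M N ((Fin.cons u t : Fin (n + 1) → Time M N) k)))
          (i, σ) k⟩ : Slot M N)) ↔
      (⟨u, i⟩ : Slot M N) ∉ range (fun k => (⟨t k, σ k⟩ : Slot M N)) ∧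
        Function.Injective fun k => (⟨t k, σ k⟩ : Slot M N) := by
    intro i σ
    rw [← Fin.cons_injective_iff]
    refine iff_of_eq (congrArg _ ?_)
    funext k
    refine Fin.cases rfl (fun k => rfl) k
  rw [particleTuples, Finset.card_filter, ← (Fin.consEquiv fun k =>
    Fin (numPts M N ((Fin.cons u t : Fin (n + 1) → Time M N) k))).sum_comp,
    Fintype.sum_prod_type_right]
  have : ∀ σ : (k : Fin n) → Fin (numPts M N (t k)), (∑ i : Fin (numPts M N u),
      if (Function.Injective fun k => (⟨(Fin.cons u t : Fin (n + 1) → Time M N) k,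
        (Fin.consEquiv fun k => Fin (numPts M N ((Fin.cons u t : Fin (n + 1) → Time M N) k)))
          (i, σ) k⟩ : Slot M N)) then 1 else 0) =
      if σ ∈ particleTuples t then
        numPts M N u - (Finset.univ.filter fun k => t k = u).card else 0 := by
    intro σ
    simp only [hinj]
    split_ifs with hσ
    · have h2 := card_used hσ u
      rw [mem_particleTuples] at hσ
      simp only [hσ, and_true]
      rw [← Finset.card_filter, ← h2, ← Finset.compl_filter, Finset.card_compl, Fintype.card_fin]
    · rw [mem_particleTuples] at hσ
      simp [hσ]
  refine (Finset.sum_congr rfl fun σ _ => this σ).trans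
    ((Finset.sum_ite_mem _ (particleTuples t) _).trans ?_)
  rw [Finset.sum_const, smul_eq_mul, mul_comm]
  exact congrArg _ (congrArg _ (Finset.univ_inter _))

open Classical in
/-- Distinct particles can be chosen unless some slice has too few of them. -/
theorem exists_lt_of_particleTuples_eq_empty : ∀ {n : ℕ} (t : Fin n → Time M N),
    particleTuples t = ∅ → ∃ u : Time M N, numPts M N u < (Finset.univ.filter fun k => t k = u).card := by
  intro n
  induction n with
  | zero =>
    intro t h
    have : (fun k => k.elim0) ∈ particleTuples t :=
      mem_particleTuples.2 (Function.injective_of_subsingleton _)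
    rw [h] at this
    simp at this
  | succ n ih =>
    intro t h
    obtain ⟨u, t, rfl⟩ : ∃ u t', t = Fin.cons u t' := ⟨t 0, Fin.tail t, (Fin.cons_self_tail t).symm⟩
    have hc : ∀ v, (Finset.univ.filter fun k => (Fin.cons u t : Fin (n + 1) → Time M N) k = v).card =
        (if u = v then 1 else 0) + (Finset.univ.filter fun k => t k = v).card := by
      intro v
      simp only [Finset.card_filter, Fin.sum_univ_succ, Fin.cons_zero, Fin.cons_succ]
    have h0 := card_particleTuples_cons u t
    rw [h, Finset.card_empty, eq_comm, mul_eq_zero] at h0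
    rcases h0 with h0 | h0
    · refine ⟨u, ?_⟩
      rw [hc, if_pos rfl]
      omega
    · obtain ⟨v, hv⟩ := ih t (Finset.card_eq_zero.1 h0)
      refine ⟨v, ?_⟩
      rw [hc]
      omega

/-! ### Integrating out particles -/

theorem kerDet_cons_coe {B : Matrix (Fin M) (Fin M) ℝ} {n : ℕ} (u : Time M N)
    (t : Fin n → Time M N) :
    kerDet lam N B (fun k => ((Fin.cons u t : Fin (n + 1) → Time M N) k : ℤ)) =
      kerDet lam N B (Fin.cons (u : ℤ) (fun k => (t k : ℤ)) : Fin (n + 1) → ℤ) := by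
  congr 1
  funext k
  refine Fin.cases rfl (fun k => rfl) k

open Classical in
theorem filter_coe_eq {n : ℕ} (u : Time M N) (t : Fin n → Time M N) :
    (Finset.univ.filter fun k => (t k : ℤ) = u) = Finset.univ.filter fun k => t k = u := by
  ext k
  simp only [Finset.mem_filter, Finset.mem_univ, true_and]
  exact Subtype.ext_iff.symm

/-- The total mass of the `n`-point determinant, obtained by integrating out all variables, is the
number of tuples that it counts. -/
theorem integral_kerDet_eq_card (h : IsPoles lam δ) (hMN : M ≤ N) {B : Matrix (Fin M) (Fin M) ℝ}
    (hB : B * (linkMat lam M N).transpose = 1) : ∀ {n : ℕ} (t : Fin n → Time M N),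
    ∫ x in unitCube (Fin n), kerDet lam N B (fun k => (t k : ℤ)) x = (particleTuples t).card := by
  classical
  intro n
  induction n with
  | zero =>
    intro t
    have h1 : particleTuples t = Finset.univ := by
      ext σ
      simp only [mem_particleTuples, Finset.mem_univ, iff_true]
      exact Function.injective_of_subsingleton _
    have h2 : unitCube (Fin 0) = univ := by
      ext x
      simp [unitCube]
    rw [h1, h2]
    rw [volume_pi, Measure.pi_of_empty _ (fun k => k.elim0)]
    simp [kerDet]
  | succ n ih =>
    intro t
    obtain ⟨u, t, rfl⟩ : ∃ u t', t = Fin.cons u t' := ⟨t 0, Fin.tail t, (Fin.cons_self_tail t).symm⟩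
    have := setIntegral_kerDet_cons h hMN hB (t := fun k => (t k : ℤ)) u.2 (fun i => (t i).2)
      MeasurableSet.univ
    simp only [mem_univ, ofPred_true, univ_inter] at this
    rw [kerDet_cons_coe, this, ih, card_particleTuples_cons, filter_coe_eq]
    rcases (particleTuples t).eq_empty_or_nonempty with h0 | ⟨σ, hσ⟩
    · simp [h0]
    · rw [Nat.cast_mul, Nat.cast_sub (card_le_of_mem_particleTuples hσ u)]

/-- The configurations, ordered or not, with all particles in `(0,1)`. -/
def configCube (M N : ℕ) : Set (Config M N) := {X | ∀ t i, X t i ∈ Ioo (0 : ℝ) 1}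

theorem measurable_coord (p : Slot M N) : Measurable fun X : Config M N => X p.1 p.2 :=
  (measurable_pi_apply p.2).comp (measurable_pi_apply p.1)

theorem measurable_positions {ι : Type*} (τ : ι → Slot M N) :
    Measurable fun (X : Config M N) k => X (τ k).1 (τ k).2 :=
  measurable_pi_lambda _ fun k => measurable_coord (τ k)

theorem measurableSet_configCube : MeasurableSet (configCube M N) := by
  have : configCube M N = ⋂ p : Slot M N, {X | X p.1 p.2 ∈ Ioo (0 : ℝ) 1} := by
    ext X
    rw [mem_iInter]
    exact ⟨fun h p => h p.1 p.2, fun h t i => h ⟨t, i⟩⟩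
  rw [this]
  exact MeasurableSet.iInter fun p => measurable_coord p measurableSet_Ioo

/-- Listing the particles by an index type preserves volume. -/
theorem measurePreserving_positions {ι : Type*} [Fintype ι] (e : ι ≃ Slot M N) :
    MeasurePreserving fun (X : Config M N) k => X (e k).1 (e k).2 := by
  refine ⟨measurable_positions e, (Measure.pi_eq fun s hs => ?_).symm⟩
  rw [Measure.map_apply (measurable_positions e) (MeasurableSet.univ_pi hs)]
  have : (fun (X : Config M N) k => X (e k).1 (e k).2) ⁻¹' univ.pi s =
      univ.pi fun t => univ.pi fun i => s (e.symm ⟨t, i⟩) := by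
    ext X
    simp only [mem_preimage, mem_univ_pi]
    refine ⟨fun h t i => ?_, fun h k => ?_⟩
    · have h' := h (e.symm ⟨t, i⟩)
      rwa [e.apply_symm_apply] at h'
    · simpa using h (e k).1 (e k).2
  rw [this, volume_pi_pi]
  simp only [volume_pi_pi]
  rw [← Fintype.prod_sigma' (f := fun t i => volume (s (e.symm ⟨t, i⟩))), ← e.prod_comp]
  simp

theorem preimage_unitCube {ι : Type*} (e : ι ≃ Slot M N) :
    (fun (X : Config M N) k => X (e k).1 (e k).2) ⁻¹' unitCube ι = configCube M N := by
  ext X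
  simp only [mem_preimage, unitCube, mem_univ_pi, configCube, mem_ofPred_eq]
  refine ⟨fun h t i => ?_, fun h k => h _ _⟩
  have h' := h (e.symm ⟨t, i⟩)
  rwa [e.apply_symm_apply] at h'

theorem integrableOn_fullDet (h : IsPoles lam δ) (B : Matrix (Fin M) (Fin M) ℝ) :
    IntegrableOn (fullDet (N := N) lam B) (configCube M N) := by
  have hp := measurePreserving_positions (Equiv.refl (Slot M N))
  have h1 := integrableOn_kerDet (N := N) h B (t := fun p : Slot M N => (p.1 : ℤ)) fun p => p.1.2
  have h2 := (hp.restrict_preimage (measurableSet_unitCube _)).integrable_comp_of_integrable h1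
  rw [preimage_unitCube] at h2
  exact h2

/-- Integrating out the particles that are not listed in `τ`, one at a time, leaves a multiple of
the kernel determinant of the listed ones. The constant `a` does not depend on `S`, so that its
value can be read off from `S = univ` later on. -/
theorem exists_setIntegral_fullDet (h : IsPoles lam δ) (hMN : M ≤ N)
    {B : Matrix (Fin M) (Fin M) ℝ} (hB : B * (linkMat lam M N).transpose = 1) (d : ℕ) :
    ∀ {n : ℕ} (τ : Fin n → Slot M N), Function.Injective τ → n + d = Fintype.card (Slot M N) →
    ∃ a : ℝ, ∀ S : Set (Fin n → ℝ), MeasurableSet S →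
      ∫ X in {X : Config M N | (fun k => X (τ k).1 (τ k).2) ∈ S} ∩ configCube M N,
        fullDet lam B X =
      a * ∫ x in S ∩ unitCube (Fin n), kerDet lam N B (fun k => ((τ k).1 : ℤ)) x := by
  classical
  induction d with
  | zero =>
    intro n τ hτ hn
    refine ⟨1, fun S hS => ?_⟩
    let e : Fin n ≃ Slot M N := Equiv.ofBijective τ
      ((Fintype.bijective_iff_injective_and_card _).2 ⟨hτ, by simpa using hn⟩)
    have hp := measurePreserving_positions e
    have h1 : ∀ X : Config M N, fullDet lam B X =
        kerDet lam N B (fun k => ((τ k).1 : ℤ)) fun k => X (e k).1 (e k).2 := fun X =>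
      (kerDet_comp e (fun p : Slot M N => (p.1 : ℤ)) fun p => X p.1 p.2).symm
    rw [one_mul, ← hp.map_eq, setIntegral_map (hS.inter (measurableSet_unitCube _))
      (measurable_kerDet B _).aestronglyMeasurable hp.measurable.aemeasurable, preimage_inter,
      preimage_unitCube]
    simp only [h1]
    rfl
  | succ d ih =>
    intro n τ hτ hn
    obtain ⟨p, hp⟩ : ∃ p, p ∉ range τ := by
      by_contra hc
      push Not at hc
      have := Fintype.card_le_of_surjective τ hc
      rw [Fintype.card_fin] at this
      omega
    obtain ⟨a, ha⟩ := ih (Fin.cons p τ : Fin (n + 1) → Slot M N)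
      (Fin.cons_injective_iff.2 ⟨hp, hτ⟩) (by omega)
    refine ⟨a * (numPts M N p.1 - (Finset.univ.filter fun k => ((τ k).1 : ℤ) = p.1).card),
      fun S hS => ?_⟩
    have h1 := ha {x | Fin.tail x ∈ S}
      ((measurable_pi_lambda _ fun k => measurable_pi_apply (Fin.succ k)) hS)
    have h2 := setIntegral_kerDet_cons h hMN hB (t := fun k => ((τ k).1 : ℤ)) p.1.2
      (fun i => (τ i).1.2) hS
    have h3 : (fun k => (((Fin.cons p τ : Fin (n + 1) → Slot M N) k).1 : ℤ)) =
        (Fin.cons (p.1 : ℤ) (fun k => ((τ k).1 : ℤ)) : Fin (n + 1) → ℤ) := by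
      funext k
      refine Fin.cases rfl (fun k => rfl) k
    rw [h3, h2] at h1
    rw [mul_assoc, ← h1]
    rfl

/-! ### Symmetrization -/

/-- Relabelling the particles of each slice. -/
def relabel (π : (t : Time M N) → Equiv.Perm (Fin (numPts M N t))) (X : Config M N) : Config M N :=
  fun t => X t ∘ π t

theorem measurePreserving_relabel (π : (t : Time M N) → Equiv.Perm (Fin (numPts M N t))) :
    MeasurePreserving (relabel π) := by
  refine volume_preserving_pi (f := fun (t : Time M N) (x : Fin (numPts M N t) → ℝ) => x ∘ π t) fun t => ?_
  exact volume_preserving_arrowCongr' (π t).symm (MeasurableEquiv.refl ℝ) (MeasurePreserving.id _)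

theorem fullDet_relabel (B : Matrix (Fin M) (Fin M) ℝ)
    (π : (t : Time M N) → Equiv.Perm (Fin (numPts M N t))) (X : Config M N) :
    fullDet lam B (relabel π X) = fullDet lam B X :=
  kerDet_comp (Equiv.sigmaCongrRight π) (fun p : Slot M N => (p.1 : ℤ)) fun p => X p.1 p.2

theorem relabel_mem_configCube (π : (t : Time M N) → Equiv.Perm (Fin (numPts M N t)))
    (X : Config M N) : relabel π X ∈ configCube M N ↔ X ∈ configCube M N := by
  refine ⟨fun h t i => by simpa [relabel] using h t ((π t).symm i), fun h t i => h t _⟩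

open Classical in
/-- A configuration whose slices have distinct entries can be sorted in exactly one way. -/
theorem existsUnique_relabel {X : Config M N} (hX : ∀ t, Function.Injective (X t)) :
    ∃! π, ∀ t, StrictMono (relabel π X t) := by
  refine ⟨fun t => Tuple.sort (X t), fun t => ?_, fun π hπ => ?_⟩
  · exact (Tuple.monotone_sort (X t)).strictMono_of_injective ((hX t).comp (Equiv.injective _))
  · funext t
    have h1 : StrictMono (X t ∘ Tuple.sort (X t)) :=
      (Tuple.monotone_sort (X t)).strictMono_of_injective ((hX t).comp (Equiv.injective _))
    have h2 : X t ∘ π t = X t ∘ Tuple.sort (X t) := by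
      refine ((hπ t).range_inj h1).1 ?_
      rw [relabel, (π t).surjective.range_comp, (Tuple.sort (X t)).surjective.range_comp]
    ext1 i
    exact hX t (congrFun h2 i)

/-- Two distinct particles almost surely have different positions, since a hyperplane has measure
zero. -/
theorem ae_ne (p q : Slot M N) (hpq : p ≠ q) : ∀ᵐ X : Config M N, X p.1 p.2 ≠ X q.1 q.2 := by
  classical
  let f : Config M N →ₗ[ℝ] ℝ :=
    { toFun := fun X => X p.1 p.2 - X q.1 q.2
      map_add' := fun X Y => by simp only [Pi.add_apply]; ring
      map_smul' := fun c X => by simp only [Pi.smul_apply, smul_eq_mul, RingHom.id_apply]; ring }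
  have hf : ∀ X, f X = X p.1 p.2 - X q.1 q.2 := fun X => rfl
  have h := Measure.addHaar_submodule (volume : Measure (Config M N)) (LinearMap.ker f) ?_
  · rw [ae_iff]
    refine measure_mono_null (fun X hX => ?_) h
    simp only [ne_eq, not_not, mem_ofPred_eq] at hX
    rw [SetLike.mem_coe, LinearMap.mem_ker, hf, hX, sub_self]
  · intro htop
    have : (fun t i => if (⟨t, i⟩ : Slot M N) = p then 1 else 0 : Config M N) ∈ LinearMap.ker f := by
      rw [htop]; trivial
    rw [LinearMap.mem_ker, hf] at this
    simp [hpq.symm] at this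

theorem ae_pairwise_ne : ∀ᵐ X : Config M N, ∀ p q : Slot M N, p ≠ q → X p.1 p.2 ≠ X q.1 q.2 := by
  simp only [ae_all_iff]
  exact ae_ne

theorem measurableSet_strictMono :
    MeasurableSet {X : Config M N | ∀ t, StrictMono (X t)} := by
  have : {X : Config M N | ∀ t, StrictMono (X t)} =
      ⋂ (t) (i) (j) (_ : i < j), {X : Config M N | X t i < X t j} := by
    ext X
    simp [StrictMono]
  rw [this]
  exact MeasurableSet.iInter fun t => MeasurableSet.iInter fun i => MeasurableSet.iInter fun j =>
    MeasurableSet.iInter fun _ => measurableSet_lt (measurable_coord ⟨t, i⟩) (measurable_coord ⟨t, j⟩)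

/-- A symmetric function may be integrated over increasing slices only. -/
theorem integral_eq_card_mul_setIntegral {f : Config M N → ℝ} (hf : Integrable f)
    (hsymm : ∀ π X, f (relabel π X) = f X) :
    ∫ X, f X = (Fintype.card ((t : Time M N) → Equiv.Perm (Fin (numPts M N t))) : ℝ) *
      ∫ X in {X : Config M N | ∀ t, StrictMono (X t)}, f X := by
  classical
  set S := {X : Config M N | ∀ t, StrictMono (X t)} with hS
  have hSm : MeasurableSet S := measurableSet_strictMono
  have h1 : ∀ᵐ X : Config M N, f X = ∑ π, S.indicator f (relabel π X) := by
    filter_upwards [ae_pairwise_ne (M := M) (N := N)] with X hX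
    obtain ⟨π, hπ, hu⟩ := existsUnique_relabel (X := X) fun t i j e => by
      by_contra hij
      exact hX ⟨t, i⟩ ⟨t, j⟩ (by simpa using hij) e
    rw [Finset.sum_eq_single π]
    · rw [indicator_of_mem (show relabel π X ∈ S from hπ), hsymm]
    · intro π' _ hne
      exact indicator_of_notMem (show relabel π' X ∉ S from fun h' => hne (hu _ h')) _
    · simp
  rw [integral_congr_ae h1, integral_finsetSum]
  · have h2 : ∀ π, ∫ X, S.indicator f (relabel π X) = ∫ X in S, f X := by
      intro π
      rw [← integral_indicator hSm]
      have hp := measurePreserving_relabel (M := M) (N := N) π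
      have h3 : AEStronglyMeasurable (S.indicator f) (Measure.map (relabel π) volume) := by
        rw [hp.map_eq]
        exact hf.aestronglyMeasurable.indicator hSm
      rw [← integral_map hp.measurable.aemeasurable h3, hp.map_eq]
    rw [Finset.sum_congr rfl fun π _ => h2 π, Finset.sum_const, nsmul_eq_mul, Finset.card_univ]
  · intro π _
    exact (measurePreserving_relabel π).integrable_comp_of_integrable (hf.indicator hSm)

open Classical in
/-- The unnormalized density of the process. -/
def weight (lam : ℤ → ℝ) (M N : ℕ) (X : Config M N) : ℝ :=
  if X ∈ admissible M N then ∏ t, ∏ i, X t i ^ (lam ((t : ℤ) - 1) - lam t - 1) else 0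

theorem weight_nonneg (X : Config M N) : 0 ≤ weight lam M N X := by
  rw [weight]
  split_ifs with h
  · exact Finset.prod_nonneg fun t _ => Finset.prod_nonneg fun i _ =>
      Real.rpow_nonneg (h.2.1 t i).1.le _
  · exact le_rfl

theorem measurableSet_admissible : MeasurableSet (admissible M N) := by
  have hi : ∀ s t : Time M N, MeasurableSet {X : Config M N | Interlaces (X s) (X t)} := by
    intro s t
    have : {X : Config M N | Interlaces (X s) (X t)} =
        (⋂ (i : Fin (numPts M N t)) (j : Fin (numPts M N s)) (_ : (i : ℕ) = j),
          {X : Config M N | X t i < X s j}) ∩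
        ⋂ (i : Fin (numPts M N t)) (j : Fin (numPts M N s)) (_ : (i : ℕ) = j + 1),
          {X : Config M N | X s j < X t i} := by
      ext X
      simp only [Interlaces, mem_ofPred_eq, mem_inter_iff, mem_iInter]
    rw [this]
    refine MeasurableSet.inter ?_ ?_ <;>
    exact MeasurableSet.iInter fun i => MeasurableSet.iInter fun j => MeasurableSet.iInter fun _ =>
      measurableSet_lt (measurable_coord ⟨_, _⟩) (measurable_coord ⟨_, _⟩)
  have : admissible M N = {X : Config M N | ∀ t, StrictMono (X t)} ∩ (configCube M N ∩
      ⋂ (s : Time M N) (t : Time M N) (_ : (t : ℤ) = s + 1), {X : Config M N |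
        if (t : ℤ) ≤ 0 then Interlaces (X s) (X t) else Interlaces (X t) (X s)}) := by
    ext X
    simp only [admissible, configCube, mem_ofPred_eq, mem_inter_iff, mem_iInter]
  rw [this]
  refine measurableSet_strictMono.inter (measurableSet_configCube.inter ?_)
  refine MeasurableSet.iInter fun s => MeasurableSet.iInter fun t => MeasurableSet.iInter fun _ => ?_
  split_ifs
  · exact hi s t
  · exact hi t s

open Classical in
/-- The number of tuples of distinct particles whose positions lie in `S`. -/
def countTuples {n : ℕ} (t : Fin n → Time M N) (S : Set (Fin n → ℝ)) (X : Config M N) : ℝ :=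
  ∑ σ ∈ particleTuples t, {X : Config M N | (fun k => X (t k) (σ k)) ∈ S}.indicator 1 X

theorem countTuples_relabel {n : ℕ} (t : Fin n → Time M N) (S : Set (Fin n → ℝ))
    (π : (t : Time M N) → Equiv.Perm (Fin (numPts M N t))) (X : Config M N) :
    countTuples t S (relabel π X) = countTuples t S X := by
  refine Finset.sum_equiv (Equiv.piCongrRight fun k => π (t k)) (fun σ => ?_) fun σ _ => rfl
  rw [mem_particleTuples, mem_particleTuples]
  have : (fun k => (⟨t k, (Equiv.piCongrRight fun k => π (t k)) σ k⟩ : Slot M N)) =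
      Equiv.sigmaCongrRight π ∘ fun k => (⟨t k, σ k⟩ : Slot M N) := rfl
  rw [this]
  exact ((Equiv.injective _).of_comp_iff _).symm

theorem measurableSet_positions {n : ℕ} (t : Fin n → Time M N)
    (σ : (k : Fin n) → Fin (numPts M N (t k))) {S : Set (Fin n → ℝ)} (hS : MeasurableSet S) :
    MeasurableSet {X : Config M N | (fun k => X (t k) (σ k)) ∈ S} :=
  measurable_positions (fun k => (⟨t k, σ k⟩ : Slot M N)) hS

/-- The expected number of tuples of distinct particles in `S`, as a sum over tuples of labels. -/
theorem integral_countTuples_mul {n : ℕ} (t : Fin n → Time M N) {S : Set (Fin n → ℝ)}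
    (hS : MeasurableSet S) {f : Config M N → ℝ} (hf : Integrable f) :
    ∫ X, countTuples t S X * f X =
      ∑ σ ∈ particleTuples t, ∫ X in {X : Config M N | (fun k => X (t k) (σ k)) ∈ S}, f X := by
  have : ∀ X, countTuples t S X * f X = ∑ σ ∈ particleTuples t,
      {X : Config M N | (fun k => X (t k) (σ k)) ∈ S}.indicator f X := by
    intro X
    rw [countTuples, Finset.sum_mul]
    refine Finset.sum_congr rfl fun σ _ => ?_
    by_cases hX : X ∈ {X : Config M N | (fun k => X (t k) (σ k)) ∈ S} <;> simp [hX]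
  simp only [this]
  rw [integral_finsetSum _ fun σ _ => hf.indicator (measurableSet_positions t σ hS)]
  exact Finset.sum_congr rfl fun σ _ => integral_indicator (measurableSet_positions t σ hS)

theorem integrable_countTuples_mul {n : ℕ} (t : Fin n → Time M N) {S : Set (Fin n → ℝ)}
    (hS : MeasurableSet S) {f : Config M N → ℝ} (hf : Integrable f) :
    Integrable fun X => countTuples t S X * f X := by
  have : ∀ X, countTuples t S X * f X = ∑ σ ∈ particleTuples t,
      {X : Config M N | (fun k => X (t k) (σ k)) ∈ S}.indicator f X := by
    intro X
    rw [countTuples, Finset.sum_mul]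
    refine Finset.sum_congr rfl fun σ _ => ?_
    by_cases hX : X ∈ {X : Config M N | (fun k => X (t k) (σ k)) ∈ S} <;> simp [hX]
  simp only [this]
  exact integrable_finsetSum _ fun σ _ => hf.indicator (measurableSet_positions t σ hS)

/-- The sum over all tuples of distinct particles of the integrals of the full determinant. -/
theorem sum_setIntegral_fullDet (h : IsPoles lam δ) (hMN : M ≤ N)
    {B : Matrix (Fin M) (Fin M) ℝ} (hB : B * (linkMat lam M N).transpose = 1) {n : ℕ}
    (t : Fin n → Time M N) {S : Set (Fin n → ℝ)} (hS : MeasurableSet S) :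
    ∑ σ ∈ particleTuples t, ∫ X in {X : Config M N | (fun k => X (t k) (σ k)) ∈ S} ∩
        configCube M N, fullDet lam B X =
      (∫ X in configCube M N, fullDet lam B X) *
        ∫ x in S ∩ unitCube (Fin n), kerDet lam N B (fun k => (t k : ℤ)) x := by
  classical
  rcases (particleTuples t).eq_empty_or_nonempty with h0 | hne
  · obtain ⟨u, hu⟩ := exists_lt_of_particleTuples_eq_empty t h0
    have : ∀ x, kerDet lam N B (fun k => (t k : ℤ)) x = 0 := fun x =>
      det_corrKer_eq_zero B (fun k => (t k : ℤ)) x u hMN (by rw [filter_coe_eq]; convert hu)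
    simp [h0, this]
  · have hcard : ((particleTuples t).card : ℝ) ≠ 0 := by
      exact_mod_cast (Finset.card_pos.2 hne).ne'
    have key : ∀ σ ∈ particleTuples t,
        ∫ X in {X : Config M N | (fun k => X (t k) (σ k)) ∈ S} ∩ configCube M N, fullDet lam B X =
        ((particleTuples t).card : ℝ)⁻¹ * ((∫ X in configCube M N, fullDet lam B X) *
          ∫ x in S ∩ unitCube (Fin n), kerDet lam N B (fun k => (t k : ℤ)) x) := by
      intro σ hσ
      rw [mem_particleTuples] at hσ
      have hle : n ≤ Fintype.card (Slot M N) := by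
        simpa using Fintype.card_le_of_injective _ hσ
      obtain ⟨a, ha⟩ := exists_setIntegral_fullDet h hMN hB (Fintype.card (Slot M N) - n) _ hσ
        (by omega)
      have h1 := ha univ MeasurableSet.univ
      simp only [mem_univ, ofPred_true, univ_inter] at h1
      rw [integral_kerDet_eq_card h hMN hB] at h1
      rw [ha S hS, h1]
      field_simp
    rw [Finset.sum_congr rfl key, Finset.sum_const, nsmul_eq_mul, mul_inv_cancel_left₀ hcard]

/-- The total mass of `fullDet` is the number of permutations of the particles within slices. It is
positive, which makes the density normalizable. -/
theorem integral_fullDet_pos (h : IsPoles lam δ) (hMN : M ≤ N)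
    {B : Matrix (Fin M) (Fin M) ℝ} (hB : B * (linkMat lam M N).transpose = 1) :
    0 < ∫ X in configCube M N, fullDet lam B X := by
  let e : Fin (Fintype.card (Slot M N)) ≃ Slot M N := (Fintype.equivFin (Slot M N)).symm
  have hp := measurePreserving_positions e
  have h1 : ∀ X : Config M N, fullDet lam B X =
      kerDet lam N B (fun k => ((e k).1 : ℤ)) fun k => X (e k).1 (e k).2 := fun X =>
    (kerDet_comp e (fun p : Slot M N => (p.1 : ℤ)) fun p => X p.1 p.2).symm
  have h2 := integral_kerDet_eq_card h hMN hB fun k => (e k).1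
  rw [← hp.map_eq, setIntegral_map (measurableSet_unitCube _)
    (measurable_kerDet B _).aestronglyMeasurable hp.measurable.aemeasurable,
    preimage_unitCube] at h2
  simp only [h1, h2]
  have : (fun k => (e k).2) ∈ particleTuples fun k => (e k).1 :=
    mem_particleTuples.2 e.injective
  exact_mod_cast Finset.card_pos.2 ⟨_, this⟩

/-- The correlation functions of the density `weight` are the kernel determinants. -/
theorem weight_correlations (h : IsPoles lam δ) (hM : 1 ≤ M) (hMN : M ≤ N)
    {B : Matrix (Fin M) (Fin M) ℝ} (hB : B * (linkMat lam M N).transpose = 1) :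
    Integrable (weight lam M N) ∧ 0 < ∫ X, weight lam M N X ∧
    ∀ {n : ℕ} (t : Fin n → Time M N) {S : Set (Fin n → ℝ)}, MeasurableSet S →
      ∑ σ ∈ particleTuples t, ∫ X in {X : Config M N | (fun k => X (t k) (σ k)) ∈ S},
        weight lam M N X =
      (∫ X, weight lam M N X) *
        ∫ x in S ∩ unitCube (Fin n), kerDet lam N B (fun k => (t k : ℤ)) x := by
  set G : ℝ := (Fintype.card ((t : Time M N) → Equiv.Perm (Fin (numPts M N t))) : ℝ) with hG
  have hG0 : 0 < G := by
    rw [hG]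
    exact_mod_cast Fintype.card_pos
  obtain ⟨c, hc⟩ := exists_fullDet_eq (lam := lam) hMN hB
  set F : Config M N → ℝ := (configCube M N).indicator (fullDet lam B) with hF
  have hFi : Integrable F := (integrableOn_fullDet h B).integrable_indicator measurableSet_configCube
  have hFs : ∀ π X, F (relabel π X) = F X := by
    intro π X
    by_cases hX : X ∈ configCube M N
    · rw [hF, indicator_of_mem hX, indicator_of_mem ((relabel_mem_configCube π X).2 hX),
        fullDet_relabel]
    · rw [hF, indicator_of_notMem hX,
        indicator_of_notMem (fun h' => hX ((relabel_mem_configCube π X).1 h'))]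
  have hFw : ∀ᵐ X : Config M N, {X : Config M N | ∀ t, StrictMono (X t)}.indicator F X =
      c * weight lam M N X := by
    filter_upwards [ae_pairwise_ne (M := M) (N := N)] with X hX
    by_cases h1 : X ∈ {X : Config M N | ∀ t, StrictMono (X t)}
    · rw [indicator_of_mem h1]
      by_cases h2 : X ∈ configCube M N
      · rw [hF, indicator_of_mem h2, hc, det_segMat ⟨h1, h2, hX⟩ hM hMN, weight]
      · rw [hF, indicator_of_notMem h2, weight, if_neg fun h' => h2 h'.2.1, mul_zero]
    · rw [indicator_of_notMem h1, weight, if_neg fun h' => h1 h'.1, mul_zero]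
  have hFsum : ∀ {n : ℕ} (t : Fin n → Time M N) {S : Set (Fin n → ℝ)}, MeasurableSet S →
      ∫ X, countTuples t S X * F X = G * (c * ∫ X, countTuples t S X * weight lam M N X) := by
    intro n t S hS
    rw [integral_eq_card_mul_setIntegral (integrable_countTuples_mul t hS hFi) fun π X => by
      rw [countTuples_relabel, hFs], ← hG, ← integral_indicator measurableSet_strictMono,
      ← integral_const_mul c]
    congr 1
    refine integral_congr_ae ?_
    filter_upwards [hFw] with X hX
    rw [mul_left_comm, ← hX]
    exact indicator_mul_right _ _ _
  have hZ := integral_fullDet_pos h hMN hB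
  have hFZ : ∫ X, F X = ∫ X in configCube M N, fullDet lam B X :=
    integral_indicator measurableSet_configCube
  have hZ' : ∫ X in configCube M N, fullDet lam B X = G * (c * ∫ X, weight lam M N X) := by
    rw [← hFZ, integral_eq_card_mul_setIntegral hFi hFs, ← hG,
      ← integral_indicator measurableSet_strictMono, ← integral_const_mul c]
    congr 1
    exact integral_congr_ae hFw
  have hc0 : c ≠ 0 := by
    rintro rfl
    rw [hZ', zero_mul, mul_zero] at hZ
    exact lt_irrefl _ hZ
  have hW0 : ∫ X, weight lam M N X ≠ 0 := by
    intro h0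
    rw [hZ', h0, mul_zero, mul_zero] at hZ
    exact lt_irrefl _ hZ
  have hWi : Integrable (weight lam M N) := by
    have h1 := (hFi.indicator measurableSet_strictMono).congr hFw
    have h2 := h1.const_mul c⁻¹
    simpa only [inv_mul_cancel_left₀ hc0] using h2
  refine ⟨hWi, lt_of_le_of_ne (integral_nonneg weight_nonneg) hW0.symm, fun {n} t {S} hS => ?_⟩
  have h1 := hFsum t hS
  rw [integral_countTuples_mul t hS hFi, integral_countTuples_mul t hS hWi] at h1
  have h2 : ∀ σ : (k : Fin n) → Fin (numPts M N (t k)), ∫ X in {X : Config M N | (fun k => X (t k) (σ k)) ∈ S}, F X =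
      ∫ X in {X : Config M N | (fun k => X (t k) (σ k)) ∈ S} ∩ configCube M N, fullDet lam B X :=
    fun σ => setIntegral_indicator measurableSet_configCube
  rw [Finset.sum_congr rfl fun σ _ => h2 σ, sum_setIntegral_fullDet h hMN hB t hS, hZ'] at h1
  have hGc : G * c ≠ 0 := mul_ne_zero hG0.ne' hc0
  apply mul_left_cancel₀ hGc
  linear_combination -h1

/-! ### The kernel with closed contours -/

/-- By `coef_src` and `coef_snk`, the path part of the kernel depends on `B` only through the sums
of `hB`; only modes on the right contribute for `x` and only modes on the left for `y`. -/
theorem pathKer_eq (h : IsPoles lam δ) (hMN : M ≤ N) {B : Matrix (Fin M) (Fin M) ℝ}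
    (hB : ∀ k ∈ Finset.Ico (-(M : ℤ)) 0, ∀ m : ℤ, 0 ≤ m →
      ∑ i : Fin M, ∑ j : Fin M, srcPoly lam M i (lam k) * B i j * snkPoly lam N j (lam m) =
        numer lam N (lam k) * denom lam M (lam m) / (lam k - lam m)) (s t : ℤ) {x y : ℝ}
    (hx : x ∈ Ioo (0 : ℝ) 1) (hy : y ∈ Ioo (0 : ℝ) 1) :
    pathKer lam N B s x t y = (√(x * y))⁻¹ *
      ∑ k ∈ Finset.Ico (-(M : ℤ)) s, coef lam (-M) s k * (if k < 0 then -(x ^ lam k *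
        (numer lam N (lam k) * ∑ m ∈ Finset.Ico t N, coef lam t N m * (if 0 ≤ m then
          (y ^ lam m)⁻¹ * denom lam M (lam m) / (lam k - lam m) else 0))) else 0) := by
  have hy1 : 1 < 1 / y := one_lt_one_div hy.1 hy.2
  have e1 : ∀ i j : Fin M, trans lam (-M + i) 1 s x * B i j * trans lam t y (N - j) 1 =
      (√(x * y))⁻¹ * ∑ k ∈ Finset.Ico (-(M : ℤ)) s, ∑ m ∈ Finset.Ico t N,
        coef lam (-M) s k * mode lam k x * (coef lam t N m * mode lam m (1 / y)) *
          (srcPoly lam M i (lam k) * B i j * snkPoly lam N j (lam m)) := by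
    intro i j
    rw [trans_src h i.2.le, trans_snk h (j.2.le.trans hMN), Real.sqrt_mul hx.1.le, mul_inv,
      mul_right_comm, mul_mul_mul_comm, Finset.sum_mul_sum, mul_assoc]
    congr 1
    rw [Finset.sum_mul]
    refine Finset.sum_congr rfl fun k _ => ?_
    rw [Finset.sum_mul]
    exact Finset.sum_congr rfl fun m _ => by ring
  simp only [pathKer, e1]
  simp only [← Finset.mul_sum]
  congr 1
  have e2 : ∀ i : Fin M, (∑ j : Fin M, ∑ k ∈ Finset.Ico (-(M : ℤ)) s, ∑ m ∈ Finset.Ico t N,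
        coef lam (-M) s k * mode lam k x * (coef lam t N m * mode lam m (1 / y)) *
          (srcPoly lam M i (lam k) * B i j * snkPoly lam N j (lam m))) =
      ∑ k ∈ Finset.Ico (-(M : ℤ)) s, ∑ m ∈ Finset.Ico t N,
        coef lam (-M) s k * mode lam k x * (coef lam t N m * mode lam m (1 / y)) *
          ∑ j : Fin M, (srcPoly lam M i (lam k) * B i j * snkPoly lam N j (lam m)) := by
    intro i
    rw [Finset.sum_comm]
    refine Finset.sum_congr rfl fun k _ => ?_
    rw [Finset.sum_comm]
    refine Finset.sum_congr rfl fun m _ => by rw [Finset.mul_sum]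
  simp only [e2]
  rw [Finset.sum_comm]
  refine Finset.sum_congr rfl fun k hk => ?_
  rw [Finset.sum_comm]
  simp only [← Finset.mul_sum]
  split_ifs with hk0
  · simp only [Finset.mul_sum, ← Finset.sum_neg_distrib]
    refine Finset.sum_congr rfl fun m hm => ?_
    simp only [← Finset.mul_sum]
    split_ifs with hm0
    · rw [hB k (Finset.mem_Ico.2 ⟨(Finset.mem_Ico.1 hk).1, hk0⟩) m hm0, mode, if_pos hk0,
        if_pos hx.2.le, mode, if_neg (not_lt.2 hm0), if_pos hy1, one_div, Real.inv_rpow hy.1.le]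
      ring
    · rw [mode_of_neg (not_le.1 hm0) hy1]
      ring
  · rw [mul_zero]
    refine Finset.sum_eq_zero fun m _ => ?_
    rw [mode_of_nonneg (not_lt.1 hk0) hx.2.le]
    ring

theorem coe_coef (t s k : ℤ) : pfCoef (fun j => (lam j : ℂ)) (fun j => (stepSign j : ℂ))
    (Finset.Ico t s) k = (coef lam t s k : ℂ) := by
  simp [coef, pfCoef]

/-- Partial fractions of the transfer function. -/
theorem prod_step_eq_sum (h : IsPoles lam δ) {t s : ℤ} (hts : t < s) {z : ℂ}
    (hz : ∀ k ∈ Finset.Ico t s, z ≠ lam k) : ∏ j ∈ Finset.Ico t s, (stepSign j : ℂ) / (z - lam j) =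
      ∑ k ∈ Finset.Ico t s, (coef lam t s k : ℂ) / (z - lam k) := by
  rw [prod_eq_sum_pfCoef (lam := fun j => (lam j : ℂ)) (fun j => (stepSign j : ℂ))
    (fun i j e => h.anti.injective (Complex.ofReal_injective e)) ⟨t, by simp [hts]⟩ z hz]
  exact Finset.sum_congr rfl fun k _ => by rw [coe_coef]

/-- The residue theorem for a sum of simple fractions times a holomorphic function. -/
theorem circleIntegral_mul_sum {c : ℂ} {r : ℝ} (hr : 0 ≤ r) (S : Finset ℤ) (a p : ℤ → ℂ) {f : ℂ → ℂ}
    (hf : DifferentiableOn ℂ f (Metric.closedBall c r)) (hp : ∀ k ∈ S, p k ∉ Metric.sphere c r) :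
    (2 * Real.pi * Complex.I)⁻¹ * ∮ z in C(c, r), f z * ∑ k ∈ S, a k / (z - p k) =
      ∑ k ∈ S, a k * open Classical in if p k ∈ Metric.ball c r then f (p k) else 0 := by
  classical
  have hci : ∀ k ∈ S, CircleIntegrable (fun z => a k * ((z - p k)⁻¹ • f z)) c r := by
    intro k hk
    apply ContinuousOn.circleIntegrable hr
    refine continuousOn_const.mul (ContinuousOn.smul (ContinuousOn.inv₀ (continuousOn_id.sub continuousOn_const) ?_)
      (hf.continuousOn.mono Metric.sphere_subset_closedBall))
    intro z hz e
    exact hp k hk ((show z = p k from sub_eq_zero.1 e) ▸ hz)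
  have h1 : ∀ z, f z * ∑ k ∈ S, a k / (z - p k) = ∑ k ∈ S, a k * ((z - p k)⁻¹ • f z) := by
    intro z
    rw [Finset.mul_sum]
    refine Finset.sum_congr rfl fun k _ => ?_
    rw [smul_eq_mul]
    ring
  simp only [h1]
  rw [circleIntegral.integral_fun_sum hci, Finset.mul_sum]
  refine Finset.sum_congr rfl fun k hk => ?_
  rw [circleIntegral.integral_const_mul, mul_left_comm]
  congr 1
  split_ifs with hk'
  · rw [hf.circleIntegral_sub_inv_smul hk', smul_eq_mul, inv_mul_cancel_left₀]
    exact Complex.two_pi_I_ne_zero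
  · have hout : p k ∉ Metric.closedBall c r := by
      rw [← Metric.ball_union_sphere]
      exact fun h => h.elim hk' (hp k hk)
    have : DifferentiableOn ℂ (fun z => (z - p k)⁻¹ • f z) (Metric.closedBall c r) := by
      refine DifferentiableOn.smul (DifferentiableOn.inv (differentiableOn_id.sub (differentiableOn_const _)) ?_) hf
      intro z hz e
      exact hout ((show z = p k from sub_eq_zero.1 e) ▸ hz)
    rw [DiffContOnCl.circleIntegral_eq_zero hr (this.diffContOnCl_ball subset_rfl), mul_zero]

/-- The conditions on the radius: the contours of radius `R` enclose all relevant poles. -/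
structure Encloses (lam : ℤ → ℝ) (δ R : ℝ) (M N : ℕ) : Prop where
  pos : 0 < R
  left : ∀ k, 0 ≤ k → k < (N : ℤ) → -δ - 2 * R < lam k
  right : ∀ k, k < 0 → -(M : ℤ) ≤ k → lam k < δ + 2 * R

theorem dist_left (δ R : ℝ) (p : ℝ) : dist (p : ℂ) ((-(δ + R) : ℝ) : ℂ) = |p + δ + R| := by
  rw [Complex.dist_eq, ← Complex.ofReal_sub, Complex.norm_real, Real.norm_eq_abs]
  ring_nf

theorem dist_right (δ R : ℝ) (p : ℝ) : dist (p : ℂ) ((δ + R : ℝ) : ℂ) = |p - δ - R| := by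
  rw [Complex.dist_eq, ← Complex.ofReal_sub, Complex.norm_real, Real.norm_eq_abs]
  ring_nf

/-- Among the poles with `k < N`, exactly those with `0 ≤ k` lie inside the left circle, and none
lies on it. -/
theorem Encloses.abs_left (hR : Encloses lam δ R M N) (h : IsPoles lam δ) {k : ℤ}
    (hk : k < (N : ℤ)) : |lam k + δ + R| ≠ R ∧ (|lam k + δ + R| < R ↔ 0 ≤ k) := by
  have hR0 := hR.pos
  by_cases hk0 : 0 ≤ k
  · have h1 := hR.left k hk0 hk
    have h2 := h.lt_of_nonneg hk0
    have : |lam k + δ + R| < R := by rw [abs_lt]; constructor <;> linarith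
    exact ⟨this.ne, by simp [this, hk0]⟩
  · have h2 := h.lt_of_neg (not_le.1 hk0)
    have h3 := h.pos
    have : R < |lam k + δ + R| := by rw [abs_of_pos] <;> linarith
    exact ⟨this.ne', by simp only [hk0, iff_false, not_lt]; exact this.le⟩

/-- Among the poles with `-M ≤ k`, exactly those with `k < 0` lie inside the right circle, and none
lies on it. -/
theorem Encloses.abs_right (hR : Encloses lam δ R M N) (h : IsPoles lam δ) {k : ℤ}
    (hk : -(M : ℤ) ≤ k) : |lam k - δ - R| ≠ R ∧ (|lam k - δ - R| < R ↔ k < 0) := by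
  have hR0 := hR.pos
  by_cases hk0 : k < 0
  · have h1 := hR.right k hk0 hk
    have h2 := h.lt_of_neg hk0
    have : |lam k - δ - R| < R := by rw [abs_lt]; constructor <;> linarith
    exact ⟨this.ne, by simp [this, hk0]⟩
  · have h2 := h.lt_of_nonneg (not_lt.1 hk0)
    have h3 := h.pos
    have : R < |lam k - δ - R| := by rw [abs_of_neg] <;> linarith
    exact ⟨this.ne', by simp only [hk0, iff_false, not_lt]; exact this.le⟩

/-- The left contour avoids the poles. -/
theorem Encloses.ne_of_mem_left (hR : Encloses lam δ R M N) (h : IsPoles lam δ) {z : ℂ}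
    (hz : z ∈ Metric.sphere ((-(δ + R) : ℝ) : ℂ) R) {k : ℤ} (hk : k < (N : ℤ)) : z ≠ lam k := by
  rintro rfl
  rw [Metric.mem_sphere, dist_left] at hz
  exact (hR.abs_left h hk).1 hz

/-- The right contour avoids the poles. -/
theorem Encloses.ne_of_mem_right (hR : Encloses lam δ R M N) (h : IsPoles lam δ) {z : ℂ}
    (hz : z ∈ Metric.sphere ((δ + R : ℝ) : ℂ) R) {k : ℤ} (hk : -(M : ℤ) ≤ k) : z ≠ lam k := by
  rintro rfl
  rw [Metric.mem_sphere, dist_right] at hz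
  exact (hR.abs_right h hk).1 hz

theorem re_le_of_mem_left {z : ℂ} (hz : z ∈ Metric.closedBall ((-(δ + R) : ℝ) : ℂ) R) :
    z.re ≤ -δ := by
  rw [Metric.mem_closedBall, Complex.dist_eq] at hz
  have := (Complex.re_le_norm _).trans hz
  simp only [Complex.sub_re, Complex.ofReal_re] at this
  linarith

theorem le_re_of_mem_right {z : ℂ} (hz : z ∈ Metric.closedBall ((δ + R : ℝ) : ℂ) R) :
    δ ≤ z.re := by
  rw [Metric.mem_closedBall, Complex.dist_eq] at hz
  have := (neg_le_abs _).trans ((Complex.abs_re_le_norm _).trans hz)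
  simp only [Complex.sub_re, Complex.ofReal_re] at this
  linarith

/-- The left contour is counterclockwise and encloses the poles with `0 ≤ k`. -/
theorem leftInt_mul_sum (h : IsPoles lam δ) (hR : Encloses lam δ R M N) {S : Finset ℤ}
    (hS : ∀ k ∈ S, k < (N : ℤ)) (a : ℤ → ℂ) {f : ℂ → ℂ}
    (hf : DifferentiableOn ℂ f {z | z.re ≤ -δ}) :
    leftInt δ R (fun z => f z * ∑ k ∈ S, a k / (z - lam k)) =
      ∑ k ∈ S, a k * if 0 ≤ k then f (lam k) else 0 := by
  have hmem := fun k hk => hR.abs_left h (hS k hk)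
  rw [leftInt, circleIntegral_mul_sum hR.pos.le S a (fun k => (lam k : ℂ)) (hf.mono ?_) ?_]
  · refine Finset.sum_congr rfl fun k hk => ?_
    simp only [Metric.mem_ball, dist_left, (hmem k hk).2]
  · exact fun z hz => re_le_of_mem_left hz
  · intro k hk
    rw [Metric.mem_sphere, dist_left]
    exact (hmem k hk).1

/-- The right contour is clockwise, whence the minus sign, and encloses the poles with `k < 0`. -/
theorem rightInt_mul_sum (h : IsPoles lam δ) (hR : Encloses lam δ R M N) {S : Finset ℤ}
    (hS : ∀ k ∈ S, -(M : ℤ) ≤ k) (a : ℤ → ℂ) {f : ℂ → ℂ}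
    (hf : DifferentiableOn ℂ f {z | δ ≤ z.re}) :
    rightInt δ R (fun z => f z * ∑ k ∈ S, a k / (z - lam k)) =
      ∑ k ∈ S, a k * if k < 0 then -f (lam k) else 0 := by
  have hmem := fun k hk => hR.abs_right h (hS k hk)
  rw [rightInt, circleIntegral_mul_sum hR.pos.le S a (fun k => (lam k : ℂ)) (hf.mono ?_) ?_,
    ← Finset.sum_neg_distrib]
  · refine Finset.sum_congr rfl fun k hk => ?_
    simp only [Metric.mem_ball, dist_right, (hmem k hk).2]
    split_ifs <;> ring
  · exact fun z hz => le_re_of_mem_right hz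
  · intro k hk
    rw [Metric.mem_sphere, dist_right]
    exact (hmem k hk).1

/-- The poles of the one-step factors of the Muttalib–Borodin process. -/
def poles (α η θ : ℝ) (k : ℤ) : ℝ :=
  if k < 0 then α / 2 + η * (-k - 1 / 2) else -(α / 2 + θ * (k + 1 / 2))

theorem isPoles_poles {α η θ : ℝ} (hα : 0 ≤ α) (hη : 0 < η) (hθ : 0 < θ) (hδ : 0 < δ)
    (hδη : δ < (α + η) / 2) (hδθ : δ < (α + θ) / 2) : IsPoles (poles α η θ) δ where
  anti := by
    intro j k hjk
    have hjk' : (j : ℝ) < k := by exact_mod_cast hjk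
    by_cases hj : j < 0 <;> by_cases hk : k < 0
    · simp only [poles, if_pos hj, if_pos hk]
      nlinarith
    · simp only [poles, if_pos hj, if_neg hk]
      have h1 : (j : ℝ) ≤ -1 := by exact_mod_cast (by omega : j ≤ -1)
      have h2 : (0 : ℝ) ≤ k := by exact_mod_cast (by omega : 0 ≤ k)
      have : 0 < η * (-j - 1 / 2) := mul_pos hη (by linarith)
      have : 0 < θ * (k + 1 / 2) := mul_pos hθ (by linarith)
      linarith
    · omega
    · simp only [poles, if_neg hj, if_neg hk]
      nlinarith
  pos := hδ
  lt_neg_one := by simp [poles]; linarith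
  zero_lt := by simp [poles]; linarith

theorem encloses_poles {α η θ : ℝ} (hM : 1 ≤ M) (hη : 0 < η) (hθ : 0 < θ)
    (hδη : δ < (α + η) / 2) (hRη : α / 2 + η * (M - 1 / 2) < δ + 2 * R)
    (hRθ : α / 2 + θ * (N - 1 / 2) < δ + 2 * R) : Encloses (poles α η θ) δ R M N where
  pos := by
    have : (1 : ℝ) ≤ M := by exact_mod_cast hM
    nlinarith
  left k hk hkN := by
    have : (k : ℝ) + 1 ≤ N := by exact_mod_cast hkN
    simp only [poles, if_neg (not_lt.2 hk)]
    nlinarith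
  right k hk hkM := by
    have : -(M : ℝ) ≤ k := by exact_mod_cast hkM
    simp only [poles, if_pos hk]
    nlinarith

/-- The exponents of the density are the differences of consecutive poles, less one. -/
theorem poles_sub_poles (α η θ : ℝ) (t : ℤ) :
    poles α η θ (t - 1) - poles α η θ t - 1 = slotExponent α η θ t := by
  rcases lt_trichotomy t 0 with ht | rfl | ht
  · simp only [poles, slotExponent, if_pos ht, if_pos (show t - 1 < 0 by omega)]
    push_cast
    ring
  · norm_num [poles, slotExponent]
    ring
  · simp only [poles, slotExponent, if_neg (show ¬t < 0 by omega), if_neg ht.ne',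
      if_neg (show ¬t - 1 < 0 by omega)]
    push_cast
    ring

theorem ascPochhammer_eval_eq_prod (n : ℕ) (z : ℂ) :
    (ascPochhammer ℂ n).eval z = ∏ i ∈ Finset.range n, (z + i) := by
  induction n with
  | zero => simp
  | succ n ih => rw [ascPochhammer_succ_eval, ih, Finset.prod_range_succ]

theorem prod_Ico_up (a N : ℕ) (f : ℤ → ℂ) :
    ∏ j ∈ Finset.Ico (a : ℤ) N, f j = ∏ i ∈ Finset.range (N - a), f (a + i) := by
  refine (Finset.prod_nbij' (fun i : ℕ => (a : ℤ) + i) (fun k => (k - a).toNat) ?_ ?_ ?_ ?_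
    fun _ _ => rfl).symm
  all_goals intro j hj; simp only [Finset.mem_range, Finset.mem_Ico] at *; omega

theorem prod_Ico_down (b M : ℕ) (f : ℤ → ℂ) :
    ∏ j ∈ Finset.Ico (-(M : ℤ)) (-(b : ℤ)), f j = ∏ i ∈ Finset.range (M - b), f (-b - 1 - i) := by
  refine (Finset.prod_nbij' (fun i : ℕ => -(b : ℤ) - 1 - i) (fun k => (-b - 1 - k).toNat) ?_ ?_ ?_
    ?_ fun _ _ => rfl).symm
  all_goals intro j hj; simp only [Finset.mem_range, Finset.mem_Ico] at *; omega

/-- The Pochhammer symbols of `F_c` are products over poles. The prefactor `θ^(N - s⁺) / η^(M - s⁻)`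
makes the factors monic. -/
theorem Fc_eq_prod {α η θ : ℝ} (hη : 0 < η) (hθ : 0 < θ) (s : ℤ) (z : ℂ) :
    Fc M N α η θ s z = (∏ j ∈ Finset.Ico (s.toNat : ℤ) N, (z - poles α η θ j)) /
      ∏ j ∈ Finset.Ico (-(M : ℤ)) (-((-s).toNat : ℤ)), ((poles α η θ j : ℂ) - z) := by
  have hη' : (η : ℂ) ≠ 0 := by exact_mod_cast hη.ne'
  have hθ' : (θ : ℂ) ≠ 0 := by exact_mod_cast hθ.ne'
  have pow_mul_prod : ∀ (c : ℂ) (n : ℕ) (f : ℕ → ℂ),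
      c ^ n * ∏ i ∈ Finset.range n, f i = ∏ i ∈ Finset.range n, c * f i := by
    intro c n f
    rw [Finset.prod_mul_distrib, Finset.prod_const, Finset.card_range]
  rw [Fc, ascPochhammer_eval_eq_prod, ascPochhammer_eval_eq_prod, div_mul_div_comm, pow_mul_prod,
    pow_mul_prod, prod_Ico_up, prod_Ico_down]
  congr 1
  · refine Finset.prod_congr rfl fun i _ => ?_
    rw [poles, if_neg (by omega)]
    push_cast
    field_simp
    ring
  · refine Finset.prod_congr rfl fun i _ => ?_
    rw [poles, if_pos (by omega)]
    push_cast
    field_simp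
    ring

/-- The complex version of `numer`. -/
def numerC (lam : ℤ → ℝ) (N : ℕ) (z : ℂ) : ℂ := ∏ j ∈ Finset.Ico (0 : ℤ) N, (z - lam j)

/-- The complex version of `denom`. -/
def denomC (lam : ℤ → ℝ) (M : ℕ) (z : ℂ) : ℂ := ∏ j ∈ Finset.Ico (-(M : ℤ)) 0, ((lam j : ℂ) - z)

theorem numerC_coe (z : ℝ) : numerC lam N z = (numer lam N z : ℂ) := by
  simp [numerC, numer]

theorem denomC_coe (z : ℝ) : denomC lam M z = (denom lam M z : ℂ) := by
  simp [denomC, denom]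

theorem differentiable_numerC : Differentiable ℂ (numerC lam N) := by
  unfold numerC
  exact Differentiable.fun_finsetProd fun j _ => by fun_prop

theorem differentiable_denomC : Differentiable ℂ (denomC lam M) := by
  unfold denomC
  exact Differentiable.fun_finsetProd fun j _ => by fun_prop

/-- `F_c(s, ·)` is the numerator polynomial times the transfer function from time `-M` to time `s`.
-/
theorem Fc_eq_mul {α η θ : ℝ} (hη : 0 < η) (hθ : 0 < θ) {s : ℤ} (hs' : s ≤ N)
    {z : ℂ} (hz : ∀ k ∈ Finset.Ico (-(M : ℤ)) N, z ≠ poles α η θ k) :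
    Fc M N α η θ s z = numerC (poles α η θ) N z *
      ∏ j ∈ Finset.Ico (-(M : ℤ)) s, (stepSign j : ℂ) / (z - poles α η θ j) := by
  have hneg : ∀ u : ℤ, u ≤ 0 → ∏ j ∈ Finset.Ico (-(M : ℤ)) u, (stepSign j : ℂ) /
      (z - poles α η θ j) = (∏ j ∈ Finset.Ico (-(M : ℤ)) u, ((poles α η θ j : ℂ) - z))⁻¹ := by
    intro u hu
    rw [← Finset.prod_inv_distrib]
    refine Finset.prod_congr rfl fun j hj => ?_
    rw [stepSign, if_pos (by rw [Finset.mem_Ico] at hj; omega), ← neg_sub (poles α η θ j : ℂ) z]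
    push_cast
    rw [neg_div_neg_eq, one_div]
  rw [Fc_eq_prod hη hθ]
  rcases le_total s 0 with h0 | h0
  · rw [Int.toNat_of_nonpos h0, Int.toNat_of_nonneg (by omega : 0 ≤ -s), neg_neg, hneg s h0,
      numerC, div_eq_mul_inv]
    rfl
  · rw [Int.toNat_of_nonneg h0, Int.toNat_of_nonpos (by omega : -s ≤ 0), numerC,
      ← Finset.Ico_union_Ico_eq_Ico (by omega : -(M : ℤ) ≤ 0) h0,
      Finset.prod_union (Finset.Ico_disjoint_Ico_consecutive _ _ _), hneg 0 le_rfl,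
      ← Finset.Ico_union_Ico_eq_Ico h0 hs',
      Finset.prod_union (Finset.Ico_disjoint_Ico_consecutive _ _ _)]
    have h1 : (∏ j ∈ Finset.Ico 0 s, (z - poles α η θ j)) *
        ∏ j ∈ Finset.Ico 0 s, (stepSign j : ℂ) / (z - poles α η θ j) = 1 := by
      rw [← Finset.prod_mul_distrib]
      refine Finset.prod_eq_one fun j hj => ?_
      rw [stepSign, if_neg (by rw [Finset.mem_Ico] at hj; omega)]
      push_cast
      rw [mul_one_div, div_self (sub_ne_zero.2 (hz j (by rw [Finset.mem_Ico] at *; omega)))]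
    rw [div_eq_mul_inv]
    push_cast
    rw [neg_zero]
    linear_combination -(∏ j ∈ Finset.Ico s (N : ℤ), (z - poles α η θ j)) *
      (∏ j ∈ Finset.Ico (-(M : ℤ)) 0, ((poles α η θ j : ℂ) - z))⁻¹ * h1

/-- The transfer function from time `-M` to time `N` is the reciprocal of `numerC * denomC`. -/
theorem numerC_mul_denomC_mul {z : ℂ} (hz : ∀ k ∈ Finset.Ico (-(M : ℤ)) N, z ≠ lam k) :
    numerC lam N z * denomC lam M z *
      ∏ j ∈ Finset.Ico (-(M : ℤ)) N, (stepSign j : ℂ) / (z - lam j) = 1 := by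
  have h1 : (∏ j ∈ Finset.Ico (0 : ℤ) N, (z - lam j)) *
      ∏ j ∈ Finset.Ico (0 : ℤ) N, (stepSign j : ℂ) / (z - lam j) = 1 := by
    rw [← Finset.prod_mul_distrib]
    refine Finset.prod_eq_one fun j hj => ?_
    rw [stepSign, if_neg (by rw [Finset.mem_Ico] at hj; omega)]
    push_cast
    rw [mul_one_div, div_self (sub_ne_zero.2 (hz j (by rw [Finset.mem_Ico] at *; omega)))]
  have h2 : (∏ j ∈ Finset.Ico (-(M : ℤ)) 0, ((lam j : ℂ) - z)) *
      ∏ j ∈ Finset.Ico (-(M : ℤ)) 0, (stepSign j : ℂ) / (z - lam j) = 1 := by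
    rw [← Finset.prod_mul_distrib]
    refine Finset.prod_eq_one fun j hj => ?_
    rw [stepSign, if_pos (by rw [Finset.mem_Ico] at hj; omega), ← neg_sub (lam j : ℂ) z]
    push_cast
    rw [neg_div_neg_eq, mul_one_div,
      div_self (sub_ne_zero.2 (hz j (by rw [Finset.mem_Ico] at *; omega)).symm)]
  rw [← Finset.Ico_union_Ico_eq_Ico (by omega : -(M : ℤ) ≤ 0) (by omega : (0 : ℤ) ≤ N),
    Finset.prod_union (Finset.Ico_disjoint_Ico_consecutive _ _ _), numerC, denomC]
  linear_combination h1 + (∏ j ∈ Finset.Ico (0 : ℤ) N, (z - lam j)) *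
      (∏ j ∈ Finset.Ico (0 : ℤ) N, (stepSign j : ℂ) / (z - lam j)) * h2

/-- `1 / F_c(s, ·)` is the denominator polynomial times the transfer function from time `s` to time
`N`. -/
theorem one_div_Fc_eq_mul {α η θ : ℝ} (hη : 0 < η) (hθ : 0 < θ) {s : ℤ} (hs : -(M : ℤ) ≤ s)
    (hs' : s ≤ N) {z : ℂ} (hz : ∀ k ∈ Finset.Ico (-(M : ℤ)) N, z ≠ poles α η θ k) :
    (Fc M N α η θ s z)⁻¹ = denomC (poles α η θ) M z *
      ∏ j ∈ Finset.Ico s (N : ℤ), (stepSign j : ℂ) / (z - poles α η θ j) := by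
  have h1 := numerC_mul_denomC_mul (M := M) (N := N) hz
  rw [← Finset.Ico_union_Ico_eq_Ico hs hs',
    Finset.prod_union (Finset.Ico_disjoint_Ico_consecutive _ _ _)] at h1
  rw [Fc_eq_mul hη hθ hs' hz]
  refine inv_eq_of_mul_eq_one_right ?_
  linear_combination h1

/-- The quotient of the functions `F_c` at two times is the transfer function between these times.
-/
theorem Fc_div_Fc {α η θ : ℝ} (hη : 0 < η) (hθ : 0 < θ) {s t : ℤ} (ht : -(M : ℤ) ≤ t) (hts : t ≤ s)
    (hs' : s ≤ N) {z : ℂ} (hz : ∀ k ∈ Finset.Ico (-(M : ℤ)) N, z ≠ poles α η θ k) :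
    Fc M N α η θ s z / Fc M N α η θ t z =
      ∏ j ∈ Finset.Ico t s, (stepSign j : ℂ) / (z - poles α η θ j) := by
  have h1 := numerC_mul_denomC_mul (M := M) (N := N) hz
  rw [div_eq_mul_inv, one_div_Fc_eq_mul hη hθ ht (hts.trans hs') hz,
    Fc_eq_mul hη hθ hs' hz, ← Finset.Ico_union_Ico_eq_Ico ht hts,
    Finset.prod_union (Finset.Ico_disjoint_Ico_consecutive _ _ _)]
  rw [← Finset.Ico_union_Ico_eq_Ico ht (hts.trans hs'),
    Finset.prod_union (Finset.Ico_disjoint_Ico_consecutive _ _ _)] at h1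
  linear_combination (∏ j ∈ Finset.Ico t s, (stepSign j : ℂ) / (z - poles α η θ j)) * h1

theorem ne_poles_of_re (h : IsPoles lam δ) {z : ℂ} (hz : -δ ≤ z.re) (hz' : z.re ≤ δ) (k : ℤ) :
    z ≠ lam k := by
  rintro rfl
  rw [Complex.ofReal_re] at hz hz'
  rcases lt_or_ge k 0 with hk | hk
  · linarith [h.lt_of_neg hk]
  · linarith [h.lt_of_nonneg hk]

/-- The value of the double contour integral as a sum over residues, without the prefactor. -/
def doubleValue (lam : ℤ → ℝ) (M N : ℕ) (s : ℤ) (x : ℝ) (t : ℤ) (y : ℝ) : ℂ :=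
  ∑ k ∈ Finset.Ico (-(M : ℤ)) s, (coef lam (-M) s k : ℂ) *
    if k < 0 then -(numerC lam N (lam k) * (x : ℂ) ^ (lam k : ℂ) *
      ∑ m ∈ Finset.Ico t (N : ℤ), (coef lam t N m : ℂ) *
        (if 0 ≤ m then ((y : ℂ) ^ (lam m : ℂ))⁻¹ * denomC lam M (lam m) / (lam k - lam m)
          else 0)) else 0

/-- The correlation kernel in terms of the values of the double and the single contour integral. -/
theorem corrKer_eq (h : IsPoles lam δ) (hMN : M ≤ N) {B : Matrix (Fin M) (Fin M) ℝ}
    (hB : ∀ k ∈ Finset.Ico (-(M : ℤ)) 0, ∀ m : ℤ, 0 ≤ m →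
      ∑ i : Fin M, ∑ j : Fin M, srcPoly lam M i (lam k) * B i j * snkPoly lam N j (lam m) =
        numer lam N (lam k) * denom lam M (lam m) / (lam k - lam m)) (s t : ℤ) {x y : ℝ}
    (hx : x ∈ Ioo (0 : ℝ) 1) (hy : y ∈ Ioo (0 : ℝ) 1) :
    (corrKer lam N B s x t y : ℂ) = 1 / (Real.sqrt (x * y) : ℂ) * doubleValue lam M N s x t y -
      if t < s then 1 / (Real.sqrt (x * y) : ℂ) *
        ∑ k ∈ Finset.Ico t s, (coef lam t s k : ℂ) * (mode lam k (x / y) : ℂ) else 0 := by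
  rw [corrKer, pathKer_eq h hMN hB s t hx hy, Complex.ofReal_sub, doubleValue]
  congr 1
  · push_cast
    rw [one_div]
    congr 1
    refine Finset.sum_congr rfl fun k _ => ?_
    split_ifs with hk
    · rw [← Complex.ofReal_cpow hx.1.le, numerC_coe]
      push_cast
      rw [mul_left_comm, mul_assoc]
      congr 3
      refine congrArg _ (Finset.sum_congr rfl fun m _ => ?_)
      split_ifs with hm
      · rw [← Complex.ofReal_cpow hy.1.le, denomC_coe]
        push_cast
        rfl
      · simp
    · simp
  · by_cases hts : t < s
    · rw [if_pos hts, trans]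
      push_cast
      rw [one_div]
    · rw [if_neg hts, trans_eq_zero (not_lt.1 hts), Complex.ofReal_zero]

/-- The kernel with closed contours is the (real) correlation kernel. -/
theorem Kc_eq {α η θ : ℝ} (hη : 0 < η) (hθ : 0 < θ) (h : IsPoles (poles α η θ) δ)
    (hR : Encloses (poles α η θ) δ R M N) (hMN : M ≤ N) {B : Matrix (Fin M) (Fin M) ℝ}
    (hB : ∀ k ∈ Finset.Ico (-(M : ℤ)) 0, ∀ m : ℤ, 0 ≤ m →
      ∑ i : Fin M, ∑ j : Fin M, srcPoly (poles α η θ) M i (poles α η θ k) * B i j *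
        snkPoly (poles α η θ) N j (poles α η θ m) =
        numer (poles α η θ) N (poles α η θ k) * denom (poles α η θ) M (poles α η θ m) /
          (poles α η θ k - poles α η θ m)) {s t : ℤ} {x y : ℝ}
    (hs : -(M : ℤ) < s) (hs' : s < N) (ht : -(M : ℤ) < t) (ht' : t < N)
    (hx : x ∈ Ioo (0 : ℝ) 1) (hy : y ∈ Ioo (0 : ℝ) 1) :
    Kc M N α η θ δ R s x t y = (corrKer (poles α η θ) N B s x t y : ℂ) := by
  generalize hlam : poles α η θ = lam at *
  have hx0 : (x : ℂ) ≠ 0 := by exact_mod_cast hx.1.ne'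
  have hy0 : (y : ℂ) ≠ 0 := by exact_mod_cast hy.1.ne'
  have hR0 := hR.pos
  have hδ := h.pos
  have hmt : ∀ m ∈ Finset.Ico t (N : ℤ), m < (N : ℤ) := fun m hm => (Finset.mem_Ico.1 hm).2
  have hks : ∀ k ∈ Finset.Ico (-(M : ℤ)) s, -(M : ℤ) ≤ k := fun k hk => (Finset.mem_Ico.1 hk).1
  -- the inner integral
  have hinner : ∀ ζ ∈ Metric.sphere ((δ + R : ℝ) : ℂ) R,
      leftInt δ R (fun ω => doubleIntegrand M N α η θ s x t y ζ ω) =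
        (numerC lam N ζ * (x : ℂ) ^ ζ * ∑ m ∈ Finset.Ico t (N : ℤ), (coef lam t N m : ℂ) *
          (if 0 ≤ m then ((y : ℂ) ^ (lam m : ℂ))⁻¹ * denomC lam M (lam m) / (ζ - lam m) else 0)) *
        ∑ k ∈ Finset.Ico (-(M : ℤ)) s, (coef lam (-M) s k : ℂ) / (ζ - lam k) := by
    intro ζ hζ
    have hζδ := le_re_of_mem_right (Metric.sphere_subset_closedBall hζ)
    have e1 : leftInt δ R (fun ω => doubleIntegrand M N α η θ s x t y ζ ω) =
        leftInt δ R (fun ω => (Fc M N α η θ s ζ * (x : ℂ) ^ ζ *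
          (((y : ℂ) ^ ω)⁻¹ * denomC lam M ω / (ζ - ω))) *
          ∑ m ∈ Finset.Ico t (N : ℤ), (coef lam t N m : ℂ) / (ω - lam m)) := by
      simp only [leftInt]
      congr 1
      refine circleIntegral.integral_congr hR0.le fun ω hω => ?_
      have hω' : ∀ k ∈ Finset.Ico (-(M : ℤ)) N, ω ≠ lam k := fun k hk =>
        hR.ne_of_mem_left h hω (Finset.mem_Ico.1 hk).2
      rw [← prod_step_eq_sum h ht' fun k hk => hω' k
        (Finset.Ico_subset_Ico_left ht.le hk), doubleIntegrand, div_eq_mul_inv (Fc M N α η θ s ζ),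
        one_div_Fc_eq_mul hη hθ ht.le ht'.le (by rw [hlam]; exact hω'), hlam]
      ring
    rw [e1, leftInt_mul_sum h hR hmt, Fc_eq_mul hη hθ hs'.le, hlam,
      prod_step_eq_sum h hs fun k hk => hR.ne_of_mem_right h hζ (Finset.mem_Ico.1 hk).1]
    · simp only [Finset.mul_sum, Finset.sum_mul]
      rw [Finset.sum_comm]
      refine Finset.sum_congr rfl fun m _ => ?_
      split_ifs with hm
      · simp only [Finset.mul_sum]
        refine Finset.sum_congr rfl fun k _ => by ring
      · simp
    · intro k hk
      rw [hlam]
      exact hR.ne_of_mem_right h hζ (Finset.mem_Ico.1 hk).1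
    · refine DifferentiableOn.const_mul (DifferentiableOn.div (DifferentiableOn.mul
        (DifferentiableOn.inv ?_ fun ω _ => ?_) differentiable_denomC.differentiableOn)
        (by fun_prop) fun ω hω e => ?_) _
      · exact fun ω _ => (differentiableAt_id.const_cpow (Or.inl hy0)).differentiableWithinAt
      · rw [Ne, Complex.cpow_eq_zero_iff]
        exact fun e => hy0 e.1
      · have := congrArg Complex.re (sub_eq_zero.1 e)
        simp only [mem_ofPred_eq] at hω
        linarith
  have hdouble : rightInt δ R (fun ζ => leftInt δ R (fun ω =>
      doubleIntegrand M N α η θ s x t y ζ ω)) = doubleValue lam M N s x t y := by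
    rw [doubleValue, ← rightInt_mul_sum h hR hks (fun k => (coef lam (-M) s k : ℂ))
      (f := fun ζ => numerC lam N ζ * (x : ℂ) ^ ζ * ∑ m ∈ Finset.Ico t (N : ℤ),
        (coef lam t N m : ℂ) * (if 0 ≤ m then
          ((y : ℂ) ^ (lam m : ℂ))⁻¹ * denomC lam M (lam m) / (ζ - lam m) else 0))]
    · simp only [rightInt]
      congr 2
      exact circleIntegral.integral_congr hR0.le hinner
    · refine DifferentiableOn.mul (DifferentiableOn.mul differentiable_numerC.differentiableOn ?_)
        (DifferentiableOn.fun_sum fun m _ => DifferentiableOn.const_mul ?_ _)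
      · exact fun ω _ => (differentiableAt_id.const_cpow (Or.inl hx0)).differentiableWithinAt
      · split_ifs with hm
        · refine DifferentiableOn.div (by fun_prop) (by fun_prop) fun ζ hζ e => ?_
          have := congrArg Complex.re (sub_eq_zero.1 e)
          have h2 := h.lt_of_nonneg hm
          simp only [mem_ofPred_eq, Complex.ofReal_re] at hζ this
          linarith
        · fun_prop
  have hsingle : t < s → (if y < x then leftInt δ R (singleIntegrand M N α η θ s x t y)
      else rightInt δ R (singleIntegrand M N α η θ s x t y)) =
      ∑ k ∈ Finset.Ico t s, (coef lam t s k : ℂ) * (mode lam k (x / y) : ℂ) := by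
    intro hts
    have hr : 0 < x / y := div_pos hx.1 hy.1
    have hr0 : ((x / y : ℝ) : ℂ) ≠ 0 := by exact_mod_cast hr.ne'
    have hint : ∀ z : ℂ, (∀ k ∈ Finset.Ico (-(M : ℤ)) N, z ≠ lam k) →
        singleIntegrand M N α η θ s x t y z = ((x / y : ℝ) : ℂ) ^ z *
          ∑ k ∈ Finset.Ico t s, (coef lam t s k : ℂ) / (z - lam k) := by
      intro z hz
      rw [singleIntegrand, Fc_div_Fc hη hθ ht.le hts.le hs'.le (by rw [hlam]; exact hz), hlam,
        prod_step_eq_sum h hts fun k hk => hz k (Finset.mem_Ico.2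
          ⟨ht.le.trans (Finset.mem_Ico.1 hk).1, (Finset.mem_Ico.1 hk).2.trans hs'⟩), mul_comm]
    have hdiff : ∀ S : Set ℂ, DifferentiableOn ℂ (fun z => ((x / y : ℝ) : ℂ) ^ z) S := fun S z _ =>
      (differentiableAt_id.const_cpow (Or.inl hr0)).differentiableWithinAt
    split_ifs with hyx
    · have e1 : leftInt δ R (singleIntegrand M N α η θ s x t y) = leftInt δ R (fun z =>
          ((x / y : ℝ) : ℂ) ^ z * ∑ k ∈ Finset.Ico t s, (coef lam t s k : ℂ) / (z - lam k)) := by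
        simp only [leftInt]
        congr 1
        exact circleIntegral.integral_congr hR0.le fun z hz => hint z fun k hk =>
          hR.ne_of_mem_left h hz (Finset.mem_Ico.1 hk).2
      rw [e1, leftInt_mul_sum h hR (fun k hk => (Finset.mem_Ico.1 hk).2.trans hs') _ (hdiff _)]
      refine Finset.sum_congr rfl fun k _ => ?_
      have : 1 < x / y := (one_lt_div hy.1).2 hyx
      congr 1
      split_ifs with hk
      · rw [mode, if_neg (not_lt.2 hk), if_pos this, Complex.ofReal_cpow hr.le]
      · rw [mode_of_neg (not_le.1 hk) this, Complex.ofReal_zero]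
    · have e1 : rightInt δ R (singleIntegrand M N α η θ s x t y) = rightInt δ R (fun z =>
          ((x / y : ℝ) : ℂ) ^ z * ∑ k ∈ Finset.Ico t s, (coef lam t s k : ℂ) / (z - lam k)) := by
        simp only [rightInt]
        congr 2
        exact circleIntegral.integral_congr hR0.le fun z hz => hint z fun k hk =>
          hR.ne_of_mem_right h hz (Finset.mem_Ico.1 hk).1
      rw [e1, rightInt_mul_sum h hR (fun k hk => ht.le.trans (Finset.mem_Ico.1 hk).1) _ (hdiff _)]
      refine Finset.sum_congr rfl fun k _ => ?_
      have : x / y ≤ 1 := (div_le_one hy.1).2 (not_lt.1 hyx)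
      congr 1
      split_ifs with hk
      · rw [mode, if_pos hk, if_pos this, Complex.ofReal_neg, Complex.ofReal_cpow hr.le]
      · rw [mode_of_nonneg (not_lt.1 hk) this, Complex.ofReal_zero]
  rw [Kc, hdouble, corrKer_eq h hMN hB s t hx hy]
  congr 1
  by_cases hts : t < s
  · rw [if_pos hts, if_pos hts, hsingle hts]
  · rw [if_neg hts, if_neg hts]

/-! ### The law and its correlation measures -/

/-- Off the admissible set, `weight` vanishes, and on it the exponents agree by `poles_sub_poles`.
-/
theorem weightMeasure_eq (α η θ : ℝ) : weightMeasure M N α η θ =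
    (volume : Measure (Config M N)).withDensity
      fun X => ENNReal.ofReal (weight (poles α η θ) M N X) := by
  rw [weightMeasure, ← withDensity_indicator measurableSet_admissible]
  congr 1
  funext X
  by_cases hX : X ∈ admissible M N
  · rw [indicator_of_mem hX, weight, if_pos hX]
    simp only [poles_sub_poles]
  · rw [indicator_of_notMem hX, weight, if_neg hX, ENNReal.ofReal_zero]

theorem weightMeasure_apply {α η θ : ℝ} (hi : Integrable (weight (poles α η θ) M N))
    {A : Set (Config M N)} (hA : MeasurableSet A) :
    weightMeasure M N α η θ A = ENNReal.ofReal (∫ X in A, weight (poles α η θ) M N X) := by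
  rw [weightMeasure_eq, withDensity_apply _ hA,
    ofReal_integral_eq_lintegral_ofReal hi.integrableOn (ae_of_all _ weight_nonneg)]

theorem law_real {α η θ : ℝ} (hi : Integrable (weight (poles α η θ) M N))
    {A : Set (Config M N)} (hA : MeasurableSet A) :
    (law M N α η θ).real A =
      (∫ X, weight (poles α η θ) M N X)⁻¹ * ∫ X in A, weight (poles α η θ) M N X := by
  rw [law, Measure.real, Measure.smul_apply, smul_eq_mul, ENNReal.toReal_mul, ENNReal.toReal_inv,
    weightMeasure_apply hi hA, weightMeasure_apply hi MeasurableSet.univ, setIntegral_univ,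
    ENNReal.toReal_ofReal (integral_nonneg weight_nonneg),
    ENNReal.toReal_ofReal (integral_nonneg weight_nonneg)]

theorem isProbabilityMeasure_law {α η θ : ℝ} (hi : Integrable (weight (poles α η θ) M N))
    (hpos : 0 < ∫ X, weight (poles α η θ) M N X) : IsProbabilityMeasure (law M N α η θ) := by
  constructor
  rw [law, Measure.smul_apply, smul_eq_mul, weightMeasure_apply hi MeasurableSet.univ,
    setIntegral_univ]
  exact ENNReal.inv_mul_cancel (by simpa using hpos) ENNReal.ofReal_ne_top

/-- The correlation measure as a sum over tuples of distinct particles. -/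
theorem corrMeasure_real {α η θ : ℝ} [IsFiniteMeasure (law M N α η θ)] {n : ℕ}
    (t : Fin n → Time M N) {B : Set (Fin n → ℝ)} (hB : MeasurableSet B) :
    (corrMeasure M N α η θ t).real B = ∑ σ ∈ particleTuples t,
      (law M N α η θ).real {X : Config M N | (fun k => X (t k) (σ k)) ∈ B} := by
  classical
  rw [Measure.real, corrMeasure, Measure.finsetSum_apply, ENNReal.toReal_sum, particleTuples,
    Finset.sum_filter]
  · refine Finset.sum_congr rfl fun σ _ => ?_
    split_ifs with hσ
    · rw [Measure.map_apply (measurable_positions fun k => (⟨t k, σ k⟩ : Slot M N)) hB]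
      rfl
    · simp
  · intro σ _
    split_ifs with hσ
    · rw [Measure.map_apply (measurable_positions fun k => (⟨t k, σ k⟩ : Slot M N)) hB]
      exact measure_ne_top _ _
    · simp

/-- The correlation measures of the law are given by the kernel determinants. -/
theorem corrMeasure_real_eq {α η θ : ℝ} (h : IsPoles (poles α η θ) δ) (hM : 1 ≤ M) (hMN : M ≤ N)
    {B : Matrix (Fin M) (Fin M) ℝ} (hB : B * (linkMat (poles α η θ) M N).transpose = 1) {n : ℕ}
    (t : Fin n → Time M N) {S : Set (Fin n → ℝ)} (hS : MeasurableSet S) :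
    (corrMeasure M N α η θ t).real S =
      ∫ x in S ∩ unitCube (Fin n), kerDet (poles α η θ) N B (fun k => (t k : ℤ)) x := by
  obtain ⟨hi, hpos, hc⟩ := weight_correlations h hM hMN hB
  have := isProbabilityMeasure_law hi hpos
  rw [corrMeasure_real t hS, Finset.sum_congr rfl fun σ _ =>
    law_real hi (measurableSet_positions t σ hS), ← Finset.mul_sum, hc t hS,
    inv_mul_cancel_left₀ hpos.ne']

/-- The determinant of `K_c` is the real kernel determinant. -/
theorem corrDet_eq {α η θ : ℝ} (hη : 0 < η) (hθ : 0 < θ) (h : IsPoles (poles α η θ) δ)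
    (hR : Encloses (poles α η θ) δ R M N) (hMN : M ≤ N) {B : Matrix (Fin M) (Fin M) ℝ}
    (hB : ∀ k ∈ Finset.Ico (-(M : ℤ)) 0, ∀ m : ℤ, 0 ≤ m →
      ∑ i : Fin M, ∑ j : Fin M, srcPoly (poles α η θ) M i (poles α η θ k) * B i j *
        snkPoly (poles α η θ) N j (poles α η θ m) =
        numer (poles α η θ) N (poles α η θ k) * denom (poles α η θ) M (poles α η θ m) /
          (poles α η θ k - poles α η θ m)) {n : ℕ} (t : Fin n → Time M N) {x : Fin n → ℝ}
    (hx : x ∈ cube n) :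
    corrDet M N α η θ δ R t x = (kerDet (poles α η θ) N B (fun k => (t k : ℤ)) x : ℂ) := by
  have hx' : ∀ k, x k ∈ Ioo (0 : ℝ) 1 := fun k => hx k (mem_univ k)
  have ht : ∀ k, -(M : ℤ) < t k ∧ (t k : ℤ) < N := fun k => by
    have := Finset.mem_Icc.1 (t k).2
    omega
  rw [corrDet, kerDet, ← Complex.ofRealHom_eq_coe, RingHom.map_det]
  congr 1
  ext k l
  simp only [Matrix.of_apply, RingHom.mapMatrix_apply, Matrix.map_apply, Complex.ofRealHom_eq_coe]
  exact Kc_eq hη hθ h hR hMN hB (ht k).1 (ht k).2 (ht l).1 (ht l).2 (hx' k) (hx' l)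

/-! ### Infinitesimal form of the correlation functions -/

/-- A mode jumps at `1` only. -/
theorem continuousAt_mode (k : ℤ) {r : ℝ} (hr : 0 < r) (hr1 : r ≠ 1) :
    ContinuousAt (mode lam k) r := by
  have hp : ContinuousAt (fun r : ℝ => r ^ lam k) r :=
    Real.continuousAt_rpow_const _ _ (Or.inl hr.ne')
  unfold mode
  rcases lt_or_gt_of_ne hr1 with h1 | h1
  · split_ifs
    · refine hp.neg.congr ?_
      filter_upwards [gt_mem_nhds h1] with u hu
      simp [hu.le]
    · refine (continuousAt_const (y := (0 : ℝ))).congr ?_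
      filter_upwards [gt_mem_nhds h1] with u hu
      simp [hu.le]
  · split_ifs
    · refine (continuousAt_const (y := (0 : ℝ))).congr ?_
      filter_upwards [lt_mem_nhds h1] with u hu
      simp [hu]
    · refine hp.congr ?_
      filter_upwards [lt_mem_nhds h1] with u hu
      simp [hu]

theorem continuousAt_trans (t s : ℤ) {y x : ℝ} (hx : 0 < x) (hy : 0 < y)
    (hxy : x ≠ y) : ContinuousAt (fun p : ℝ × ℝ => trans lam t p.1 s p.2) (y, x) := by
  unfold trans
  refine ContinuousAt.mul (ContinuousAt.inv₀ (by fun_prop) ?_) ?_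
  · exact (Real.sqrt_pos.2 (mul_pos hx hy)).ne'
  · refine tendsto_finsetSum _ fun k _ => ?_
    refine ContinuousAt.mul continuousAt_const ?_
    have h1 : ContinuousAt (fun p : ℝ × ℝ => p.2 / p.1) (y, x) :=
      ContinuousAt.div continuousAt_snd continuousAt_fst hy.ne'
    exact ContinuousAt.comp (f := fun p : ℝ × ℝ => p.2 / p.1) (g := mode lam k)
      (continuousAt_mode k (div_pos hx hy) (by
        intro e; exact hxy ((div_eq_one_iff_eq hy.ne').1 e))) h1

/-- The kernel is continuous off the diagonal, and also on it at equal times, where the transition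
kernel vanishes. -/
theorem continuousAt_corrKer (B : Matrix (Fin M) (Fin M) ℝ) (s t : ℤ) {x y : ℝ}
    (hx : x ∈ Ioo (0 : ℝ) 1) (hy : y ∈ Ioo (0 : ℝ) 1) (hxy : s = t ∨ x ≠ y) :
    ContinuousAt (fun p : ℝ × ℝ => corrKer lam N B s p.1 t p.2) (x, y) := by
  unfold corrKer pathKer
  refine ContinuousAt.sub (tendsto_finsetSum _ fun i _ => tendsto_finsetSum _ fun j _ =>
    ContinuousAt.mul (ContinuousAt.mul ?_ continuousAt_const) ?_) ?_
  · exact ContinuousAt.comp (f := fun p : ℝ × ℝ => ((1 : ℝ), p.1))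
      (g := fun p : ℝ × ℝ => trans lam (-M + i) p.1 s p.2) (x := (x, y))
      (continuousAt_trans _ _ hx.1 one_pos hx.2.ne) (by fun_prop)
  · exact ContinuousAt.comp (f := fun p : ℝ × ℝ => (p.2, (1 : ℝ)))
      (g := fun p : ℝ × ℝ => trans lam t p.1 (N - j) p.2) (x := (x, y))
      (continuousAt_trans _ _ one_pos hy.1 hy.2.ne') (by fun_prop)
  · rcases hxy with rfl | hxy
    · simp only [trans_eq_zero le_rfl]
      exact continuousAt_const
    · exact ContinuousAt.comp (f := fun p : ℝ × ℝ => (p.2, p.1))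
        (g := fun p : ℝ × ℝ => trans lam t p.1 s p.2) (x := (x, y))
        (continuousAt_trans _ _ hx.1 hy.1 hxy) (by fun_prop)

/-- At distinct positions the diagonal entries of the matrix are those at equal times, and its other
entries are off the diagonal. -/
theorem continuousAt_kerDet (B : Matrix (Fin M) (Fin M) ℝ) {n : ℕ}
    (t : Fin n → ℤ) {x : Fin n → ℝ} (hx : ∀ k, x k ∈ Ioo (0 : ℝ) 1) (hinj : Function.Injective x) :
    ContinuousAt (kerDet lam N B t) x := by
  have hent : ∀ k l, ContinuousAt (fun y : Fin n → ℝ => corrKer lam N B (t k) (y k) (t l) (y l)) x := by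
    intro k l
    refine ContinuousAt.comp (f := fun y : Fin n → ℝ => (y k, y l))
      (g := fun p : ℝ × ℝ => corrKer lam N B (t k) p.1 (t l) p.2) (x := x)
      (continuousAt_corrKer B _ _ (hx k) (hx l) ?_) (by fun_prop)
    by_cases hkl : k = l
    · exact Or.inl (congrArg t hkl)
    · exact Or.inr (hinj.ne hkl)
  have : kerDet lam N B t = fun y => ∑ σ : Equiv.Perm (Fin n), ((Equiv.Perm.sign σ : ℤ) : ℝ) *
      ∏ i, corrKer lam N B (t (σ i)) (y (σ i)) (t i) (y i) := by
    funext y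
    rw [kerDet, Matrix.det_apply']
    rfl
  rw [this]
  refine tendsto_finsetSum _ fun σ _ => ?_
  exact continuousAt_const.mul (tendsto_finsetProd _ fun i _ => hent _ _)

open Filter Topology

/-- The box with lower corner `x` and side length `h`. -/
def box {n : ℕ} (x : Fin n → ℝ) (h : ℝ) : Set (Fin n → ℝ) := univ.pi fun k => Ioo (x k) (x k + h)

theorem measurableSet_box {n : ℕ} (x : Fin n → ℝ) (h : ℝ) : MeasurableSet (box x h) :=
  MeasurableSet.univ_pi fun _ => measurableSet_Ioo

theorem volume_box {n : ℕ} (x : Fin n → ℝ) {h : ℝ} (hh : 0 ≤ h) :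
    volume (box x h) = ENNReal.ofReal (h ^ n) := by
  rw [box, volume_pi_pi]
  simp [ENNReal.ofReal_pow hh]

theorem box_subset_unitCube {n : ℕ} {x : Fin n → ℝ} (hx : ∀ k, x k ∈ Ioo (0 : ℝ) 1) :
    ∀ᶠ h in 𝓝[>] (0 : ℝ), box x h ⊆ unitCube (Fin n) := by
  have : ∀ k, ∀ᶠ h in 𝓝[>] (0 : ℝ), x k + h ≤ 1 := fun k => by
    filter_upwards [nhdsWithin_le_nhds (gt_mem_nhds (sub_pos.2 (hx k).2))] with h hh
    linarith
  filter_upwards [eventually_all.2 this] with h hh y hy k hk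
  have := hy k hk
  exact ⟨(hx k).1.trans this.1, this.2.trans_le (hh k)⟩

/-- The positions in `x` may coincide, where the determinant may fail to be continuous; local
boundedness suffices. -/
theorem exists_integral_box_le (h : IsPoles lam δ) (B : Matrix (Fin M) (Fin M) ℝ) {n : ℕ}
    {t : Fin n → ℤ} (ht : ∀ i, t i ∈ Finset.Icc (-(M : ℤ) + 1) (N - 1)) {x : Fin n → ℝ}
    (hx : ∀ k, x k ∈ Ioo (0 : ℝ) 1) : ∃ C : ℝ, ∀ᶠ r in 𝓝[>] (0 : ℝ),
      ∫ y in box x r ∩ unitCube (Fin n), kerDet lam N B t y ≤ C * r ^ n := by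
  -- the kernel is bounded on compact parts of the open unit square
  have hker : ∀ k l, ∃ D, ∀ r, box x r ⊆ unitCube (Fin n) → ∀ y ∈ box x r,
      |corrKer lam N B (t k) (y k) (t l) (y l)| ≤ D := by
    intro k l
    obtain ⟨D, hD0, hD⟩ := exists_abs_corrKer_le h B (ht k) (ht l)
    have hpow : ∀ (a : ℝ) (k : Fin n), ∃ C, 0 ≤ C ∧ ∀ u ∈ Ioo (x k) 1, u ^ a ≤ C := by
      intro a k
      refine ⟨1 + x k ^ a, by have := Real.rpow_nonneg (hx k).1.le a; linarith, fun u hu => ?_⟩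
      have hu0 := (hx k).1.trans hu.1
      have h2 := Real.rpow_nonneg (hx k).1.le a
      rcases le_total 0 a with ha | ha
      · have := Real.rpow_le_one hu0.le hu.2.le ha
        linarith
      · have := Real.rpow_le_rpow_of_nonpos (hx k).1 hu.1.le ha
        linarith
    obtain ⟨C1, h10, h1⟩ := hpow (-1 / 2 + (δ / (M + N + 1) - δ / (M + N + 1) * t k)) k
    obtain ⟨C2, h20, h2⟩ := hpow (-1 / 2 - -(δ / (M + N + 1) * t l)) l
    refine ⟨D * C1 * C2, fun r hr y hy => ?_⟩
    have hyc : ∀ k, y k ∈ Ioo (0 : ℝ) 1 := fun k => hr hy k (mem_univ k)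
    have hyx : ∀ k, y k ∈ Ioo (x k) 1 := fun k => ⟨(hy k (mem_univ k)).1, (hyc k).2⟩
    refine (hD _ (hyc k) _ (hyc l)).trans ?_
    have := Real.rpow_nonneg (hyc l).1.le (-1 / 2 - -(δ / (M + N + 1) * t l))
    exact mul_le_mul (mul_le_mul_of_nonneg_left (h1 _ (hyx k)) hD0) (h2 _ (hyx l)) this
      (mul_nonneg hD0 h10)
  choose D hD using hker
  obtain ⟨C, hC⟩ : ∃ C, ∀ k l, D k l ≤ C := by
    obtain ⟨C, hC⟩ := (Set.finite_range fun p : Fin n × Fin n => D p.1 p.2).bddAbove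
    exact ⟨C, fun k l => hC ⟨(k, l), rfl⟩⟩
  refine ⟨(n.factorial • C ^ n), ?_⟩
  filter_upwards [box_subset_unitCube hx, self_mem_nhdsWithin] with r hr hr0
  have hr0 : 0 < r := hr0
  rw [inter_eq_left.2 hr]
  have hbound : ∀ y ∈ box x r, ‖kerDet lam N B t y‖ ≤ n.factorial • C ^ n := by
    intro y hy
    have := Matrix.det_le (abv := (IsAbsoluteValue.toAbsoluteValue (abs : ℝ → ℝ)))
      (A := Matrix.of fun k l => corrKer lam N B (t k) (y k) (t l) (y l)) (x := C)
      fun k l => (hD k l r hr y hy).trans (hC k l)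
    rwa [Fintype.card_fin] at this
  refine (le_abs_self _).trans ((norm_setIntegral_le_of_norm_le_const
    (by rw [volume_box x hr0.le]; exact ENNReal.ofReal_lt_top) hbound).trans_eq ?_)
  rw [Measure.real, volume_box x hr0.le, ENNReal.toReal_ofReal (pow_nonneg hr0.le n)]

/-- The average of the determinant over a shrinking box tends to its value at the corner, a point of
continuity. -/
theorem tendsto_integral_box (h : IsPoles lam δ) (B : Matrix (Fin M) (Fin M) ℝ) {n : ℕ}
    {t : Fin n → ℤ} (ht : ∀ i, t i ∈ Finset.Icc (-(M : ℤ) + 1) (N - 1)) {x : Fin n → ℝ}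
    (hx : ∀ k, x k ∈ Ioo (0 : ℝ) 1) (hinj : Function.Injective x) :
    Tendsto (fun r : ℝ => (∫ y in box x r ∩ unitCube (Fin n), kerDet lam N B t y) / r ^ n)
      (𝓝[>] 0) (𝓝 (kerDet lam N B t x)) := by
  rw [Metric.tendsto_nhds]
  intro ε hε
  obtain ⟨ρ, hρ, hcont⟩ := Metric.continuousAt_iff.1 (continuousAt_kerDet (lam := lam) (N := N) B t hx hinj)
    (ε / 2) (half_pos hε)
  filter_upwards [box_subset_unitCube hx, self_mem_nhdsWithin,
    nhdsWithin_le_nhds (gt_mem_nhds hρ)] with r hr hr0 hrρ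
  have hr0 : 0 < r := hr0
  rw [inter_eq_left.2 hr]
  have hvol : volume.real (box x r) = r ^ n := by
    rw [Measure.real, volume_box x hr0.le, ENNReal.toReal_ofReal (pow_nonneg hr0.le n)]
  have hfin : volume (box x r) < ⊤ := by rw [volume_box x hr0.le]; exact ENNReal.ofReal_lt_top
  have hrn : 0 < r ^ n := pow_pos hr0 n
  have hi : IntegrableOn (kerDet lam N B t) (box x r) :=
    (integrableOn_kerDet h B ht).mono_set hr
  have hbound : ∀ y ∈ box x r, ‖kerDet lam N B t y - kerDet lam N B t x‖ ≤ ε / 2 := by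
    intro y hy
    refine (hcont ?_).le
    rw [dist_pi_lt_iff hρ]
    intro k
    have := hy k (mem_univ k)
    rw [Real.dist_eq, abs_of_pos] <;> linarith [this.1, this.2]
  have h1 := norm_setIntegral_le_of_norm_le_const hfin hbound
  rw [integral_sub hi (integrableOn_const hfin.ne), setIntegral_const, hvol, smul_eq_mul] at h1
  rw [Real.dist_eq, div_sub' hrn.ne', abs_div, abs_of_pos hrn, div_lt_iff₀ hrn]
  rw [Real.norm_eq_abs] at h1
  nlinarith

/-- A Bonferroni inequality. -/
theorem sum_sub_le_measureReal_iUnion {Ω ι : Type*} [MeasurableSpace Ω] [Fintype ι] [DecidableEq ι]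
    (μ : Measure Ω) [IsFiniteMeasure μ] {A : ι → Set Ω} (hA : ∀ i, MeasurableSet (A i)) :
    ∑ i, μ.real (A i) - ∑ i, ∑ j ∈ Finset.univ.erase i, μ.real (A i ∩ A j) ≤
      μ.real (⋃ i, A i) := by
  have hDm : ∀ i, MeasurableSet (A i \ ⋃ j ∈ Finset.univ.erase i, A j) := fun i =>
    (hA i).diff (Finset.measurableSet_biUnion _ fun j _ => hA j)
  have hdisj : Pairwise (Function.onFun Disjoint fun i => A i \ ⋃ j ∈ Finset.univ.erase i, A j) := by
    intro i j hij
    rw [Function.onFun, Set.disjoint_left]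
    rintro ω ⟨h1, -⟩ ⟨-, h2⟩
    exact h2 (mem_biUnion (Finset.mem_erase.2 ⟨hij, Finset.mem_univ i⟩) h1)
  have h1 : μ.real (⋃ i, A i \ ⋃ j ∈ Finset.univ.erase i, A j) ≤ μ.real (⋃ i, A i) :=
    measureReal_mono (iUnion_mono fun i => sdiff_subset)
  have h2 : μ.real (⋃ i, A i \ ⋃ j ∈ Finset.univ.erase i, A j) =
      ∑ i, μ.real (A i \ ⋃ j ∈ Finset.univ.erase i, A j) := by
    rw [measureReal_def, measure_iUnion hdisj hDm, tsum_fintype,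
      ENNReal.toReal_sum fun i _ => measure_ne_top _ _]
    rfl
  refine le_trans ?_ h1
  rw [h2, ← Finset.sum_sub_distrib]
  refine Finset.sum_le_sum fun i _ => ?_
  rw [sub_le_iff_le_add]
  have h3 : A i ⊆ (A i \ ⋃ j ∈ Finset.univ.erase i, A j) ∪ ⋃ j ∈ Finset.univ.erase i, A i ∩ A j := by
    intro ω hω
    by_cases hc : ω ∈ ⋃ j ∈ Finset.univ.erase i, A j
    · right
      rw [← inter_iUnion₂]
      exact ⟨hω, hc⟩
    · exact Or.inl ⟨hω, hc⟩
  refine (measureReal_mono h3).trans ((measureReal_union_le _ _).trans ?_)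
  gcongr
  exact measureReal_biUnion_finset_le _ _

/-- The event is the union over tuples `σ` of labels of the events that the particles of `σ` lie in
the box. The union bound and the Bonferroni inequality compare its probability with the `n`-point
correlation. The error consists of intersections for two tuples, which involve `n + 1` distinct
particles and so are of order `r ^ (n + 1)`. -/
theorem tendsto_prob_div_pow {α η θ : ℝ} (h : IsPoles (poles α η θ) δ) (hM : 1 ≤ M) (hMN : M ≤ N)
    {B : Matrix (Fin M) (Fin M) ℝ} (hB : B * (linkMat (poles α η θ) M N).transpose = 1) {n : ℕ}
    {t : Fin n → Time M N} (ht : Function.Injective t) {x : Fin n → ℝ}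
    (hx : ∀ k, x k ∈ Ioo (0 : ℝ) 1) (hinj : Function.Injective x) :
    Tendsto (fun r : ℝ => (law M N α η θ).real
        {X | ∀ k, ∃ i, X (t k) i ∈ Ioo (x k) (x k + r)} / r ^ n) (𝓝[>] 0)
      (𝓝 (kerDet (poles α η θ) N B (fun k => (t k : ℤ)) x)) := by
  classical
  obtain ⟨hi, hpos, -⟩ := weight_correlations h hM hMN hB
  have := isProbabilityMeasure_law hi hpos
  set P := law M N α η θ with hP
  let A : ℝ → ((k : Fin n) → Fin (numPts M N (t k))) → Set (Config M N) :=
    fun r σ => {X | (fun k => X (t k) (σ k)) ∈ box x r}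
  have hAm : ∀ r σ, MeasurableSet (A r σ) := fun r σ =>
    measurableSet_positions t σ (measurableSet_box x r)
  have hE : ∀ r, {X : Config M N | ∀ k, ∃ i, X (t k) i ∈ Ioo (x k) (x k + r)} = ⋃ σ, A r σ := by
    intro r
    ext X
    simp only [mem_ofPred_eq, mem_iUnion, A, box, mem_univ_pi]
    exact ⟨fun hX => ⟨fun k => (hX k).choose, fun k => (hX k).choose_spec⟩,
      fun ⟨σ, hσ⟩ k => ⟨σ k, hσ k⟩⟩
  -- since the times are distinct, all tuples consist of distinct particles
  have hall : particleTuples t = Finset.univ := by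
    ext σ
    simp only [mem_particleTuples, Finset.mem_univ, iff_true]
    exact fun k l e => ht (congrArg Sigma.fst e)
  have hsum : ∀ r, ∑ σ, P.real (A r σ) = ∫ y in box x r ∩ unitCube (Fin n),
      kerDet (poles α η θ) N B (fun k => (t k : ℤ)) y := by
    intro r
    rw [← corrMeasure_real_eq h hM hMN hB t (measurableSet_box x r),
      corrMeasure_real t (measurableSet_box x r), hall]
  -- two tuples differ at some time, where there are two distinct particles
  let E : ℝ → ℝ := fun r => ∑ k, ∫ y in box (Fin.cons (x k) x : Fin (n + 1) → ℝ) r ∩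
    unitCube (Fin (n + 1)), kerDet (poles α η θ) N B
      (fun l => ((Fin.cons (t k) t : Fin (n + 1) → Time M N) l : ℤ)) y
  have hEk0 : ∀ r k, 0 ≤ ∫ y in box (Fin.cons (x k) x : Fin (n + 1) → ℝ) r ∩
    unitCube (Fin (n + 1)), kerDet (poles α η θ) N B
      (fun l => ((Fin.cons (t k) t : Fin (n + 1) → Time M N) l : ℤ)) y := by
    intro r k
    rw [← corrMeasure_real_eq h hM hMN hB _ (measurableSet_box _ r)]
    exact measureReal_nonneg
  have hpair : ∀ r σ, ∀ τ ∈ Finset.univ.erase σ, P.real (A r σ ∩ A r τ) ≤ E r := by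
    intro r σ τ hτ
    obtain ⟨k, hk⟩ : ∃ k, σ k ≠ τ k := by
      by_contra hc
      push Not at hc
      exact Finset.ne_of_mem_erase hτ (funext fun k => (hc k).symm)
    refine le_trans ?_ (Finset.single_le_sum (fun k _ => hEk0 r k) (Finset.mem_univ k))
    rw [← corrMeasure_real_eq h hM hMN hB _ (measurableSet_box _ r),
      corrMeasure_real _ (measurableSet_box _ r)]
    let υ : (l : Fin (n + 1)) →
        Fin (numPts M N ((Fin.cons (t k) t : Fin (n + 1) → Time M N) l)) :=
      Fin.consEquiv (fun l => Fin (numPts M N ((Fin.cons (t k) t : Fin (n + 1) → Time M N) l)))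
        (σ k, τ)
    have hυ : υ ∈ particleTuples (Fin.cons (t k) t : Fin (n + 1) → Time M N) := by
      rw [mem_particleTuples]
      have : (fun l => (⟨(Fin.cons (t k) t : Fin (n + 1) → Time M N) l, υ l⟩ : Slot M N)) =
          Fin.cons ⟨t k, σ k⟩ fun l => ⟨t l, τ l⟩ := by
        funext l
        refine Fin.cases rfl (fun l => rfl) l
      rw [this, Fin.cons_injective_iff]
      refine ⟨?_, fun l m e => ht (congrArg Sigma.fst e)⟩
      rintro ⟨l, hl⟩
      obtain rfl : l = k := ht (congrArg Sigma.fst hl)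
      exact hk (by simpa using hl.symm)
    refine le_trans (measureReal_mono fun X hX => ?_) (Finset.single_le_sum
      (f := fun υ : (l : Fin (n + 1)) →
        Fin (numPts M N ((Fin.cons (t k) t : Fin (n + 1) → Time M N) l)) =>
        P.real {X : Config M N | (fun l => X ((Fin.cons (t k) t : Fin (n + 1) → Time M N) l) (υ l)) ∈
          box (Fin.cons (x k) x : Fin (n + 1) → ℝ) r}) (fun _ _ => measureReal_nonneg) hυ)
    intro l _
    refine Fin.cases ?_ (fun l => ?_) l
    · exact hX.1 k (mem_univ k)
    · exact hX.2 l (mem_univ l)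
  have hElim : Tendsto (fun r : ℝ => E r / r ^ n) (𝓝[>] 0) (𝓝 0) := by
    have hC : ∀ k, ∃ C : ℝ, ∀ᶠ r in 𝓝[>] (0 : ℝ), ∫ y in box (Fin.cons (x k) x : Fin (n + 1) → ℝ) r ∩
        unitCube (Fin (n + 1)), kerDet (poles α η θ) N B
        (fun l => ((Fin.cons (t k) t : Fin (n + 1) → Time M N) l : ℤ)) y ≤ C * r ^ (n + 1) := by
      intro k
      refine exists_integral_box_le h B (fun i => Subtype.property _) fun l => ?_
      exact Fin.cases (hx k) (fun l => hx l) l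
    choose C hC using hC
    refine tendsto_of_tendsto_of_tendsto_of_le_of_le' tendsto_const_nhds
      (h := fun r : ℝ => (∑ k, C k) * r) ?_ ?_ ?_
    · have : Tendsto (fun r : ℝ => (∑ k, C k) * r) (𝓝 0) (𝓝 ((∑ k, C k) * 0)) :=
        tendsto_id.const_mul _
      rw [mul_zero] at this
      exact this.mono_left nhdsWithin_le_nhds
    · filter_upwards [self_mem_nhdsWithin] with r hr
      exact div_nonneg (Finset.sum_nonneg fun k _ => hEk0 r k) (pow_nonneg (le_of_lt hr) n)
    · filter_upwards [eventually_all.2 hC, self_mem_nhdsWithin] with r hr hr0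
      rw [div_le_iff₀ (pow_pos hr0 n), mul_assoc, ← pow_succ', Finset.sum_mul]
      exact Finset.sum_le_sum fun k _ => hr k
  have hmain := tendsto_integral_box h B (N := N) (t := fun k => (t k : ℤ)) (fun k => (t k).2) hx hinj
  set c : ℝ := (Fintype.card ((k : Fin n) → Fin (numPts M N (t k))) : ℝ) with hc
  refine tendsto_of_tendsto_of_tendsto_of_le_of_le'
    (g := fun r : ℝ => (∫ y in box x r ∩ unitCube (Fin n),
      kerDet (poles α η θ) N B (fun k => (t k : ℤ)) y) / r ^ n - c * (c * (E r / r ^ n)))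
    ?_ hmain ?_ ?_
  · simpa using hmain.sub ((hElim.const_mul c).const_mul c)
  · filter_upwards [self_mem_nhdsWithin] with r hr
    rw [hE, ← hsum, ← mul_div_assoc, ← mul_div_assoc, ← sub_div]
    have hrn : 0 < r ^ n := pow_pos hr n
    gcongr
    refine le_trans ?_ (sum_sub_le_measureReal_iUnion P (hAm r))
    gcongr
    have hE0 : 0 ≤ E r := Finset.sum_nonneg fun k _ => hEk0 r k
    have : ∀ σ ∈ (Finset.univ : Finset ((k : Fin n) → Fin (numPts M N (t k)))),
        ∑ τ ∈ Finset.univ.erase σ, P.real (A r σ ∩ A r τ) ≤ c * E r := by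
      intro σ _
      refine (Finset.sum_le_card_nsmul _ _ _ (hpair r σ)).trans ?_
      rw [nsmul_eq_mul]
      gcongr
      rw [hc]
      exact_mod_cast Finset.card_le_univ (Finset.univ.erase σ)
    refine (Finset.sum_le_card_nsmul _ _ _ this).trans_eq ?_
    rw [nsmul_eq_mul, Finset.card_univ]
  · filter_upwards [self_mem_nhdsWithin] with r hr
    have hrn : 0 < r ^ n := pow_pos hr n
    rw [hE, ← hsum]
    gcongr
    have := measureReal_biUnion_finset_le (μ := P) Finset.univ (A r)
    simpa using this

/-! ### Shifting vertical lines -/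

theorem vertInt_eq (c : ℝ) (f : ℂ → ℂ) :
    vertInt c f = (2 * Real.pi : ℂ)⁻¹ * ∫ τ : ℝ, f (c + τ * Complex.I) := by
  rw [vertInt, integral_mul_const, mul_inv, mul_assoc]
  congr 1
  rw [mul_comm, mul_assoc, mul_inv_cancel₀ Complex.I_ne_zero, mul_one]

theorem ne_zero_of_re_ne {q : ℝ} (hq : q ≠ 0) (τ : ℝ) : (q : ℂ) + τ * Complex.I ≠ 0 := by
  intro e
  have := congrArg Complex.re e
  simp at this
  exact hq this

/-- The odd imaginary part cancels over a symmetric interval. -/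
theorem integral_inv_add_mul_I {q : ℝ} (hq : q ≠ 0) (T : ℝ) :
    ∫ τ in (-T)..T, ((q : ℂ) + τ * Complex.I)⁻¹ = ((2 * Real.arctan (T / q) : ℝ) : ℂ) := by
  have hpos : ∀ τ : ℝ, 0 < q ^ 2 + τ ^ 2 := fun τ => by positivity
  have hder : ∀ τ : ℝ, HasDerivAt (fun τ : ℝ => ((Real.arctan (τ / q) : ℝ) : ℂ) -
      ((Real.log (q ^ 2 + τ ^ 2) / 2 : ℝ) : ℂ) * Complex.I) (((q : ℂ) + τ * Complex.I)⁻¹) τ := by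
    intro τ
    have h1 : HasDerivAt (fun τ : ℝ => Real.arctan (τ / q)) (q / (q ^ 2 + τ ^ 2)) τ := by
      refine ((hasDerivAt_id' τ).div_const q).arctan.congr_deriv ?_
      have := hpos τ
      field_simp
    have h2 : HasDerivAt (fun τ : ℝ => Real.log (q ^ 2 + τ ^ 2) / 2) (τ / (q ^ 2 + τ ^ 2)) τ := by
      refine ((((hasDerivAt_pow 2 τ).const_add (q ^ 2)).log (hpos τ).ne').div_const 2).congr_deriv ?_
      have := hpos τ
      norm_num
      field_simp
    refine (h1.ofReal_comp.fun_sub (h2.ofReal_comp.mul_const Complex.I)).congr_deriv ?_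
    have hne : (q : ℂ) ^ 2 + (τ : ℂ) ^ 2 ≠ 0 := by exact_mod_cast (hpos τ).ne'
    have hne' := ne_zero_of_re_ne hq τ
    push_cast
    refine eq_inv_of_mul_eq_one_left ?_
    field_simp
    linear_combination -(τ : ℂ) ^ 2 * Complex.I_sq
  rw [intervalIntegral.integral_eq_sub_of_hasDerivAt (fun τ _ => hder τ)]
  · rw [neg_div, Real.arctan_neg, neg_sq]
    push_cast
    ring
  · apply Continuous.intervalIntegrable
    exact Continuous.inv₀ (by fun_prop) (ne_zero_of_re_ne hq)

/-- The principal value of the integral of `1 / z` over a vertical line. -/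
theorem tendsto_integral_inv_add_mul_I {q : ℝ} (hq : q ≠ 0) :
    Tendsto (fun T : ℝ => ∫ τ in (-T)..T, ((q : ℂ) + τ * Complex.I)⁻¹) atTop
      (𝓝 ((Real.pi * Real.sign q : ℝ) : ℂ)) := by
  simp only [integral_inv_add_mul_I hq]
  refine (Complex.continuous_ofReal.tendsto _).comp ?_
  rcases lt_or_gt_of_ne hq with h | h
  · have h1 : Tendsto (fun T : ℝ => T / q) atTop atBot := tendsto_id.atTop_div_const_of_neg h
    have h2 : Tendsto (fun T : ℝ => 2 * Real.arctan (T / q)) atTop (𝓝 (2 * -(Real.pi / 2))) :=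
      ((Real.tendsto_arctan_atBot.mono_right nhdsWithin_le_nhds).comp h1).const_mul 2
    rw [Real.sign_of_neg h, show Real.pi * -1 = 2 * -(Real.pi / 2) by ring]
    exact h2
  · have h1 : Tendsto (fun T : ℝ => T / q) atTop atTop := tendsto_id.atTop_div_const h
    have h2 : Tendsto (fun T : ℝ => 2 * Real.arctan (T / q)) atTop (𝓝 (2 * (Real.pi / 2))) :=
      ((Real.tendsto_arctan_atTop.mono_right nhdsWithin_le_nhds).comp h1).const_mul 2
    rw [Real.sign_of_pos h, show Real.pi * 1 = 2 * (Real.pi / 2) by ring]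
    exact h2

/-- Cauchy's theorem for a vertical strip. -/
theorem tendsto_integral_sub_of_strip {f : ℂ → ℂ} {a c : ℝ}
    (hf : DifferentiableOn ℂ f {z | z.re ∈ uIcc a c}) {b : ℝ → ℝ} (hb : Tendsto b atTop (𝓝 0))
    (hfb : ∀ z : ℂ, z.re ∈ uIcc a c → 0 < |z.im| → ‖f z‖ ≤ b |z.im|) :
    Tendsto (fun T : ℝ => (∫ τ in (-T)..T, f (c + τ * Complex.I)) -
      ∫ τ in (-T)..T, f (a + τ * Complex.I)) atTop (𝓝 0) := by
  have hlim : Tendsto (fun T : ℝ => 2 * (b T * |c - a|)) atTop (𝓝 0) := by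
    have := (hb.mul_const |c - a|).const_mul 2
    simpa using this
  refine squeeze_zero_norm' ?_ hlim
  filter_upwards [eventually_gt_atTop 0] with T hT
  have h := Complex.integral_boundary_rect_eq_zero_of_differentiableOn f
    (a - T * Complex.I) (c + T * Complex.I) (hf.mono fun z hz => by
      have := hz.1
      simpa using this)
  simp only [Complex.sub_re, Complex.add_re, Complex.ofReal_re, Complex.mul_re, Complex.I_re,
    mul_zero, Complex.ofReal_im, Complex.I_im, mul_one, sub_zero, add_zero, Complex.sub_im,
    Complex.mul_im, zero_sub, Complex.add_im, zero_add, smul_eq_mul, sub_self] at h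
  have hbd : ∀ u : ℝ, |u| = T → ‖∫ x in a..c, f (x + u * Complex.I)‖ ≤ b T * |c - a| := by
    intro u hu
    refine intervalIntegral.norm_integral_le_of_norm_le_const fun x hx => ?_
    have := hfb (x + u * Complex.I) (by simpa using uIoc_subset_uIcc hx) (by simpa [hu] using hT)
    simpa [hu] using this
  have h1 := hbd T (abs_of_pos hT)
  have h2 := hbd (-T) (by rw [abs_neg, abs_of_pos hT])
  have e : Complex.I * ((∫ τ in (-T)..T, f (c + τ * Complex.I)) -
      ∫ τ in (-T)..T, f (a + τ * Complex.I)) =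
      (∫ x in a..c, f (x + T * Complex.I)) - ∫ x in a..c, f (x + (-T : ℝ) * Complex.I) := by
    linear_combination h
  have e2 := congrArg norm e
  rw [norm_mul, Complex.norm_I, one_mul] at e2
  rw [e2]
  exact (norm_sub_le _ _).trans (by linarith)

/-- Moving a vertical line across a simple pole with residue `w`, where `g` is the integrand less
its polar part. Cauchy's theorem applies to `g`, and the polar part contributes principal values. -/
theorem vertInt_sub_vertInt_aux {h g : ℂ → ℂ} {a c p C : ℝ} {w : ℂ} (ha : a ≠ p) (hc : c ≠ p)
    (hg : DifferentiableOn ℂ g {z | z.re ∈ uIcc a c})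
    (hgh : ∀ z : ℂ, z ≠ p → g z = (h z - w) / (z - p))
    (hC : ∀ z : ℂ, z.re ∈ uIcc a c → ‖h z‖ ≤ C)
    (hia : Integrable fun τ : ℝ => h (a + τ * Complex.I) / (a + τ * Complex.I - p))
    (hic : Integrable fun τ : ℝ => h (c + τ * Complex.I) / (c + τ * Complex.I - p)) :
    vertInt c (fun z => h z / (z - p)) - vertInt a (fun z => h z / (z - p)) =
      w * ((Real.sign (c - p) - Real.sign (a - p)) / 2 : ℝ) := by
  have hstrip := tendsto_integral_sub_of_strip (b := fun T => (C + ‖w‖) * T⁻¹) hg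
    (by simpa using tendsto_inv_atTop_zero.const_mul (C + ‖w‖)) (by
      intro z hz him
      have hzp : z ≠ p := by
        rintro rfl
        simp at him
      have him' : |z.im| ≤ ‖z - p‖ := by
        have := Complex.abs_im_le_norm (z - p)
        simpa using this
      rw [hgh z hzp, norm_div, div_eq_mul_inv]
      have h1 : ‖h z - w‖ ≤ C + ‖w‖ := (norm_sub_le _ _).trans (by linarith [hC z hz])
      have h2 : ‖z - p‖⁻¹ ≤ |z.im|⁻¹ := inv_anti₀ him him'
      exact mul_le_mul h1 h2 (by positivity) ((norm_nonneg _).trans h1))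
  have hline : ∀ q : ℝ, q ≠ p →
      Integrable (fun τ : ℝ => h (q + τ * Complex.I) / (q + τ * Complex.I - p)) →
      Tendsto (fun T : ℝ => ∫ τ in (-T)..T, g (q + τ * Complex.I)) atTop
        (𝓝 ((∫ τ : ℝ, h (q + τ * Complex.I) / (q + τ * Complex.I - p)) -
          w * ((Real.pi * Real.sign (q - p) : ℝ) : ℂ))) := by
    intro q hq hi
    have hne : ∀ τ : ℝ, (q : ℂ) + τ * Complex.I ≠ p := fun τ e => by
      have := congrArg Complex.re e
      simp at this
      exact hq this
    have hq' : q - p ≠ 0 := sub_ne_zero.2 hq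
    have e : ∀ T : ℝ, ∫ τ in (-T)..T, g (q + τ * Complex.I) =
        (∫ τ in (-T)..T, h (q + τ * Complex.I) / (q + τ * Complex.I - p)) -
          w * ∫ τ in (-T)..T, (((q - p : ℝ) : ℂ) + τ * Complex.I)⁻¹ := by
      intro T
      rw [← intervalIntegral.integral_const_mul, ← intervalIntegral.integral_sub
        hi.intervalIntegrable]
      · refine intervalIntegral.integral_congr fun τ _ => ?_
        rw [hgh _ (hne τ), sub_div, div_eq_mul_inv w]
        congr 3
        push_cast
        ring
      · apply Continuous.intervalIntegrable
        exact continuous_const.mul (Continuous.inv₀ (by fun_prop) (ne_zero_of_re_ne hq'))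
    simp only [e]
    exact (intervalIntegral_tendsto_integral hi tendsto_neg_atTop_atBot tendsto_id).sub
      ((tendsto_integral_inv_add_mul_I hq').const_mul w)
  have huniq := tendsto_nhds_unique hstrip ((hline c hc hic).sub (hline a ha hia))
  rw [vertInt_eq, vertInt_eq, ← mul_sub]
  have hpi : (Real.pi : ℂ) ≠ 0 := by exact_mod_cast Real.pi_ne_zero
  rw [inv_mul_eq_iff_eq_mul₀ (by simp)]
  push_cast at huniq ⊢
  linear_combination -huniq

/-- Moving a vertical line across a simple pole. -/
theorem vertInt_sub_vertInt {h : ℂ → ℂ} {a c p C : ℝ} (ha : a ≠ p) (hc : c ≠ p)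
    (hh : DifferentiableOn ℂ h {z | z.re ∈ uIcc a c})
    (hC : ∀ z : ℂ, z.re ∈ uIcc a c → ‖h z‖ ≤ C)
    (hia : Integrable fun τ : ℝ => h (a + τ * Complex.I) / (a + τ * Complex.I - p))
    (hic : Integrable fun τ : ℝ => h (c + τ * Complex.I) / (c + τ * Complex.I - p)) :
    vertInt c (fun z => h z / (z - p)) - vertInt a (fun z => h z / (z - p)) =
      h p * ((Real.sign (c - p) - Real.sign (a - p)) / 2 : ℝ) := by
  by_cases hp : p ∈ uIcc a c
  · refine vertInt_sub_vertInt_aux (g := dslope h p) ha hc ?_ (fun z hz => ?_) hC hia hic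
    · rw [Complex.differentiableOn_dslope]
      · exact hh
      · have h1 : uIcc a c ∈ 𝓝 p := by
          rcases le_total a c with hac | hac
          · rw [uIcc_of_le hac] at hp ⊢
            exact Icc_mem_nhds (lt_of_le_of_ne hp.1 ha) (lt_of_le_of_ne hp.2 hc.symm)
          · rw [uIcc_of_ge hac] at hp ⊢
            exact Icc_mem_nhds (lt_of_le_of_ne hp.1 hc) (lt_of_le_of_ne hp.2 ha.symm)
        exact Complex.continuous_re.continuousAt.preimage_mem_nhds (by simpa using h1)
    · rw [dslope_of_ne _ hz, slope_def_field]
  · have hsign : Real.sign (c - p) = Real.sign (a - p) := by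
      rcases le_total a c with hac | hac
      · rw [uIcc_of_le hac, mem_Icc, not_and_or, not_le, not_le] at hp
        rcases hp with hp | hp
        · rw [Real.sign_of_pos, Real.sign_of_pos] <;> linarith
        · rw [Real.sign_of_neg, Real.sign_of_neg] <;> linarith
      · rw [uIcc_of_ge hac, mem_Icc, not_and_or, not_le, not_le] at hp
        rcases hp with hp | hp
        · rw [Real.sign_of_pos, Real.sign_of_pos] <;> linarith
        · rw [Real.sign_of_neg, Real.sign_of_neg] <;> linarith
    rw [vertInt_sub_vertInt_aux (g := fun z => (h z - 0) / (z - p)) (w := 0) ha hc ?_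
      (fun z _ => rfl) hC hia hic, hsign]
    · simp
    · refine DifferentiableOn.div (by simpa using hh) (by fun_prop) fun z hz e => hp ?_
      rw [sub_eq_zero.1 e] at hz
      simpa using hz

theorem vertInt_finsetSum {S : Finset ℤ} {c : ℝ} {f : ℤ → ℂ → ℂ}
    (hf : ∀ k ∈ S, Integrable fun τ : ℝ => f k (c + τ * Complex.I)) :
    vertInt c (fun z => ∑ k ∈ S, f k z) = ∑ k ∈ S, vertInt c (f k) := by
  simp only [vertInt_eq]
  rw [integral_finsetSum _ hf, Finset.mul_sum]

theorem integrable_div_sub {h : ℂ → ℂ} {c p : ℝ} (hc : c ≠ p)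
    (hi : Integrable fun τ : ℝ => h (c + τ * Complex.I)) :
    Integrable fun τ : ℝ => h (c + τ * Complex.I) / (c + τ * Complex.I - p) := by
  have hc' : c - p ≠ 0 := sub_ne_zero.2 hc
  have hpos : 0 < |c - p| := abs_pos.2 hc'
  have e : ∀ τ : ℝ, (c : ℂ) + τ * Complex.I - p = ((c - p : ℝ) : ℂ) + τ * Complex.I := fun τ => by
    push_cast; ring
  simp only [e, div_eq_inv_mul]
  refine hi.bdd_mul (c := |c - p|⁻¹) ?_ (ae_of_all _ fun τ => ?_)
  · exact (Continuous.inv₀ (by fun_prop) (ne_zero_of_re_ne hc')).aestronglyMeasurable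
  · rw [norm_inv]
    refine inv_anti₀ hpos ?_
    have := Complex.abs_re_le_norm (((c - p : ℝ) : ℂ) + τ * Complex.I)
    simpa using this

/-- Moving a vertical line across several simple poles. -/
theorem vertInt_sub_vertInt_sum {h : ℂ → ℂ} {a c C : ℝ} {S : Finset ℤ} {p : ℤ → ℝ} (b : ℤ → ℂ)
    (ha : ∀ k ∈ S, a ≠ p k) (hc : ∀ k ∈ S, c ≠ p k)
    (hh : DifferentiableOn ℂ h {z | z.re ∈ uIcc a c})
    (hC : ∀ z : ℂ, z.re ∈ uIcc a c → ‖h z‖ ≤ C)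
    (hia : Integrable fun τ : ℝ => h (a + τ * Complex.I))
    (hic : Integrable fun τ : ℝ => h (c + τ * Complex.I)) :
    vertInt c (fun z => h z * ∑ k ∈ S, b k / (z - p k)) -
        vertInt a (fun z => h z * ∑ k ∈ S, b k / (z - p k)) =
      ∑ k ∈ S, b k * h (p k) * ((Real.sign (c - p k) - Real.sign (a - p k)) / 2 : ℝ) := by
  have e : ∀ z, h z * ∑ k ∈ S, b k / (z - p k) = ∑ k ∈ S, b k * (h z / (z - p k)) := by
    intro z
    rw [Finset.mul_sum]
    exact Finset.sum_congr rfl fun k _ => by ring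
  have hsum : ∀ q : ℝ, (∀ k ∈ S, q ≠ p k) → (Integrable fun τ : ℝ => h (q + τ * Complex.I)) →
      vertInt q (fun z => h z * ∑ k ∈ S, b k / (z - p k)) =
        ∑ k ∈ S, b k * vertInt q (fun z => h z / (z - p k)) := by
    intro q hq hi
    simp only [e]
    rw [vertInt_finsetSum fun k hk => (integrable_div_sub (hq k hk) hi).const_mul (b k)]
    refine Finset.sum_congr rfl fun k _ => ?_
    rw [vertInt_eq, vertInt_eq, integral_const_mul, mul_left_comm]
  rw [hsum c hc hic, hsum a ha hia, ← Finset.sum_sub_distrib]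
  refine Finset.sum_congr rfl fun k hk => ?_
  rw [← mul_sub, vertInt_sub_vertInt (ha k hk) (hc k hk) hh hC (integrable_div_sub (ha k hk) hia)
    (integrable_div_sub (hc k hk) hic), mul_assoc]

/-! ### Gaussian regularization -/

/-- The function `exp (ε z² + L z)`. -/
def gaussExp (ε L : ℝ) (z : ℂ) : ℂ := Complex.exp (ε * z ^ 2 + L * z)

theorem differentiable_gaussExp (ε L : ℝ) : Differentiable ℂ (gaussExp ε L) := by
  unfold gaussExp
  fun_prop

theorem norm_gaussExp (ε L c τ : ℝ) :
    ‖gaussExp ε L (c + τ * Complex.I)‖ = Real.exp (ε * c ^ 2 + L * c) * Real.exp (-ε * τ ^ 2) := by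
  rw [gaussExp, Complex.norm_exp, ← Real.exp_add]
  congr 1
  simp [pow_two]
  ring

theorem gaussExp_coe (ε L p : ℝ) : gaussExp ε L p = (Real.exp (ε * p ^ 2 + L * p) : ℂ) := by
  rw [gaussExp]
  push_cast
  rfl

/-- Half of the Gaussian factor absorbs polynomial growth at the price of a power of `1 / ε`. -/
theorem one_add_abs_pow_mul_exp_le (K : ℕ) {ε : ℝ} (hε : 0 < ε) (hε1 : ε ≤ 1) (τ : ℝ) :
    (1 + |τ|) ^ K * Real.exp (-ε * τ ^ 2) ≤
      (K.factorial * Real.exp 2) * (1 / ε) ^ K * Real.exp (-(ε / 2) * τ ^ 2) := by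
  have h1 := Real.pow_div_factorial_le_exp (ε * (1 + |τ|)) (by positivity) K
  rw [div_le_iff₀ (by positivity), mul_pow] at h1
  have h2 : (1 + |τ|) ^ K ≤ (1 / ε) ^ K * (Real.exp (ε * (1 + |τ|)) * K.factorial) := by
    rw [one_div, inv_pow, ← div_eq_inv_mul, le_div_iff₀' (pow_pos hε K)]
    exact h1
  have h3 : Real.exp (ε * (1 + |τ|)) * Real.exp (-ε * τ ^ 2) ≤
      Real.exp 2 * Real.exp (-(ε / 2) * τ ^ 2) := by
    rw [← Real.exp_add, ← Real.exp_add, Real.exp_le_exp]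
    have := sq_abs τ
    nlinarith [sq_nonneg (|τ| - 1)]
  calc (1 + |τ|) ^ K * Real.exp (-ε * τ ^ 2)
      ≤ ((1 / ε) ^ K * (Real.exp (ε * (1 + |τ|)) * K.factorial)) * Real.exp (-ε * τ ^ 2) := by
        gcongr
    _ = (1 / ε) ^ K * K.factorial * (Real.exp (ε * (1 + |τ|)) * Real.exp (-ε * τ ^ 2)) := by ring
    _ ≤ (1 / ε) ^ K * K.factorial * (Real.exp 2 * Real.exp (-(ε / 2) * τ ^ 2)) := by gcongr
    _ = _ := by ring

theorem integrable_exp_half {ε : ℝ} (hε : 0 < ε) :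
    Integrable fun τ : ℝ => Real.exp (-(ε / 2) * τ ^ 2) :=
  integrable_exp_neg_mul_sq (half_pos hε)

theorem integral_exp_half_le {ε : ℝ} (hε : 0 < ε) (hε1 : ε ≤ 1) :
    ∫ τ : ℝ, Real.exp (-(ε / 2) * τ ^ 2) ≤ 3 * (1 / ε) := by
  rw [integral_gaussian]
  refine Real.sqrt_le_iff.2 ⟨by positivity, ?_⟩
  have h4 := Real.pi_lt_four
  rw [div_le_iff₀ (half_pos hε)]
  have h1 : 1 ≤ 1 / ε := (one_le_div hε).2 hε1
  have h2 : ε * (1 / ε) = 1 := by field_simp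
  nlinarith

/-- A bound on a vertical line for a polynomially bounded function with the Gaussian factor. -/
theorem norm_gaussExp_mul_le {ε : ℝ} (hε : 0 < ε) (hε1 : ε ≤ 1) (L c τ : ℝ) {Q : ℂ} {C : ℝ}
    (hC : 0 ≤ C) {K : ℕ} (hQ : ‖Q‖ ≤ C * (1 + ‖(c : ℂ) + τ * Complex.I‖) ^ K) :
    ‖gaussExp ε L (c + τ * Complex.I) * Q‖ ≤ Real.exp (ε * c ^ 2 + L * c) * (C * (1 + |c|) ^ K) *
      ((K.factorial * Real.exp 2) * (1 / ε) ^ K) * Real.exp (-(ε / 2) * τ ^ 2) := by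
  have h1 : 1 + ‖(c : ℂ) + τ * Complex.I‖ ≤ (1 + |c|) * (1 + |τ|) := by
    have : ‖(c : ℂ) + τ * Complex.I‖ ≤ |c| + |τ| := by
      refine (norm_add_le _ _).trans ?_
      simp
    nlinarith [mul_nonneg (abs_nonneg c) (abs_nonneg τ)]
  have h2 : ‖Q‖ ≤ C * ((1 + |c|) ^ K * (1 + |τ|) ^ K) := by
    rw [← mul_pow]
    exact hQ.trans (by gcongr)
  rw [norm_mul, norm_gaussExp]
  calc Real.exp (ε * c ^ 2 + L * c) * Real.exp (-ε * τ ^ 2) * ‖Q‖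
      ≤ Real.exp (ε * c ^ 2 + L * c) * Real.exp (-ε * τ ^ 2) *
          (C * ((1 + |c|) ^ K * (1 + |τ|) ^ K)) := by gcongr
    _ = Real.exp (ε * c ^ 2 + L * c) * (C * (1 + |c|) ^ K) *
          ((1 + |τ|) ^ K * Real.exp (-ε * τ ^ 2)) := by ring
    _ ≤ Real.exp (ε * c ^ 2 + L * c) * (C * (1 + |c|) ^ K) *
          ((K.factorial * Real.exp 2) * (1 / ε) ^ K * Real.exp (-(ε / 2) * τ ^ 2)) := by
        exact mul_le_mul_of_nonneg_left (one_add_abs_pow_mul_exp_le K hε hε1 τ) (by positivity)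
    _ = _ := by ring

theorem continuous_line {Q : ℂ → ℂ} {s : Set ℝ} (hQ : DifferentiableOn ℂ Q {z | z.re ∈ s}) {c : ℝ}
    (hc : c ∈ s) : Continuous fun τ : ℝ => Q (c + τ * Complex.I) :=
  hQ.continuousOn.comp_continuous (by fun_prop) fun τ => by simpa using hc

theorem integrable_gaussExp_mul {ε : ℝ} (hε : 0 < ε) (hε1 : ε ≤ 1) (L : ℝ) {c : ℝ} {Q : ℂ → ℂ}
    {C : ℝ} (hC : 0 ≤ C) {K : ℕ} (hcont : Continuous fun τ : ℝ => Q (c + τ * Complex.I))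
    (hQ : ∀ τ : ℝ, ‖Q (c + τ * Complex.I)‖ ≤ C * (1 + ‖(c : ℂ) + τ * Complex.I‖) ^ K) :
    Integrable fun τ : ℝ => gaussExp ε L (c + τ * Complex.I) * Q (c + τ * Complex.I) := by
  refine ((integrable_exp_half hε).const_mul _).mono' ?_ (ae_of_all _ fun τ =>
    norm_gaussExp_mul_le hε hε1 L c τ hC (hQ τ))
  exact (((differentiable_gaussExp ε L).continuous.comp (by fun_prop)).mul hcont).aestronglyMeasurable

theorem norm_sum_div_le {S : Finset ℤ} (b : ℤ → ℂ) {p : ℤ → ℝ} {c r : ℝ} (hr : 0 < r)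
    (hc : ∀ k ∈ S, r ≤ |c - p k|) (τ : ℝ) :
    ‖∑ k ∈ S, b k / ((c : ℂ) + τ * Complex.I - p k)‖ ≤ (∑ k ∈ S, ‖b k‖) / r := by
  rw [Finset.sum_div]
  refine norm_sum_le_of_le S fun k hk => ?_
  rw [norm_div]
  have h1 : r ≤ ‖(c : ℂ) + τ * Complex.I - p k‖ := by
    have := Complex.abs_re_le_norm ((c : ℂ) + τ * Complex.I - p k)
    simp only [Complex.sub_re, Complex.add_re, Complex.ofReal_re, Complex.mul_re, Complex.I_re,
      mul_zero, Complex.ofReal_im, Complex.I_im, mul_one, sub_self, add_zero] at this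
    exact (hc k hk).trans this
  gcongr

/-- With the Gaussian factor, a polynomially bounded function is bounded in vertical strips. -/
theorem exists_norm_gaussExp_mul_le {ε : ℝ} (hε : 0 < ε) (hε1 : ε ≤ 1) (L : ℝ) {a c C : ℝ}
    {Q : ℂ → ℂ} (hC : 0 ≤ C) {K : ℕ} (hQC : ∀ z : ℂ, z.re ∈ uIcc a c → ‖Q z‖ ≤ C * (1 + ‖z‖) ^ K) :
    ∃ D, ∀ z : ℂ, z.re ∈ uIcc a c → ‖gaussExp ε L z * Q z‖ ≤ D := by
  set X := max |a| |c| with hX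
  refine ⟨Real.exp (ε * X ^ 2 + |L| * X) * (C * (1 + X) ^ K) *
    ((K.factorial * Real.exp 2) * (1 / ε) ^ K), fun z hz => ?_⟩
  have hzX : |z.re| ≤ X := by
    have := abs_le_max_abs_abs (a := min a c) (b := z.re) (c := max a c) hz.1 hz.2
    refine this.trans (max_le ?_ ?_)
    · rcases min_choice a c with h | h <;> rw [h]
      exacts [le_max_left _ _, le_max_right _ _]
    · rcases max_choice a c with h | h <;> rw [h]
      exacts [le_max_left _ _, le_max_right _ _]
  have hX0 : 0 ≤ X := (abs_nonneg _).trans hzX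
  have h0 := norm_gaussExp_mul_le hε hε1 L z.re z.im hC (Q := Q z) (K := K) (by
    rw [Complex.re_add_im]; exact hQC z hz)
  rw [Complex.re_add_im] at h0
  refine h0.trans ?_
  have h1 : Real.exp (-(ε / 2) * z.im ^ 2) ≤ 1 := by
    rw [Real.exp_le_one_iff]
    have : 0 ≤ ε / 2 * z.im ^ 2 := by positivity
    linarith
  have h2 : z.re ^ 2 ≤ X ^ 2 := by
    rw [← sq_abs z.re]; gcongr
  have h3 : L * z.re ≤ |L| * X := by
    refine (le_abs_self _).trans ?_
    rw [abs_mul]; gcongr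
  calc _ ≤ Real.exp (ε * X ^ 2 + |L| * X) * (C * (1 + X) ^ K) *
      ((K.factorial * Real.exp 2) * (1 / ε) ^ K) * 1 := by gcongr
    _ = _ := mul_one _

/-- The saddle point of `ε z² + L z` is `-L / (2 ε)`. Moving the line of integration there, one
picks up the residues and an exponentially small remainder. -/
theorem exists_norm_vertInt_sub_le (S : Finset ℤ) (b : ℤ → ℂ) (p : ℤ → ℝ) (K : ℕ) (L : ℝ) :
    ∃ Γ : ℝ, 0 ≤ Γ ∧ ∀ ε : ℝ, 0 < ε → ε ≤ 1 → ∀ (Q : ℂ → ℂ) (C a c : ℝ), c = -L / (2 * ε) → 0 ≤ C →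
      (∀ k ∈ S, a ≠ p k) → (∀ k ∈ S, 1 ≤ |c - p k|) →
      DifferentiableOn ℂ Q {z | z.re ∈ uIcc a c} →
      (∀ z : ℂ, z.re ∈ uIcc a c → ‖Q z‖ ≤ C * (1 + ‖z‖) ^ K) →
      ‖vertInt a (fun z => gaussExp ε L z * Q z * ∑ k ∈ S, b k / (z - p k)) -
        ∑ k ∈ S, b k * (gaussExp ε L (p k) * Q (p k)) *
          ((Real.sign (a - p k) - Real.sign (c - p k)) / 2 : ℝ)‖ ≤
        Γ * C * ((1 / ε) ^ (2 * K + 1) * Real.exp (-(L ^ 2 / 4) / ε)) := by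
  refine ⟨3 * ((1 + |L|) ^ K * (K.factorial * Real.exp 2) * ∑ k ∈ S, ‖b k‖), by positivity,
    fun ε hε hε1 Q C a c hc hC ha hcp hQ hQC => ?_⟩
  have hcp' : ∀ k ∈ S, c ≠ p k := by
    intro k hk e
    have := hcp k hk
    rw [e, sub_self, abs_zero] at this
    linarith
  have hline : ∀ q ∈ uIcc a c, Integrable fun τ : ℝ =>
      gaussExp ε L (q + τ * Complex.I) * Q (q + τ * Complex.I) := fun q hq =>
    integrable_gaussExp_mul hε hε1 L hC (continuous_line hQ hq) fun τ => hQC _ (by simpa using hq)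
  obtain ⟨D, hD⟩ := exists_norm_gaussExp_mul_le hε hε1 L hC hQC
  have hshift := vertInt_sub_vertInt_sum (h := fun z => gaussExp ε L z * Q z) b ha hcp'
    ((differentiable_gaussExp ε L).differentiableOn.mul hQ) hD (hline a left_mem_uIcc)
    (hline c right_mem_uIcc)
  have e1 : vertInt a (fun z => gaussExp ε L z * Q z * ∑ k ∈ S, b k / (z - p k)) -
        ∑ k ∈ S, b k * (gaussExp ε L (p k) * Q (p k)) *
          ((Real.sign (a - p k) - Real.sign (c - p k)) / 2 : ℝ) =
      vertInt c (fun z => gaussExp ε L z * Q z * ∑ k ∈ S, b k / (z - p k)) := by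
    rw [sub_eq_iff_eq_add, ← sub_eq_iff_eq_add', ← neg_sub, hshift, ← Finset.sum_neg_distrib]
    refine Finset.sum_congr rfl fun k _ => ?_
    rw [← mul_neg, ← Complex.ofReal_neg]
    congr 2
    ring
  rw [e1, vertInt_eq]
  -- at the saddle point the exponential factor is `exp (-L² / (4 ε))`
  have hexp : Real.exp (ε * c ^ 2 + L * c) = Real.exp (-(L ^ 2 / 4) / ε) := by
    congr 1
    rw [hc]
    field_simp
    ring
  have hc1 : 1 + |c| ≤ (1 + |L|) * (1 / ε) := by
    have h1 : 1 ≤ 1 / ε := (one_le_div hε).2 hε1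
    have h2 : |c| ≤ |L| * (1 / ε) := by
      rw [hc, abs_div, abs_neg, abs_of_pos (by positivity : 0 < 2 * ε), mul_one_div]
      gcongr
      linarith
    linarith
  have hbound : ∀ τ : ℝ, ‖gaussExp ε L (c + τ * Complex.I) * Q (c + τ * Complex.I) *
      ∑ k ∈ S, b k / ((c : ℂ) + τ * Complex.I - p k)‖ ≤
      Real.exp (-(L ^ 2 / 4) / ε) * (C * ((1 + |L|) * (1 / ε)) ^ K) *
      ((K.factorial * Real.exp 2) * (1 / ε) ^ K) * (∑ k ∈ S, ‖b k‖) *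
        Real.exp (-(ε / 2) * τ ^ 2) := by
    intro τ
    have h1 := norm_gaussExp_mul_le hε hε1 L c τ hC (Q := Q (c + τ * Complex.I)) (K := K)
      (hQC _ (by simp))
    have h2 := norm_sum_div_le b one_pos hcp τ
    rw [div_one] at h2
    rw [norm_mul]
    rw [hexp] at h1
    calc _ ≤ (Real.exp (-(L ^ 2 / 4) / ε) * (C * (1 + |c|) ^ K) *
          ((K.factorial * Real.exp 2) * (1 / ε) ^ K) * Real.exp (-(ε / 2) * τ ^ 2)) *
          ∑ k ∈ S, ‖b k‖ := by gcongr
      _ ≤ (Real.exp (-(L ^ 2 / 4) / ε) * (C * ((1 + |L|) * (1 / ε)) ^ K) *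
          ((K.factorial * Real.exp 2) * (1 / ε) ^ K) * Real.exp (-(ε / 2) * τ ^ 2)) *
          ∑ k ∈ S, ‖b k‖ := by gcongr
      _ = _ := by ring
  have h3 := norm_integral_le_of_norm_le ((integrable_exp_half hε).const_mul _)
    (ae_of_all _ hbound)
  rw [integral_const_mul] at h3
  have h4 : ‖((2 * Real.pi : ℂ))⁻¹‖ ≤ 1 := by
    rw [norm_inv]
    refine inv_le_one_of_one_le₀ ?_
    rw [norm_mul, Complex.norm_real, Real.norm_eq_abs, abs_of_pos Real.pi_pos, Complex.norm_ofNat]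
    linarith [Real.pi_gt_three]
  rw [norm_mul]
  calc _ ≤ 1 * (Real.exp (-(L ^ 2 / 4) / ε) * (C * ((1 + |L|) * (1 / ε)) ^ K) *
      ((K.factorial * Real.exp 2) * (1 / ε) ^ K) * (∑ k ∈ S, ‖b k‖) * (3 * (1 / ε))) := by
        refine mul_le_mul h4 (h3.trans ?_) (norm_nonneg _) zero_le_one
        exact mul_le_mul_of_nonneg_left (integral_exp_half_le hε hε1) (by positivity)
    _ = _ := by rw [mul_pow]; ring

/-- Powers of `1 / ε` are negligible against the exponential factor gained at the saddle point. -/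
theorem tendsto_pow_mul_exp_neg_div (J : ℕ) {b : ℝ} (hb : 0 < b) :
    Tendsto (fun ε : ℝ => (1 / ε) ^ J * Real.exp (-b / ε)) (𝓝[>] 0) (𝓝 0) := by
  have h1 : Tendsto (fun ε : ℝ => b * ε⁻¹) (𝓝[>] 0) atTop :=
    tendsto_inv_nhdsGT_zero.const_mul_atTop hb
  have h2 := ((Real.tendsto_pow_mul_exp_neg_atTop_nhds_zero J).comp h1).const_mul (b⁻¹ ^ J)
  rw [mul_zero] at h2
  refine h2.congr fun ε => ?_
  simp only [Function.comp]
  rw [mul_pow, ← mul_assoc, ← mul_assoc, ← mul_pow, inv_mul_cancel₀ hb.ne', one_pow, one_mul,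
    one_div, neg_div, div_eq_mul_inv]

theorem tendsto_gaussExp (L p : ℝ) :
    Tendsto (fun ε : ℝ => gaussExp ε L p) (𝓝[>] 0) (𝓝 (gaussExp 0 L p)) := by
  have : Continuous fun ε : ℝ => gaussExp ε L p := by
    unfold gaussExp
    fun_prop
  exact (this.tendsto 0).mono_left nhdsWithin_le_nhds

/-- As `ε → 0` the saddle point `-L / (2 ε)` leaves all poles behind, on the side where `exp (L z)`
decays. -/
theorem eventually_saddle (S : Finset ℤ) (p : ℤ → ℝ) (a : ℝ) {L : ℝ} (hL : L ≠ 0) :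
    ∀ᶠ ε in 𝓝[>] (0 : ℝ), 0 < ε ∧ ε ≤ 1 ∧ (∀ k ∈ S, 1 ≤ |-L / (2 * ε) - p k|) ∧
      (∀ k ∈ S, Real.sign (-L / (2 * ε) - p k) = -Real.sign L) ∧
      ∀ u ∈ uIcc a (-L / (2 * ε)), 0 ≤ L * (a - u) := by
  have hε1 : ∀ᶠ ε in 𝓝[>] (0 : ℝ), ε ≤ 1 := by
    filter_upwards [nhdsWithin_le_nhds (gt_mem_nhds one_pos)] with ε h using le_of_lt h
  have hform : ∀ ε : ℝ, -L / (2 * ε) = (-L / 2) * ε⁻¹ := fun ε => by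
    rw [div_mul_eq_div_div, div_eq_mul_inv]
  rcases lt_or_gt_of_ne hL with h | h
  · have hlim : Tendsto (fun ε : ℝ => -L / (2 * ε)) (𝓝[>] 0) atTop := by
      simp only [hform]
      exact tendsto_inv_nhdsGT_zero.const_mul_atTop (by linarith)
    have h1 : ∀ᶠ ε in 𝓝[>] (0 : ℝ), ∀ k ∈ S, p k + 1 ≤ -L / (2 * ε) :=
      (Filter.eventually_all_finset S).2 fun k _ => hlim.eventually_ge_atTop _
    filter_upwards [h1, hε1, self_mem_nhdsWithin, hlim.eventually_ge_atTop a] with ε h1 h2 h3 h4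
    refine ⟨h3, h2, fun k hk => ?_, fun k hk => ?_, fun u hu => ?_⟩
    · have := h1 k hk
      rw [abs_of_nonneg] <;> linarith
    · have := h1 k hk
      rw [Real.sign_of_pos (by linarith), Real.sign_of_neg h, neg_neg]
    · rw [uIcc_of_le h4] at hu
      exact mul_nonneg_of_nonpos_of_nonpos h.le (by linarith [hu.1])
  · have hlim : Tendsto (fun ε : ℝ => -L / (2 * ε)) (𝓝[>] 0) atBot := by
      simp only [hform]
      exact tendsto_inv_nhdsGT_zero.const_mul_atTop_of_neg (by linarith)
    have h1 : ∀ᶠ ε in 𝓝[>] (0 : ℝ), ∀ k ∈ S, -L / (2 * ε) ≤ p k - 1 :=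
      (Filter.eventually_all_finset S).2 fun k _ => hlim.eventually_le_atBot _
    filter_upwards [h1, hε1, self_mem_nhdsWithin, hlim.eventually_le_atBot a] with ε h1 h2 h3 h4
    refine ⟨h3, h2, fun k hk => ?_, fun k hk => ?_, fun u hu => ?_⟩
    · have := h1 k hk
      rw [abs_of_nonpos] <;> linarith
    · have := h1 k hk
      rw [Real.sign_of_neg (by linarith), Real.sign_of_pos h]
    · rw [uIcc_of_ge h4] at hu
      exact mul_nonneg h.le (by linarith [hu.2])

/-- As `ε → 0`, the regularized integral over a vertical line tends to the sum of the residues on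
the side where `exp (L z)` decays. -/
theorem tendsto_vertInt {S : Finset ℤ} (b : ℤ → ℂ) {p : ℤ → ℝ} {K : ℕ} {L a C : ℝ} (hL : L ≠ 0)
    {Q : ℂ → ℂ} (hC : 0 ≤ C) (ha : ∀ k ∈ S, a ≠ p k)
    (hQ : DifferentiableOn ℂ Q {z | 0 ≤ L * (a - z.re)})
    (hQC : ∀ z : ℂ, 0 ≤ L * (a - z.re) → ‖Q z‖ ≤ C * (1 + ‖z‖) ^ K) :
    Tendsto (fun ε : ℝ => vertInt a (fun z => gaussExp ε L z * Q z * ∑ k ∈ S, b k / (z - p k)))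
      (𝓝[>] 0) (𝓝 (∑ k ∈ S, b k * (gaussExp 0 L (p k) * Q (p k)) *
        ((Real.sign (a - p k) + Real.sign L) / 2 : ℝ))) := by
  obtain ⟨Γ, hΓ, hbd⟩ := exists_norm_vertInt_sub_le S b p K L
  have hmain : Tendsto (fun ε : ℝ => ∑ k ∈ S, b k * (gaussExp ε L (p k) * Q (p k)) *
        ((Real.sign (a - p k) + Real.sign L) / 2 : ℝ)) (𝓝[>] 0)
      (𝓝 (∑ k ∈ S, b k * (gaussExp 0 L (p k) * Q (p k)) *
        ((Real.sign (a - p k) + Real.sign L) / 2 : ℝ))) :=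
    tendsto_finsetSum _ fun k _ =>
      (((tendsto_gaussExp L (p k)).mul_const _).const_mul _).mul_const _
  have hsmall : Tendsto (fun ε : ℝ =>
      Γ * C * ((1 / ε) ^ (2 * K + 1) * Real.exp (-(L ^ 2 / 4) / ε))) (𝓝[>] 0) (𝓝 0) := by
    have := (tendsto_pow_mul_exp_neg_div (2 * K + 1) (b := L ^ 2 / 4)
      (by positivity)).const_mul (Γ * C)
    rwa [mul_zero] at this
  have hdiff : Tendsto (fun ε : ℝ =>
      vertInt a (fun z => gaussExp ε L z * Q z * ∑ k ∈ S, b k / (z - p k)) -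
        ∑ k ∈ S, b k * (gaussExp ε L (p k) * Q (p k)) *
        ((Real.sign (a - p k) + Real.sign L) / 2 : ℝ)) (𝓝[>] 0) (𝓝 0) := by
    refine squeeze_zero_norm' ?_ hsmall
    filter_upwards [eventually_saddle S p a hL] with ε ⟨h1, h2, h3, h4, h5⟩
    have := hbd ε h1 h2 Q C a _ rfl hC ha h3 (hQ.mono fun z hz => h5 _ hz)
      fun z hz => hQC z (h5 _ hz)
    refine le_trans (le_of_eq ?_) this
    congr 2
    refine Finset.sum_congr rfl fun k hk => ?_
    rw [h4 k hk, sub_neg_eq_add]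
  have := hdiff.add hmain
  simpa using this

theorem sign_sub_of_neg (h : IsPoles lam δ) {a : ℝ} (ha : -δ ≤ a ∧ a ≤ δ) {k : ℤ} (hk : k < 0) :
    Real.sign (a - lam k) = -1 :=
  Real.sign_of_neg (by linarith [h.lt_of_neg hk, ha.2])

theorem sign_sub_of_nonneg (h : IsPoles lam δ) {a : ℝ} (ha : -δ ≤ a ∧ a ≤ δ) {k : ℤ} (hk : 0 ≤ k) :
    Real.sign (a - lam k) = 1 :=
  Real.sign_of_pos (by linarith [h.lt_of_nonneg hk, ha.1])

theorem ne_of_abs_le (h : IsPoles lam δ) {a : ℝ} (ha : -δ ≤ a ∧ a ≤ δ) (k : ℤ) : a ≠ lam k := by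
  rcases lt_or_ge k 0 with hk | hk
  · have h' : a < lam k := by linarith [h.lt_of_neg hk, ha.2]
    exact h'.ne
  · have h' : lam k < a := by linarith [h.lt_of_nonneg hk, ha.1]
    exact h'.ne'

theorem gaussExp_zero_log {r : ℝ} (hr : 0 < r) (p : ℝ) :
    gaussExp 0 (Real.log r) p = ((r ^ p : ℝ) : ℂ) := by
  rw [gaussExp_coe, Real.rpow_def_of_pos hr, zero_mul, zero_add]

theorem cpow_eq_exp_log {r : ℝ} (hr : 0 < r) (z : ℂ) :
    (r : ℂ) ^ z = Complex.exp (Real.log r * z) := by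
  rw [Complex.cpow_def_of_ne_zero (by exact_mod_cast hr.ne'), Complex.ofReal_log hr.le]

/-! ### The single integral -/

/-- Off the diagonal the regularized single integral tends to the sum of modes: the line is moved to
the right if `r < 1` and to the left if `r > 1`. -/
theorem tendsto_vertInt_single (h : IsPoles lam δ) (t s : ℤ) {r : ℝ} (hr : 0 < r) (hr1 : r ≠ 1) :
    Tendsto (fun ε : ℝ => vertInt δ (fun z => gaussExp ε (Real.log r) z * 1 *
      ∑ k ∈ Finset.Ico t s, (coef lam t s k : ℂ) / (z - lam k))) (𝓝[>] 0)
      (𝓝 (∑ k ∈ Finset.Ico t s, (coef lam t s k : ℂ) * (mode lam k r : ℂ))) := by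
  have hδ := h.pos
  have hδ' : -δ ≤ δ ∧ δ ≤ δ := ⟨by linarith, le_rfl⟩
  have hL : Real.log r ≠ 0 := Real.log_ne_zero_of_pos_of_ne_one hr hr1
  have := tendsto_vertInt (S := Finset.Ico t s) (fun k => (coef lam t s k : ℂ)) (p := lam) (K := 0)
    (a := δ) (C := 1) hL (Q := fun _ => 1) zero_le_one (fun k _ => ne_of_abs_le h hδ' k)
    (differentiableOn_const _) (by simp)
  convert this using 2
  refine Finset.sum_congr rfl fun k _ => ?_
  rw [gaussExp_zero_log hr, mul_one, mul_assoc]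
  congr 1
  rw [← Complex.ofReal_mul, mode]
  congr 1
  rcases lt_or_gt_of_ne hr1 with h1 | h1
  · rw [Real.sign_of_neg (Real.log_neg hr h1)]
    split_ifs with hk hk'
    · rw [sign_sub_of_neg h hδ' hk]; ring
    · exact absurd h1.le hk'
    · exact absurd h1 (by linarith)
    · rw [sign_sub_of_nonneg h hδ' (not_lt.1 hk)]; ring
  · rw [Real.sign_of_pos (Real.log_pos h1)]
    split_ifs with hk hk'
    · exact absurd h1 (by linarith)
    · rw [sign_sub_of_neg h hδ' hk]; ring
    · rw [sign_sub_of_nonneg h hδ' (not_lt.1 hk)]; ring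

theorem integrable_inv_sq_add_sq {u : ℝ} (hu : 0 < u) :
    Integrable (fun τ : ℝ => (u ^ 2 + τ ^ 2)⁻¹) ∧ ∫ τ : ℝ, (u ^ 2 + τ ^ 2)⁻¹ = Real.pi / u := by
  have e : ∀ τ : ℝ, (u ^ 2 + τ ^ 2)⁻¹ = (u ^ 2)⁻¹ * (1 + (τ / u) ^ 2)⁻¹ := by
    intro τ
    have : 0 < u ^ 2 + τ ^ 2 := by positivity
    field_simp
  simp only [e]
  refine ⟨(integrable_inv_one_add_sq.comp_div hu.ne').const_mul _, ?_⟩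
  rw [integral_const_mul, Measure.integral_comp_div (fun x : ℝ => (1 + x ^ 2)⁻¹) u,
    integral_univ_inv_one_add_sq, abs_of_pos hu, smul_eq_mul]
  field_simp

/-- At equal positions the exponential factor is trivial, and the integrals converge since the
integrand decays quadratically. -/
theorem tendsto_vertInt_single_one (h : IsPoles lam δ) {t s : ℤ} (hts : t + 2 ≤ s) :
    Tendsto (fun ε : ℝ => vertInt δ (fun z => gaussExp ε 0 z * 1 *
      ∑ k ∈ Finset.Ico t s, (coef lam t s k : ℂ) / (z - lam k))) (𝓝[>] 0)
      (𝓝 (∑ k ∈ Finset.Ico t s, (coef lam t s k : ℂ) * (mode lam k 1 : ℂ))) := by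
  have hδ := h.pos
  have hδ' : -δ ≤ δ ∧ δ ≤ δ := ⟨by linarith, le_rfl⟩
  have hmode : ∀ k, (mode lam k 1 : ℂ) =
      gaussExp 0 0 (lam k) * ((Real.sign (δ - lam k) - 1) / 2 : ℝ) := by
    intro k
    rw [gaussExp_coe, ← Complex.ofReal_mul]
    congr 1
    rcases lt_or_ge k 0 with hk | hk
    · rw [sign_sub_of_neg h hδ' hk]
      norm_num [mode, hk]
    · rw [sign_sub_of_nonneg h hδ' hk]
      norm_num [mode, not_lt.2 hk]
  have hmain : Tendsto (fun ε : ℝ => ∑ k ∈ Finset.Ico t s, (coef lam t s k : ℂ) *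
      (gaussExp ε 0 (lam k) * ((Real.sign (δ - lam k) - 1) / 2 : ℝ))) (𝓝[>] 0)
      (𝓝 (∑ k ∈ Finset.Ico t s, (coef lam t s k : ℂ) * (mode lam k 1 : ℂ))) := by
    simp only [hmode]
    exact tendsto_finsetSum _ fun k _ => ((tendsto_gaussExp 0 (lam k)).mul_const _).const_mul _
  -- the line is moved to the abscissa `2 u = ε ^ (-1/2)`
  have hu : Tendsto (fun ε : ℝ => (√ε)⁻¹ / 2) (𝓝[>] 0) atTop := by
    refine Tendsto.atTop_div_const two_pos (tendsto_inv_nhdsGT_zero.comp ?_)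
    refine tendsto_nhdsWithin_iff.2 ⟨?_, ?_⟩
    · have := (Real.continuous_sqrt.tendsto 0).mono_left (nhdsWithin_le_nhds (s := Ioi 0))
      rwa [Real.sqrt_zero] at this
    · filter_upwards [self_mem_nhdsWithin] with ε hε using Real.sqrt_pos.2 hε
  have hsmall : Tendsto (fun ε : ℝ => Real.exp 1 * (Real.pi / ((√ε)⁻¹ / 2))) (𝓝[>] 0) (𝓝 0) := by
    have := (hu.const_div_atTop Real.pi).const_mul (Real.exp 1)
    rwa [mul_zero] at this
  have hdiff : Tendsto (fun ε : ℝ => vertInt δ (fun z => gaussExp ε 0 z * 1 *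
      ∑ k ∈ Finset.Ico t s, (coef lam t s k : ℂ) / (z - lam k)) -
      ∑ k ∈ Finset.Ico t s, (coef lam t s k : ℂ) *
      (gaussExp ε 0 (lam k) * ((Real.sign (δ - lam k) - 1) / 2 : ℝ))) (𝓝[>] 0) (𝓝 0) := by
    refine squeeze_zero_norm' ?_ hsmall
    have hε1 : ∀ᶠ ε in 𝓝[>] (0 : ℝ), ε ≤ 1 := by
      filter_upwards [nhdsWithin_le_nhds (gt_mem_nhds one_pos)] with ε h using le_of_lt h
    have hbig : ∀ᶠ ε in 𝓝[>] (0 : ℝ), ∀ k ∈ Finset.Ico t s, |lam k| ≤ (√ε)⁻¹ / 2 :=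
      (Filter.eventually_all_finset _).2 fun k _ => hu.eventually_ge_atTop _
    filter_upwards [self_mem_nhdsWithin, hε1, hbig, hu.eventually_ge_atTop 1] with ε hε hε1 hbig hu1
    have hε : 0 < ε := hε
    set u := (√ε)⁻¹ / 2 with hu_def
    have hu0 : 0 < u := by linarith
    have hεu : ε * (2 * u) ^ 2 = 1 := by
      rw [hu_def]
      have := Real.sq_sqrt hε.le
      have h2 := (Real.sqrt_pos.2 hε).ne'
      field_simp
      rw [this]
    have hdist : ∀ k ∈ Finset.Ico t s, u ≤ 2 * u - lam k := fun k hk => by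
      have := (le_abs_self _).trans (hbig k hk)
      linarith
    have hne : ∀ k ∈ Finset.Ico t s, 2 * u ≠ lam k := fun k hk e => by
      have := hdist k hk
      linarith
    have hQ : ∀ z : ℂ, ‖(1 : ℂ)‖ ≤ 1 * (1 + ‖z‖) ^ 0 := fun z => by simp
    obtain ⟨D, hD⟩ := exists_norm_gaussExp_mul_le (a := δ) (c := 2 * u) hε hε1 0 zero_le_one
      (Q := fun _ => 1) fun z _ => hQ z
    have hshift := vertInt_sub_vertInt_sum (h := fun z => gaussExp ε 0 z * 1) (S := Finset.Ico t s)
      (fun k => (coef lam t s k : ℂ)) (p := lam) (fun k _ => ne_of_abs_le h hδ' k) hne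
      ((differentiable_gaussExp ε 0).mul_const 1).differentiableOn hD
      (integrable_gaussExp_mul hε hε1 0 zero_le_one (Q := fun _ => 1) continuous_const fun _ => hQ _)
      (integrable_gaussExp_mul hε hε1 0 zero_le_one (Q := fun _ => 1) continuous_const fun _ => hQ _)
    have e1 : vertInt δ (fun z => gaussExp ε 0 z * 1 *
        ∑ k ∈ Finset.Ico t s, (coef lam t s k : ℂ) / (z - lam k)) -
        ∑ k ∈ Finset.Ico t s, (coef lam t s k : ℂ) *
        (gaussExp ε 0 (lam k) * ((Real.sign (δ - lam k) - 1) / 2 : ℝ)) =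
        vertInt ((2 * u : ℝ)) (fun z => gaussExp ε 0 z * 1 *
          ∑ k ∈ Finset.Ico t s, (coef lam t s k : ℂ) / (z - lam k)) := by
      rw [sub_eq_iff_eq_add, ← sub_eq_iff_eq_add', ← neg_sub, hshift, ← Finset.sum_neg_distrib]
      refine Finset.sum_congr rfl fun k hk => ?_
      rw [Real.sign_of_pos (show 0 < 2 * u - lam k by linarith [hdist k hk]), mul_one, mul_assoc,
        ← mul_neg, ← mul_neg, ← Complex.ofReal_neg]
      congr 3
      ring
    rw [e1, vertInt_eq]
    have hbound : ∀ τ : ℝ, ‖gaussExp ε 0 ((2 * u : ℝ) + τ * Complex.I) * 1 *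
        ∑ k ∈ Finset.Ico t s, (coef lam t s k : ℂ) / (((2 * u : ℝ) : ℂ) + τ * Complex.I - lam k)‖ ≤
        Real.exp 1 * (u ^ 2 + τ ^ 2)⁻¹ := by
      intro τ
      set z : ℂ := ((2 * u : ℝ) : ℂ) + τ * Complex.I with hz
      have hzk : ∀ k ∈ Finset.Ico t s, z ≠ lam k := by
        intro k hk e
        have := congrArg Complex.re e
        simp [hz] at this
        exact hne k hk this
      rw [← prod_step_eq_sum h (by omega) hzk, norm_mul, mul_one, hz, norm_gaussExp, ← hz,
        zero_mul, add_zero, hεu, norm_prod]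
      set w := √(u ^ 2 + τ ^ 2) with hw
      have hw2 : w ^ 2 = u ^ 2 + τ ^ 2 := Real.sq_sqrt (by positivity)
      have hw1 : 1 ≤ w := by
        rw [hw, Real.one_le_sqrt]
        nlinarith [sq_nonneg τ]
      have hfac : ∀ k ∈ Finset.Ico t s, ‖(stepSign k : ℂ) / (z - lam k)‖ ≤ w⁻¹ := by
        intro k hk
        have h1 : ‖(stepSign k : ℂ)‖ = 1 := by
          unfold stepSign; split_ifs <;> simp
        rw [norm_div, h1, one_div]
        refine inv_anti₀ (by linarith) ?_
        rw [hw, Complex.norm_def, Complex.normSq_apply]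
        apply Real.sqrt_le_sqrt
        have h2 := hdist k hk
        have e1 : (z - lam k).re = 2 * u - lam k := by simp [hz]
        have e2 : (z - lam k).im = τ := by simp [hz]
        rw [e1, e2]
        nlinarith
      have hprod : ∏ k ∈ Finset.Ico t s, ‖(stepSign k : ℂ) / (z - lam k)‖ ≤ (u ^ 2 + τ ^ 2)⁻¹ := by
        refine (Finset.prod_le_prod (fun _ _ => norm_nonneg _) hfac).trans ?_
        rw [← hw2, ← inv_pow, Finset.prod_const]
        refine pow_le_pow_of_le_one (by positivity) (inv_le_one_of_one_le₀ hw1) ?_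
        rw [Int.card_Ico]
        omega
      have hexp : Real.exp (-ε * τ ^ 2) ≤ 1 := by
        rw [Real.exp_le_one_iff]
        nlinarith [sq_nonneg τ]
      calc Real.exp 1 * Real.exp (-ε * τ ^ 2) * ∏ k ∈ Finset.Ico t s, ‖(stepSign k : ℂ) / (z - lam k)‖
          ≤ Real.exp 1 * 1 * (u ^ 2 + τ ^ 2)⁻¹ := by gcongr
        _ = _ := by rw [mul_one]
    obtain ⟨hi, hint⟩ := integrable_inv_sq_add_sq hu0
    have h3 := norm_integral_le_of_norm_le (hi.const_mul (Real.exp 1)) (ae_of_all _ hbound)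
    rw [integral_const_mul, hint] at h3
    have h4 : ‖((2 * Real.pi : ℂ))⁻¹‖ ≤ 1 := by
      rw [norm_inv]
      refine inv_le_one_of_one_le₀ ?_
      rw [norm_mul, Complex.norm_real, Real.norm_eq_abs, abs_of_pos Real.pi_pos, Complex.norm_ofNat]
      linarith [Real.pi_gt_three]
    rw [norm_mul]
    calc _ ≤ 1 * (Real.exp 1 * (Real.pi / u)) := mul_le_mul h4 h3 (norm_nonneg _) zero_le_one
      _ = _ := one_mul _
  have := hdiff.add hmain
  simpa using this

/-! ### The double integral over vertical lines -/

/-- Products of linear factors grow polynomially. -/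
theorem exists_norm_prod_le (S : Finset ℤ) (lam : ℤ → ℝ) :
    ∃ (C : ℝ) (K : ℕ), 0 ≤ C ∧ ∀ z : ℂ, ‖∏ j ∈ S, (z - lam j)‖ ≤ C * (1 + ‖z‖) ^ K := by
  refine ⟨∏ j ∈ S, (1 + |lam j|), S.card, Finset.prod_nonneg fun _ _ => by positivity,
    fun z => ?_⟩
  rw [norm_prod, ← Finset.prod_const, ← Finset.prod_mul_distrib]
  refine Finset.prod_le_prod (fun _ _ => norm_nonneg _) fun j _ => ?_
  have h1 := norm_sub_le z (lam j)
  rw [Complex.norm_real, Real.norm_eq_abs] at h1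
  nlinarith [norm_nonneg z, abs_nonneg (lam j)]

theorem exists_norm_numerC_le (lam : ℤ → ℝ) (N : ℕ) :
    ∃ (C : ℝ) (K : ℕ), 0 ≤ C ∧ ∀ z : ℂ, ‖numerC lam N z‖ ≤ C * (1 + ‖z‖) ^ K :=
  exists_norm_prod_le _ lam

theorem exists_norm_denomC_le (lam : ℤ → ℝ) (M : ℕ) :
    ∃ (C : ℝ) (K : ℕ), 0 ≤ C ∧ ∀ z : ℂ, ‖denomC lam M z‖ ≤ C * (1 + ‖z‖) ^ K := by
  obtain ⟨C, K, hC, h⟩ := exists_norm_prod_le (Finset.Ico (-(M : ℤ)) 0) lam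
  refine ⟨C, K, hC, fun z => le_trans (le_of_eq ?_) (h z)⟩
  rw [denomC, norm_prod, norm_prod]
  exact Finset.prod_congr rfl fun j _ => norm_sub_rev _ _

theorem norm_div_le_of_le_re {a w : ℂ} {r B : ℝ} (hr : 0 < r) (ha : ‖a‖ ≤ B) (hw : r ≤ |w.re|) :
    ‖a / w‖ ≤ B / r := by
  rw [norm_div]
  have h1 := hw.trans (Complex.abs_re_le_norm w)
  have h2 := (norm_nonneg a).trans ha
  gcongr

theorem norm_vertInt_le {c D : ℝ} {f : ℂ → ℂ} {g : ℝ → ℝ} (hg : Integrable g)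
    (hfg : ∀ τ : ℝ, ‖f (c + τ * Complex.I)‖ ≤ g τ) (hD : ∫ τ, g τ ≤ D) : ‖vertInt c f‖ ≤ D := by
  have h3 := (norm_integral_le_of_norm_le hg (ae_of_all _ hfg)).trans hD
  have h4 : ‖((2 * Real.pi : ℂ))⁻¹‖ ≤ 1 := by
    rw [norm_inv]
    refine inv_le_one_of_one_le₀ ?_
    rw [norm_mul, Complex.norm_real, Real.norm_eq_abs, abs_of_pos Real.pi_pos, Complex.norm_ofNat]
    linarith [Real.pi_gt_three]
  rw [vertInt_eq, norm_mul]
  calc _ ≤ 1 * D := mul_le_mul h4 h3 (norm_nonneg _) zero_le_one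
    _ = _ := one_mul _

theorem vertInt_const_mul (c : ℝ) (w : ℂ) (f : ℂ → ℂ) :
    vertInt c (fun z => w * f z) = w * vertInt c f := by
  rw [vertInt_eq, vertInt_eq, integral_const_mul]
  ring

theorem integrable_mul_sum_div {h : ℂ → ℂ} {c : ℝ} {S : Finset ℤ} {p : ℤ → ℝ} (b : ℤ → ℂ)
    (hc : ∀ k ∈ S, c ≠ p k) (hi : Integrable fun τ : ℝ => h (c + τ * Complex.I)) :
    Integrable fun τ : ℝ => h (c + τ * Complex.I) * ∑ k ∈ S, b k / (c + τ * Complex.I - p k) := by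
  have e : ∀ τ : ℝ, h (c + τ * Complex.I) * ∑ k ∈ S, b k / (c + τ * Complex.I - p k) =
      ∑ k ∈ S, b k * (h (c + τ * Complex.I) / (c + τ * Complex.I - p k)) := by
    intro τ
    rw [Finset.mul_sum]
    exact Finset.sum_congr rfl fun k _ => by ring
  simp only [e]
  exact integrable_finsetSum _ fun k hk => (integrable_div_sub (hc k hk) hi).const_mul _

/-- The integrand of the inner integral. -/
def innerFun (lam : ℤ → ℝ) (M N : ℕ) (t : ℤ) (L ε : ℝ) (ζ ω : ℂ) : ℂ :=
  gaussExp ε L ω * (denomC lam M ω / (ζ - ω)) *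
    ∑ m ∈ Finset.Ico t (N : ℤ), (coef lam t N m : ℂ) / (ω - lam m)

/-- The residues of `innerFun` at the poles to the left of the line. -/
def innerRes (lam : ℤ → ℝ) (M N : ℕ) (t : ℤ) (L ε : ℝ) (ζ : ℂ) : ℂ :=
  ∑ m ∈ Finset.Ico t (N : ℤ) with 0 ≤ m, (coef lam t N m : ℂ) *
    (gaussExp ε L (lam m) * (denomC lam M (lam m) / (ζ - lam m)))

/-- The saddle point estimate for the inner integral is uniform in `ζ`, since `ω` moves to the left,
away from the line of `ζ`, where `ζ - ω` stays at distance `2 δ` or more from zero. -/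
theorem exists_norm_inner_sub_le (h : IsPoles lam δ) (M N : ℕ) (t : ℤ) {L : ℝ} (hL : 0 < L) :
    ∃ (Γ : ℝ) (J : ℕ), 0 ≤ Γ ∧ ∀ᶠ ε in 𝓝[>] (0 : ℝ), ∀ ζ : ℂ, ζ.re = δ →
      ‖vertInt (-δ) (innerFun lam M N t L ε ζ) - innerRes lam M N t L ε ζ‖ ≤
        Γ * ((1 / ε) ^ J * Real.exp (-(L ^ 2 / 4) / ε)) := by
  have hδ := h.pos
  have hδ' : -δ ≤ -δ ∧ -δ ≤ δ := ⟨le_rfl, by linarith⟩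
  obtain ⟨C, K, hC, hCb⟩ := exists_norm_denomC_le lam M
  obtain ⟨Γ, hΓ, hbd⟩ := exists_norm_vertInt_sub_le (Finset.Ico t (N : ℤ))
    (fun m => (coef lam t N m : ℂ)) lam K L
  refine ⟨Γ * (C / (2 * δ)), 2 * K + 1, by positivity, ?_⟩
  filter_upwards [eventually_saddle (Finset.Ico t (N : ℤ)) lam (-δ) hL.ne'] with
    ε ⟨h1, h2, h3, h4, h5⟩ ζ hζ
  have hre : ∀ ω : ℂ, ω.re ∈ uIcc (-δ) (-L / (2 * ε)) → 2 * δ ≤ (ζ - ω).re := by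
    intro ω hω
    have := nonneg_of_mul_nonneg_right (h5 _ hω) hL
    rw [Complex.sub_re, hζ]
    linarith
  have := hbd ε h1 h2 (fun ω => denomC lam M ω / (ζ - ω)) (C / (2 * δ)) (-δ) _ rfl (by positivity)
    (fun k _ => ne_of_abs_le h hδ' k) h3 ?_ ?_
  · refine le_trans (le_of_eq ?_) this
    congr 2
    rw [innerRes, Finset.sum_filter]
    refine Finset.sum_congr rfl fun m hm => ?_
    rw [h4 m hm, Real.sign_of_pos hL]
    split_ifs with hm0
    · rw [sign_sub_of_nonneg h hδ' hm0]
      norm_num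
    · rw [sign_sub_of_neg h hδ' (not_le.1 hm0)]
      norm_num
  · refine DifferentiableOn.div differentiable_denomC.differentiableOn (by fun_prop) fun ω hω e => ?_
    have := hre ω hω
    rw [e, Complex.zero_re] at this
    linarith
  · intro ω hω
    have := hre ω hω
    rw [div_mul_eq_mul_div]
    exact norm_div_le_of_le_re (by positivity) (hCb ω) (this.trans (le_abs_self _))

/-- The inner integral depends measurably on the outer variable. -/
theorem measurable_vertInt_inner (h : IsPoles lam δ) (M N : ℕ) (t : ℤ) (L ε : ℝ) :
    StronglyMeasurable fun τ : ℝ =>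
      vertInt (-δ) (innerFun lam M N t L ε ((δ : ℂ) + τ * Complex.I)) := by
  have hδ := h.pos
  have hδ' : -δ ≤ -δ ∧ -δ ≤ δ := ⟨le_rfl, by linarith⟩
  simp only [vertInt_eq]
  refine StronglyMeasurable.const_mul ?_ _
  have hc : Continuous fun q : ℝ × ℝ => innerFun lam M N t L ε ((δ : ℂ) + q.1 * Complex.I)
      (((-δ : ℝ) : ℂ) + q.2 * Complex.I) := by
    unfold innerFun
    have hl : Continuous fun q : ℝ × ℝ => (((-δ : ℝ) : ℂ) + q.2 * Complex.I) := by fun_prop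
    refine Continuous.mul (Continuous.mul ((differentiable_gaussExp ε L).continuous.comp hl)
      (Continuous.div (differentiable_denomC.continuous.comp hl) (by fun_prop) fun q e => ?_))
      (continuous_finsetSum _ fun m _ => Continuous.div continuous_const (by fun_prop) fun q e => ?_)
    · have := congrArg Complex.re e
      simp at this
      linarith
    · exact ne_poles_of_re h (by simp) (by simpa using hδ'.2) m (sub_eq_zero.1 e)
  exact hc.stronglyMeasurable.integral_prod_right'

/-- The regularized double integral over vertical lines. The inner integral is its sum of residues
up to an error which is exponentially small in `1 / ε`, uniformly in `ζ`. -/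
theorem tendsto_vertInt_double (h : IsPoles lam δ) (M N : ℕ) (s t : ℤ) {x y : ℝ}
    (hx : x ∈ Ioo (0 : ℝ) 1) (hy : y ∈ Ioo (0 : ℝ) 1) :
    Tendsto (fun ε : ℝ => vertInt δ (fun ζ => gaussExp ε (Real.log x) ζ * numerC lam N ζ *
      (∑ k ∈ Finset.Ico (-(M : ℤ)) s, (coef lam (-M) s k : ℂ) / (ζ - lam k)) *
        vertInt (-δ) (innerFun lam M N t (-Real.log y) ε ζ))) (𝓝[>] 0)
      (𝓝 (doubleValue lam M N s x t y)) := by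
  have hδ := h.pos
  have hδ' : -δ ≤ δ ∧ δ ≤ δ := ⟨by linarith, le_rfl⟩
  have hLx : Real.log x < 0 := Real.log_neg hx.1 hx.2
  have hLy : 0 < -Real.log y := neg_pos.2 (Real.log_neg hy.1 hy.2)
  set Lx := Real.log x with hLx_def
  set Ly := -Real.log y with hLy_def
  set S := Finset.Ico (-(M : ℤ)) s
  set T := Finset.Ico t (N : ℤ) with hT
  set b : ℤ → ℂ := fun k => (coef lam (-M) s k : ℂ) with hb
  set d : ℤ → ℂ := fun m => (coef lam t N m : ℂ) with hd
  obtain ⟨C, K, hC, hCb⟩ := exists_norm_numerC_le lam N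
  -- the functions multiplying the Gaussian factor in the outer integrals
  have hre : ∀ m : ℤ, 0 ≤ m → ∀ z : ℂ, δ ≤ z.re → 2 * δ ≤ (z - lam m).re := by
    intro m hm z hz
    have := h.lt_of_nonneg hm
    rw [Complex.sub_re, Complex.ofReal_re]
    linarith
  have hQd : ∀ m : ℤ, 0 ≤ m →
      DifferentiableOn ℂ (fun z => numerC lam N z / (z - lam m)) {z | δ ≤ z.re} := by
    intro m hm
    refine DifferentiableOn.div differentiable_numerC.differentiableOn (by fun_prop) fun z hz e => ?_
    have := hre m hm z hz
    rw [e, Complex.zero_re] at this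
    linarith
  have hQb : ∀ m : ℤ, 0 ≤ m → ∀ z : ℂ, δ ≤ z.re →
      ‖numerC lam N z / (z - lam m)‖ ≤ C / (2 * δ) * (1 + ‖z‖) ^ K := by
    intro m hm z hz
    rw [div_mul_eq_mul_div]
    exact norm_div_le_of_le_re (by positivity) (hCb z) ((hre m hm z hz).trans (le_abs_self _))
  have hside : ∀ z : ℂ, 0 ≤ Lx * (δ - z.re) ↔ δ ≤ z.re := by
    intro z
    constructor <;> intro hz <;> nlinarith
  -- the contribution of the residues
  have hterm : ∀ m ∈ T.filter (0 ≤ ·), Tendsto (fun ε : ℝ => vertInt δ (fun ζ =>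
      gaussExp ε Lx ζ * (numerC lam N ζ / (ζ - lam m)) * ∑ k ∈ S, b k / (ζ - lam k))) (𝓝[>] 0)
      (𝓝 (∑ k ∈ S, b k * (gaussExp 0 Lx (lam k) * (numerC lam N (lam k) / (lam k - lam m))) *
        ((Real.sign (δ - lam k) + Real.sign Lx) / 2 : ℝ))) := by
    intro m hm
    have hm0 := (Finset.mem_filter.1 hm).2
    refine tendsto_vertInt (S := S) b (K := K) (C := C / (2 * δ)) hLx.ne (by positivity)
      (fun k _ => ne_of_abs_le h hδ' k) ?_ fun z hz => hQb m hm0 z ((hside z).1 hz)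
    exact (hQd m hm0).mono fun z hz => (hside z).1 hz
  have hint : ∀ ε : ℝ, 0 < ε → ε ≤ 1 → ∀ m ∈ T.filter (0 ≤ ·), Integrable fun τ : ℝ =>
      d m * (gaussExp ε Ly (lam m) * denomC lam M (lam m)) *
      (gaussExp ε Lx (δ + τ * Complex.I) *
        (numerC lam N (δ + τ * Complex.I) / (δ + τ * Complex.I - lam m)) *
        ∑ k ∈ S, b k / (δ + τ * Complex.I - lam k)) := by
    intro ε hε hε1 m hm
    have hm0 := (Finset.mem_filter.1 hm).2
    refine Integrable.const_mul ?_ _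
    refine integrable_mul_sum_div (h := fun z => gaussExp ε Lx z * (numerC lam N z / (z - lam m))) b
      (fun k _ => ne_of_abs_le h hδ' k) ?_
    exact integrable_gaussExp_mul hε hε1 Lx (Q := fun z => numerC lam N z / (z - lam m))
      (C := C / (2 * δ)) (K := K) (by positivity)
      (continuous_line (s := Ici δ) (hQd m hm0) self_mem_Ici) fun τ => hQb m hm0 _ (by simp)
  have hsplit : ∀ (ε : ℝ) (ζ : ℂ), gaussExp ε Lx ζ * numerC lam N ζ *
      (∑ k ∈ S, b k / (ζ - lam k)) * innerRes lam M N t Ly ε ζ =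
      ∑ m ∈ T with 0 ≤ m, d m * (gaussExp ε Ly (lam m) * denomC lam M (lam m)) *
      (gaussExp ε Lx ζ * (numerC lam N ζ / (ζ - lam m)) * ∑ k ∈ S, b k / (ζ - lam k)) := by
    intro ε ζ
    rw [innerRes, Finset.mul_sum]
    refine Finset.sum_congr rfl fun m _ => ?_
    simp only [hd]
    ring
  have hres : Tendsto (fun ε : ℝ => vertInt δ (fun ζ => gaussExp ε Lx ζ * numerC lam N ζ *
      (∑ k ∈ S, b k / (ζ - lam k)) * innerRes lam M N t Ly ε ζ)) (𝓝[>] 0)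
      (𝓝 (doubleValue lam M N s x t y)) := by
    have h1 : Tendsto (fun ε : ℝ => ∑ m ∈ T with 0 ≤ m,
        d m * (gaussExp ε Ly (lam m) * denomC lam M (lam m)) * vertInt δ (fun ζ =>
        gaussExp ε Lx ζ * (numerC lam N ζ / (ζ - lam m)) * ∑ k ∈ S, b k / (ζ - lam k))) (𝓝[>] 0)
        (𝓝 (∑ m ∈ T with 0 ≤ m, d m * (gaussExp 0 Ly (lam m) * denomC lam M (lam m)) *
          ∑ k ∈ S, b k * (gaussExp 0 Lx (lam k) * (numerC lam N (lam k) / (lam k - lam m))) *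
            ((Real.sign (δ - lam k) + Real.sign Lx) / 2 : ℝ))) :=
      tendsto_finsetSum _ fun m hm =>
        (((tendsto_gaussExp Ly (lam m)).mul_const _).const_mul _).mul (hterm m hm)
    have h2 : ∑ m ∈ T with 0 ≤ m, d m * (gaussExp 0 Ly (lam m) * denomC lam M (lam m)) *
          ∑ k ∈ S, b k * (gaussExp 0 Lx (lam k) * (numerC lam N (lam k) / (lam k - lam m))) *
            ((Real.sign (δ - lam k) + Real.sign Lx) / 2 : ℝ) = doubleValue lam M N s x t y := by
      simp only [Finset.mul_sum, doubleValue]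
      rw [Finset.sum_comm]
      refine Finset.sum_congr rfl fun k _ => ?_
      split_ifs with hk
      · rw [mul_neg, Finset.sum_filter, Finset.mul_sum, ← Finset.sum_neg_distrib]
        refine Finset.sum_congr rfl fun m _ => ?_
        split_ifs with hm
        · rw [sign_sub_of_neg h hδ' hk, Real.sign_of_neg hLx, hLx_def, gaussExp_zero_log hx.1,
            hLy_def, ← Real.log_inv, gaussExp_zero_log (inv_pos.2 hy.1), Real.inv_rpow hy.1.le,
            ← Complex.ofReal_cpow hx.1.le, ← Complex.ofReal_cpow hy.1.le]
          push_cast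
          ring
        · ring
      · refine (Finset.sum_eq_zero fun m _ => ?_).trans (mul_zero _).symm
        rw [sign_sub_of_nonneg h hδ' (not_lt.1 hk), Real.sign_of_neg hLx]
        norm_num
    rw [h2] at h1
    refine h1.congr' ?_
    filter_upwards [self_mem_nhdsWithin, nhdsWithin_le_nhds (gt_mem_nhds one_pos)] with ε hε hε1
    simp only [hsplit]
    rw [vertInt_finsetSum (hint ε hε (le_of_lt hε1))]
    simp only [vertInt_const_mul]
  -- the contribution of the error
  obtain ⟨Γ, J, hΓ, herr⟩ := exists_norm_inner_sub_le h M N t hLy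
  obtain ⟨r, hr, hrS⟩ : ∃ r : ℝ, 0 < r ∧ ∀ k ∈ S, r ≤ |δ - lam k| := by
    refine ⟨min (δ - lam 0) (lam (-1) - δ), lt_min ?_ ?_, fun k _ => ?_⟩
    · linarith [h.lt_of_nonneg le_rfl]
    · linarith [h.lt_of_neg (show (-1 : ℤ) < 0 by norm_num)]
    · rcases lt_or_ge k 0 with hk | hk
      · have := h.anti.antitone (show k ≤ -1 by omega)
        exact (min_le_right _ _).trans ((by linarith : lam (-1) - δ ≤ -(δ - lam k)).trans (neg_le_abs _))
      · have := h.anti.antitone hk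
        exact (min_le_left _ _).trans ((by linarith : δ - lam 0 ≤ δ - lam k).trans (le_abs_self _))
  set C' := C * ((∑ k ∈ S, ‖b k‖) / r) with hC'_def
  have hC' : 0 ≤ C' := by positivity
  have hA : ∀ τ : ℝ, ‖numerC lam N (δ + τ * Complex.I) *
      ∑ k ∈ S, b k / ((δ : ℂ) + τ * Complex.I - lam k)‖ ≤
      C' * (1 + ‖(δ : ℂ) + τ * Complex.I‖) ^ K := by
    intro τ
    rw [norm_mul, hC'_def, mul_right_comm]
    exact mul_le_mul (hCb _) (norm_sum_div_le b hr hrS τ) (norm_nonneg _) (by positivity)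
  set D := Real.exp (δ ^ 2 + Lx * δ) * (C' * (1 + |δ|) ^ K) * (K.factorial * Real.exp 2) with hD
  have hD0 : 0 ≤ D := by positivity
  have hbound : ∀ᶠ ε in 𝓝[>] (0 : ℝ), 0 < ε ∧ ε ≤ 1 ∧ ∀ τ : ℝ,
      ‖gaussExp ε Lx (δ + τ * Complex.I) * numerC lam N (δ + τ * Complex.I) *
        (∑ k ∈ S, b k / (δ + τ * Complex.I - lam k)) *
        (vertInt (-δ) (innerFun lam M N t Ly ε (δ + τ * Complex.I)) -
          innerRes lam M N t Ly ε (δ + τ * Complex.I))‖ ≤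
      D * (1 / ε) ^ K * (Γ * ((1 / ε) ^ J * Real.exp (-(Ly ^ 2 / 4) / ε))) *
        Real.exp (-(ε / 2) * τ ^ 2) := by
    filter_upwards [self_mem_nhdsWithin, nhdsWithin_le_nhds (gt_mem_nhds one_pos), herr]
      with ε hε hε1 herr
    have hε : 0 < ε := hε
    have hε1 : ε ≤ 1 := le_of_lt hε1
    refine ⟨hε, hε1, fun τ => ?_⟩
    have h1 := norm_gaussExp_mul_le hε hε1 Lx δ τ hC' (hA τ)
    have h2 := herr ((δ : ℂ) + τ * Complex.I) (by simp)
    have h3 : Real.exp (ε * δ ^ 2 + Lx * δ) ≤ Real.exp (δ ^ 2 + Lx * δ) := by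
      rw [Real.exp_le_exp]
      nlinarith [sq_nonneg δ]
    rw [norm_mul, mul_assoc (gaussExp ε Lx _)]
    refine (mul_le_mul h1 h2 (norm_nonneg _) (by positivity)).trans ?_
    rw [hD]
    have h4 : 0 ≤ (C' * (1 + |δ|) ^ K) * ((K.factorial * Real.exp 2) * (1 / ε) ^ K) *
        Real.exp (-(ε / 2) * τ ^ 2) * (Γ * ((1 / ε) ^ J * Real.exp (-(Ly ^ 2 / 4) / ε))) := by
      positivity
    nlinarith [mul_le_mul_of_nonneg_right h3 h4]
  have hdiff : Tendsto (fun ε : ℝ => vertInt δ (fun ζ => gaussExp ε Lx ζ * numerC lam N ζ *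
      (∑ k ∈ S, b k / (ζ - lam k)) * vertInt (-δ) (innerFun lam M N t Ly ε ζ)) -
      vertInt δ (fun ζ => gaussExp ε Lx ζ * numerC lam N ζ *
      (∑ k ∈ S, b k / (ζ - lam k)) * innerRes lam M N t Ly ε ζ)) (𝓝[>] 0) (𝓝 0) := by
    have hsmall : Tendsto (fun ε : ℝ => 3 * D * Γ *
        ((1 / ε) ^ (K + J + 1) * Real.exp (-(Ly ^ 2 / 4) / ε))) (𝓝[>] 0) (𝓝 0) := by
      have := (tendsto_pow_mul_exp_neg_div (K + J + 1) (b := Ly ^ 2 / 4)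
        (by positivity)).const_mul (3 * D * Γ)
      rwa [mul_zero] at this
    refine squeeze_zero_norm' ?_ hsmall
    filter_upwards [hbound] with ε ⟨hε, hε1, hb⟩
    have hmajor := (integrable_exp_half hε).const_mul
      (D * (1 / ε) ^ K * (Γ * ((1 / ε) ^ J * Real.exp (-(Ly ^ 2 / 4) / ε))))
    have hl : Continuous fun τ : ℝ => (δ : ℂ) + τ * Complex.I := by fun_prop
    have hne : ∀ (τ : ℝ) (k : ℤ), (δ : ℂ) + τ * Complex.I - lam k ≠ 0 := fun τ k =>
      sub_ne_zero.2 (ne_poles_of_re h (by simpa using hδ'.1) (by simp) k)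
    have hAc : Continuous fun τ : ℝ => gaussExp ε Lx (δ + τ * Complex.I) *
        numerC lam N (δ + τ * Complex.I) * (∑ k ∈ S, b k / (δ + τ * Complex.I - lam k)) :=
      (((differentiable_gaussExp ε Lx).continuous.comp hl).mul
        (differentiable_numerC.continuous.comp hl)).mul
        (continuous_finsetSum _ fun k _ => Continuous.div continuous_const (by fun_prop)
          fun τ => hne τ k)
    have hWc : Continuous fun τ : ℝ => innerRes lam M N t Ly ε (δ + τ * Complex.I) := by
      unfold innerRes
      exact continuous_finsetSum _ fun m _ => continuous_const.mul (continuous_const.mul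
        (Continuous.div continuous_const (by fun_prop) fun τ => hne τ m))
    have hi : Integrable fun τ : ℝ => gaussExp ε Lx (δ + τ * Complex.I) *
        numerC lam N (δ + τ * Complex.I) * (∑ k ∈ S, b k / (δ + τ * Complex.I - lam k)) *
        (vertInt (-δ) (innerFun lam M N t Ly ε (δ + τ * Complex.I)) -
          innerRes lam M N t Ly ε (δ + τ * Complex.I)) :=
      hmajor.mono' (hAc.aestronglyMeasurable.mul
        ((measurable_vertInt_inner h M N t Ly ε).aestronglyMeasurable.sub
          hWc.aestronglyMeasurable)) (ae_of_all _ hb)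
    have hiW : Integrable fun τ : ℝ => gaussExp ε Lx (δ + τ * Complex.I) *
        numerC lam N (δ + τ * Complex.I) * (∑ k ∈ S, b k / (δ + τ * Complex.I - lam k)) *
        innerRes lam M N t Ly ε (δ + τ * Complex.I) := by
      simp only [hsplit]
      exact integrable_finsetSum _ (hint ε hε hε1)
    have hiV : Integrable fun τ : ℝ => gaussExp ε Lx (δ + τ * Complex.I) *
        numerC lam N (δ + τ * Complex.I) * (∑ k ∈ S, b k / (δ + τ * Complex.I - lam k)) *
        vertInt (-δ) (innerFun lam M N t Ly ε (δ + τ * Complex.I)) := by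
      refine (hi.add hiW).congr (ae_of_all _ fun τ => ?_)
      simp only [Pi.add_apply]
      ring
    have e1 : vertInt δ (fun ζ => gaussExp ε Lx ζ * numerC lam N ζ *
        (∑ k ∈ S, b k / (ζ - lam k)) * vertInt (-δ) (innerFun lam M N t Ly ε ζ)) -
        vertInt δ (fun ζ => gaussExp ε Lx ζ * numerC lam N ζ *
        (∑ k ∈ S, b k / (ζ - lam k)) * innerRes lam M N t Ly ε ζ) =
        vertInt δ (fun ζ => gaussExp ε Lx ζ * numerC lam N ζ * (∑ k ∈ S, b k / (ζ - lam k)) *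
          (vertInt (-δ) (innerFun lam M N t Ly ε ζ) - innerRes lam M N t Ly ε ζ)) := by
      simp only [vertInt_eq δ]
      rw [← mul_sub, ← integral_sub hiV hiW]
      simp only [mul_sub]
    rw [e1]
    refine norm_vertInt_le hmajor hb ?_
    rw [integral_const_mul]
    have h5 : 0 ≤ D * (1 / ε) ^ K * (Γ * ((1 / ε) ^ J * Real.exp (-(Ly ^ 2 / 4) / ε))) := by
      positivity
    refine (mul_le_mul_of_nonneg_left (integral_exp_half_le hε hε1) h5).trans (le_of_eq ?_)
    rw [pow_succ, pow_add]
    ring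
  have := hdiff.add hres
  simpa using this

/-! ### The kernel as a limit of integrals over vertical lines -/

theorem gaussExp_log {r : ℝ} (hr : 0 < r) (ε : ℝ) (z : ℂ) :
    gaussExp ε (Real.log r) z = Complex.exp (ε * z ^ 2) * (r : ℂ) ^ z := by
  rw [gaussExp, Complex.exp_add, cpow_eq_exp_log hr]

theorem vertInt_congr {c : ℝ} {f g : ℂ → ℂ}
    (hfg : ∀ τ : ℝ, f (c + τ * Complex.I) = g (c + τ * Complex.I)) : vertInt c f = vertInt c g := by
  simp only [vertInt, hfg]

/-- The regularized double integrand in terms of the poles, as a function of `ζ` times `innerFun`.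
-/
theorem exp_mul_doubleIntegrand {α η θ : ℝ} (hη : 0 < η) (hθ : 0 < θ) {s t : ℤ} {x y : ℝ}
    (hs : -(M : ℤ) < s) (hs' : s < N) (ht : -(M : ℤ) < t) (ht' : t < N)
    (hx : x ∈ Ioo (0 : ℝ) 1) (hy : y ∈ Ioo (0 : ℝ) 1) (h : IsPoles (poles α η θ) δ) (ε : ℝ) {ζ ω : ℂ}
    (hζ : ∀ k, ζ ≠ poles α η θ k) (hω : ∀ k, ω ≠ poles α η θ k) :
    Complex.exp (ε * (ζ ^ 2 + ω ^ 2)) * doubleIntegrand M N α η θ s x t y ζ ω =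
      gaussExp ε (Real.log x) ζ * numerC (poles α η θ) N ζ *
        (∑ k ∈ Finset.Ico (-(M : ℤ)) s, (coef (poles α η θ) (-M) s k : ℂ) /
          (ζ - poles α η θ k)) * innerFun (poles α η θ) M N t (-Real.log y) ε ζ ω := by
  have hy' : ((y⁻¹ : ℝ) : ℂ) ^ ω = ((y : ℂ) ^ ω)⁻¹ := by
    rw [cpow_eq_exp_log (inv_pos.2 hy.1), cpow_eq_exp_log hy.1, ← Complex.exp_neg, Real.log_inv]
    push_cast
    rw [neg_mul]
  rw [innerFun, ← Real.log_inv, gaussExp_log hx.1, gaussExp_log (inv_pos.2 hy.1), hy',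
    ← prod_step_eq_sum h hs (fun k _ => hζ k), ← prod_step_eq_sum h ht' (fun k _ => hω k),
    doubleIntegrand, div_eq_mul_inv (Fc M N α η θ s ζ),
    one_div_Fc_eq_mul hη hθ ht.le ht'.le (fun k _ => hω k),
    Fc_eq_mul hη hθ hs'.le (fun k _ => hζ k), mul_add, Complex.exp_add]
  ring

/-- If `x = y` and `s = t + 1`, the single integrand decays like `1 / ζ` only and the limit would be
the average of the two one-sided values; this case is excluded. -/
theorem tendsto_KcVert {α η θ : ℝ} (hη : 0 < η) (hθ : 0 < θ) (h : IsPoles (poles α η θ) δ)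
    (hR : Encloses (poles α η θ) δ R M N) (hMN : M ≤ N) {B : Matrix (Fin M) (Fin M) ℝ}
    (hB : ∀ k ∈ Finset.Ico (-(M : ℤ)) 0, ∀ m : ℤ, 0 ≤ m →
      ∑ i : Fin M, ∑ j : Fin M, srcPoly (poles α η θ) M i (poles α η θ k) * B i j *
        snkPoly (poles α η θ) N j (poles α η θ m) =
        numer (poles α η θ) N (poles α η θ k) * denom (poles α η θ) M (poles α η θ m) /
          (poles α η θ k - poles α η θ m)) {s t : ℤ} {x y : ℝ}
    (hs : -(M : ℤ) < s) (hs' : s < N) (ht : -(M : ℤ) < t) (ht' : t < N)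
    (hx : x ∈ Ioo (0 : ℝ) 1) (hy : y ∈ Ioo (0 : ℝ) 1) (hxy : s = t + 1 → x ≠ y) :
    Tendsto (fun ε : ℝ => KcVert M N α η θ δ ε s x t y) (𝓝[>] 0)
      (𝓝 (Kc M N α η θ δ R s x t y)) := by
  have hδ := h.pos
  have hline : ∀ (τ : ℝ) (k : ℤ), (δ : ℂ) + τ * Complex.I ≠ poles α η θ k := fun τ k =>
    ne_poles_of_re h (by simpa using by linarith) (by simp) k
  have hline' : ∀ (τ : ℝ) (k : ℤ), ((-δ : ℝ) : ℂ) + τ * Complex.I ≠ poles α η θ k := fun τ k =>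
    ne_poles_of_re h (by simp) (by simpa using by linarith) k
  have hr : 0 < x / y := div_pos hx.1 hy.1
  rw [Kc_eq hη hθ h hR hMN hB hs hs' ht ht' hx hy, corrKer_eq h hMN hB s t hx hy]
  unfold KcVert
  refine Tendsto.sub (Tendsto.const_mul _ ?_) ?_
  · refine (tendsto_vertInt_double h M N s t hx hy).congr fun ε => vertInt_congr fun τ => ?_
    rw [← vertInt_const_mul]
    exact vertInt_congr fun σ => (exp_mul_doubleIntegrand hη hθ hs hs' ht ht' hx hy h ε
      (hline τ) (hline' σ)).symm
  · split_ifs with hts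
    · refine Tendsto.const_mul _ ?_
      have hsingle : ∀ ε : ℝ, vertInt δ (fun z => gaussExp ε (Real.log (x / y)) z * 1 *
          ∑ k ∈ Finset.Ico t s, (coef (poles α η θ) t s k : ℂ) / (z - poles α η θ k)) =
          vertInt δ fun ζ => Complex.exp (ε * ζ ^ 2) * singleIntegrand M N α η θ s x t y ζ := by
        intro ε
        refine vertInt_congr fun τ => ?_
        rw [gaussExp_log hr, singleIntegrand, Fc_div_Fc hη hθ ht.le hts.le hs'.le
          (fun k _ => hline τ k), prod_step_eq_sum h hts fun k _ => hline τ k]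
        ring
      simp only [← hsingle]
      by_cases hne : x = y
      · have h1 : x / y = 1 := by rw [hne, div_self hy.1.ne']
        rw [h1, Real.log_one]
        have hst : s ≠ t + 1 := fun e => hxy e hne
        exact tendsto_vertInt_single_one h (by omega)
      · exact tendsto_vertInt_single h t s hr fun e => hne ((div_eq_one_iff_eq hy.1.ne').1 e)
    · exact tendsto_const_nhds

theorem time_mem (t : Time M N) : -(M : ℤ) < t ∧ (t : ℤ) < N := by
  have := Finset.mem_Icc.1 t.2
  omega

end MBP

end

open MeasureTheory Filter Topology in
theorem theorem4 (M N : ℕ) (hM : 1 ≤ M) (hMN : M ≤ N)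
    (α η θ : ℝ) (hα : 0 ≤ α) (hη : 0 < η) (hθ : 0 < θ)
    (δ R : ℝ) (hδ : 0 < δ) (hδη : δ < (α + η) / 2) (hδθ : δ < (α + θ) / 2)
    (hRη : α / 2 + η * (M - 1 / 2) < δ + 2 * R)
    (hRθ : α / 2 + θ * (N - 1 / 2) < δ + 2 * R) :
    -- the law is a probability measure
    IsProbabilityMeasure (MBP.law M N α η θ) ∧
    -- all correlation functions (times not necessarily distinct) are determinants of the kernel
    (∀ (n : ℕ) (t : Fin n → MBP.Time M N),
      IntegrableOn (MBP.corrDet M N α η θ δ R t) (MBP.cube n) ∧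
      ∀ B : Set (Fin n → ℝ), MeasurableSet B →
        (((MBP.corrMeasure M N α η θ t).real B : ℝ) : ℂ) =
          ∫ x in B ∩ MBP.cube n, MBP.corrDet M N α η θ δ R t x) ∧
    -- infinitesimal form at distinct times and positions
    (∀ (n : ℕ) (t : Fin n → MBP.Time M N), StrictMono t →
      ∀ x ∈ MBP.cube n, Function.Injective x →
        Tendsto
          (fun h : ℝ =>
            (((MBP.law M N α η θ).real
              {X | ∀ k, ∃ i, X (t k) i ∈ Set.Ioo (x k) (x k + h)} / h ^ n : ℝ) : ℂ))
          (𝓝[>] 0) (𝓝 (MBP.corrDet M N α η θ δ R t x))) ∧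
    -- the kernel is given by the integrals over vertical lines
    (∀ (s t : MBP.Time M N) (x y : ℝ), x ∈ Set.Ioo (0 : ℝ) 1 → y ∈ Set.Ioo (0 : ℝ) 1 →
      ((s : ℤ) = t + 1 → x ≠ y) →
        Tendsto (fun ε : ℝ => MBP.KcVert M N α η θ δ ε s x t y) (𝓝[>] 0)
          (𝓝 (MBP.Kc M N α η θ δ R s x t y))) := by
  have h := MBP.isPoles_poles hα hη hθ hδ hδη hδθ
  have hR := MBP.encloses_poles hM hη hθ hδη hRη hRθ
  obtain ⟨B, hB, hB'⟩ := MBP.exists_inverse h hMN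
  obtain ⟨hi, hpos, -⟩ := MBP.weight_correlations h hM hMN hB
  have hcube : ∀ n, MBP.cube n = MBP.unitCube (Fin n) := fun _ => rfl
  have hmeas : ∀ n, MeasurableSet (MBP.cube n) := fun _ =>
    MeasurableSet.univ_pi fun _ => measurableSet_Ioo
  refine ⟨MBP.isProbabilityMeasure_law hi hpos, fun n t => ⟨?_, fun S hS => ?_⟩,
    fun n t ht x hx hinj => ?_, fun s t x y hx hy hxy => ?_⟩
  · refine IntegrableOn.congr_fun (f := fun x => ((MBP.kerDet (MBP.poles α η θ) N B
      (fun k => (t k : ℤ)) x : ℝ) : ℂ)) ?_ (fun x hx =>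
        (MBP.corrDet_eq hη hθ h hR hMN hB' t hx).symm) (hmeas n)
    exact (MBP.integrableOn_kerDet h B fun k => (t k).2).ofReal
  · rw [MBP.corrMeasure_real_eq h hM hMN hB t hS, setIntegral_congr_fun
      (hS.inter (hmeas n)) fun x hx => MBP.corrDet_eq hη hθ h hR hMN hB' t hx.2, hcube]
    exact integral_ofReal.symm
  · rw [MBP.corrDet_eq hη hθ h hR hMN hB' t hx]
    exact (Complex.continuous_ofReal.tendsto _).comp
      (MBP.tendsto_prob_div_pow h hM hMN hB ht.injective (fun k => hx k trivial) hinj)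
  · exact MBP.tendsto_KcVert hη hθ h hR hMN hB' (MBP.time_mem s).1 (MBP.time_mem s).2
      (MBP.time_mem t).1 (MBP.time_mem t).2 hx hy hxy
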